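/- Let $M$ be a $C^\infty$ manifold (Hausdorff, second countable, without boundary). The space of distributions $C^{-\infty}(M)$ is the dual of the space of compactly supported complex smooth measures on $M$. Let $f\in C^\infty(M)$ be real valued without critical points on its zero set $S=\{p\in M: f(p)=0\}$, a closed submanifold of codimension one, with ideal sheaf $\mathcal I_S\subset\mathcal C^\infty_M$. A differential operator $D$ (linear, with $C^\infty$ coefficients) is *tangential to* $S$ if $D\,\mathcal I_S^{\,j}\subset\mathcal I_S^{\,j}$ for all $j\in\mathbb N$. A distribution $\sigma\in C^{-\infty}(M)$ *vanishes to order* $k$ along $S$ ($k\ge 0$ an integer) if every $p\in S$ has an open neighborhood $U_p$ on which $\sigma=\sum_{j=1}^N f_jD_jh_j$ as distributions, with $f_j\in C^\infty(U_p)$ vanishing to order $k$ on $S$ (sections of $\mathcal I_S^{\,k}$), $D_j$ differential operators on $U_p$ tangential to $S\cap U_p$, and $h_j$ measurable and locally bounded on $U_p$. It *vanishes to infinite order* along $S$ if it vanishes to order $k$ for every $k\ge0$. A *canonical extension* of a distribution on $M-S$ is an extension to $M$ that vanishes to infinite order along $S$. Let $\delta\in\mathbb Z/2\mathbb Z$ and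 $\alpha,\beta\in\mathbb C$. Complex powers are principal values; in particular $(\log|f|)^\beta$ is defined with $\arg(\log|f|)=\pi$ where $|f|<1$, and $0^0=1$. Assume either * (i) $|f(p)|\neq1$ for all $p\in M$, and $\beta$ ranges over $\mathbb C$; or * (ii) $f$ is arbitrary (as above), and $\beta=m\in\{0,1,2,\dots\}$ is fixed. In both cases the function $(\operatorname{sg}f)^\delta|f|^\alpha(\log|f|)^\beta$ is smooth on $M-S$, so that $(\operatorname{sg}f)^\delta|f|^\alpha(\log|f|)^\beta\sigma$ is a well-defined distribution on $M-S$ for every $\sigma\in C^{-\infty}(M)$. **Proposition.** Suppose that $\sigma\in C^{-\infty}(M)$ vanishes to order $k$ along $S$, where $k\geq 0$ is an integer. Then for all $\alpha$ with $\operatorname{Re}\alpha>-k-1$, and all $\beta$ as in (i) or (ii), the distribution $(\operatorname{sg}f)^\delta|f|^\alpha(\log|f|)^\beta\sigma$ on $M-S$ has an extension $\tau=\tau(\alpha,\beta)\in C^{-\infty}(M)$ such that: a) if $\ell$ is an integer with $0\le\ell<\operatorname{Re}\alpha+k$, or if $\beta=0$ and $0\le\ell\le\operatorname{Re}\alpha+k$,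 then $\tau(\alpha,\beta)$ vanishes to order $\ell$ along $S$; b) $\tau(\alpha,\beta)$ depends holomorphically on the parameters: for every compactly supported smooth measure $\mu$ on $M$, the integral of $\tau(\alpha,\beta)$ against $\mu$ is holomorphic in $(\alpha,\beta)$ on $\{(\alpha,\beta)\in\mathbb C^2:\operatorname{Re}\alpha>-k-1\}$ in case (i), and in $\alpha$ on $\{\alpha\in\mathbb C:\operatorname{Re}\alpha>-k-1\}$ for each $\beta=m$ in case (ii). The family of extensions is uniquely determined by a) and b): any two families of extensions, defined for $\operatorname{Re}\alpha>-k-1$, with these properties coincide. If $\sigma$ vanishes to infinite order along $S$, then for all $\alpha\in\mathbb C$, and all $\beta$ as in (i) or (ii), $(\operatorname{sg}f)^\delta|f|^\alpha(\log|f|)^\beta\sigma$ has a canonical extension. It is unique and, when integrated against any compactly supported smooth measure on $M$, it depends holomorphically on $(\alpha,\beta)\in\mathbb C^2$ in case (i), and on $\alpha\in\mathbb C$ for each $\beta=m$ in case (ii). -/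

import Mathlib

open Set Topology MeasureTheory TopologicalSpace
open scoped Manifold ContDiff

noncomputable section

namespace DistributionVanishing

/-- The model space `ℝⁿ` with its Euclidean structure and Lebesgue measure. -/
abbrev Eu (n : ℕ) : Type := EuclideanSpace ℝ (Fin n)

/-! ### Smooth measures and distributions on a manifold -/

section Manifold

variable {n : ℕ} {M : Type*} [TopologicalSpace M] [ChartedSpace (Eu n) M]

/-- The `C^∞` charts of `M`: the members of the maximal smooth atlas. -/
def IsSmoothChart (e : OpenPartialHomeomorph M (Eu n)) : Prop :=
  e ∈ IsManifold.maximalAtlas 𝓘(ℝ, Eu n) ∞ M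

/-- A (complex) measure on `M` which is absolutely continuous in coordinates is encoded by
a function `ρ : M → ℂ`: the value `ρ p` is its density at `p` with respect to Lebesgue measure in
the preferred chart `chartAt (Eu n) p` at `p`. If `x ↦ y` is the change of coordinates from
the chart `e` to the preferred chart at `p = e⁻¹(x)`, then `dy = |det (∂y/∂x)| dx`, so that
`densityCoord e ρ` is the density of the same measure with respect to Lebesgue measure in `e`. -/
def densityCoord (e : OpenPartialHomeomorph M (Eu n)) (ρ : M → ℂ) : Eu n → ℂ := fun x =>
  ρ (e.symm x) *
    ((|(fderiv ℝ (fun y => chartAt (Eu n) (e.symm x) (e.symm y)) x).det| : ℝ) : ℂ)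

/-- The space of smooth measures on `M` whose support is compact and contained in the open
set `U`: the density in every `C^∞` chart is a `C^∞` function. -/
def smoothMeasure (U : Opens M) : Submodule ℂ (M → ℂ) where
  carrier := {ρ | HasCompactSupport ρ ∧ tsupport ρ ⊆ U ∧
    ∀ e : OpenPartialHomeomorph M (Eu n), IsSmoothChart e →
      ContDiffOn ℝ ∞ (densityCoord e ρ) e.target}
  add_mem' := by
    rintro a b ⟨ha, ha', ha''⟩ ⟨hb, hb', hb''⟩
    refine ⟨ha.add hb, (tsupport_add a b).trans (union_subset ha' hb'), fun e he => ?_⟩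
    have h : densityCoord e (a + b) = fun x => densityCoord e a x + densityCoord e b x := by
      funext x; simp [densityCoord, add_mul]
    rw [h]
    exact (ha'' e he).add (hb'' e he)
  zero_mem' := by
    refine ⟨HasCompactSupport.zero, ?_, fun e _ => ?_⟩
    · simp [tsupport]
    · have h : densityCoord e (0 : M → ℂ) = fun _ => 0 := by funext x; simp [densityCoord]
      rw [h]
      exact contDiffOn_const
  smul_mem' := by
    rintro c a ⟨ha, ha', ha''⟩
    have hs : tsupport (c • a) ⊆ tsupport a :=
      closure_mono (Function.support_const_smul_subset c a)
    refine ⟨ha.mono' (subset_closure.trans hs), hs.trans ha', fun e he => ?_⟩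
    have h : densityCoord e (c • a) = fun x => c * densityCoord e a x := by
      funext x; simp [densityCoord, mul_assoc]
    rw [h]
    exact contDiffOn_const.mul (ha'' e he)

/-- Continuity of a linear functional on the compactly supported smooth measures on `U`, in the
usual (inductive limit) topology: for every compact subset of a coordinate neighbourhood, the
functional is bounded, on the smooth measures supported there, by finitely many of the sup norms
of the derivatives of the density. -/
def IsContinuousFunctional (U : Opens M) (T : smoothMeasure (n := n) U →ₗ[ℂ] ℂ) : Prop :=
  ∀ e : OpenPartialHomeomorph M (Eu n), IsSmoothChart e →
    ∀ K : Set (Eu n), IsCompact K → K ⊆ e.target → (∀ x ∈ K, e.symm x ∈ U) →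
      ∃ (C : ℝ) (N : ℕ), ∀ μ : smoothMeasure (n := n) U,
        (∀ p : M, (μ : M → ℂ) p ≠ 0 → p ∈ e.source ∧ e p ∈ K) →
          ∀ B : ℝ, 0 ≤ B →
            (∀ m ≤ N, ∀ x ∈ K, ‖iteratedFDeriv ℝ m (densityCoord e μ) x‖ ≤ B) →
              ‖T μ‖ ≤ C * B

variable (n) in
/-- Distributions on the open subset `U` of `M`: continuous linear functionals on the space of
compactly supported smooth measures on `U`. -/
structure Distr (U : Opens M) where
  toLinearMap : smoothMeasure (n := n) U →ₗ[ℂ] ℂ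
  continuous' : IsContinuousFunctional U toLinearMap

/-- `σ μ` is the integral of the distribution `σ` against the smooth measure `μ`. -/
instance (U : Opens M) : CoeFun (Distr n U) (fun _ => smoothMeasure (n := n) U → ℂ) :=
  ⟨fun σ μ => σ.toLinearMap μ⟩

theorem smoothMeasure_mono {U V : Opens M} (h : V ≤ U) :
    smoothMeasure (n := n) V ≤ smoothMeasure (n := n) U :=
  fun _ hρ => ⟨hρ.1, hρ.2.1.trans h, hρ.2.2⟩

/-- Restriction of a distribution to a smaller open set. -/
def Distr.restrict {U V : Opens M} (h : V ≤ U) (σ : Distr n U) : Distr n V where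
  toLinearMap := σ.toLinearMap ∘ₗ Submodule.inclusion (smoothMeasure_mono h)
  continuous' := by
    intro e he K hK hKe hKV
    obtain ⟨C, N, hC⟩ := σ.continuous' e he K hK hKe fun x hx => h (hKV x hx)
    exact ⟨C, N, fun μ hμ B hB hb =>
      hC (Submodule.inclusion (smoothMeasure_mono h) μ) hμ B hB hb⟩

theorem densityCoord_mul (e : OpenPartialHomeomorph M (Eu n)) (g ρ : M → ℂ) :
    densityCoord e (g * ρ) = fun x => g (e.symm x) * densityCoord e ρ x := by
  funext x; simp [densityCoord, mul_assoc]

theorem contDiffOn_comp_symm {U : Opens M} {g : M → ℂ}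
    (hg : ContMDiffOn 𝓘(ℝ, Eu n) 𝓘(ℝ, ℂ) ∞ g U)
    {e : OpenPartialHomeomorph M (Eu n)} (he : IsSmoothChart e) :
    ContDiffOn ℝ ∞ (fun x => g (e.symm x)) (e.target ∩ e.symm ⁻¹' U) := by
  have h1 := contMDiffOn_symm_of_mem_maximalAtlas (I := 𝓘(ℝ, Eu n)) he
  have h2 := hg.comp (h1.mono inter_subset_left)
    (s := e.target ∩ e.symm ⁻¹' (U : Set M)) (fun x hx => hx.2)
  exact h2.contDiffOn

/-- The product of a smooth measure, compactly supported in `U`, with a smooth function on `U`,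
extended by zero. -/
theorem mul_mem_smoothMeasure {U : Opens M} {g : M → ℂ}
    (hg : ContMDiffOn 𝓘(ℝ, Eu n) 𝓘(ℝ, ℂ) ∞ g U) {ρ : M → ℂ}
    (hρ : ρ ∈ smoothMeasure (n := n) U) : g * ρ ∈ smoothMeasure (n := n) U := by
  refine ⟨hρ.1.mul_left, (tsupport_mul_subset_right).trans hρ.2.1, fun e he => ?_⟩
  rw [densityCoord_mul]
  intro x hx
  by_cases hxU : e.symm x ∈ U
  · have ho : IsOpen (e.target ∩ e.symm ⁻¹' (U : Set M)) :=
      e.isOpen_inter_preimage_symm U.isOpen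
    have h1 := (contDiffOn_comp_symm hg he).contDiffAt (ho.mem_nhds ⟨hx, hxU⟩)
    exact h1.contDiffWithinAt.mul (hρ.2.2 e he x hx)
  · have hc : IsOpen (e.target ∩ e.symm ⁻¹' (tsupport ρ)ᶜ) :=
      e.isOpen_inter_preimage_symm (isClosed_tsupport ρ).isOpen_compl
    have hmem : x ∈ e.target ∩ e.symm ⁻¹' (tsupport ρ)ᶜ := ⟨hx, fun h => hxU (hρ.2.1 h)⟩
    have hev : (fun x => g (e.symm x) * densityCoord e ρ x) =ᶠ[𝓝 x] fun _ => (0 : ℂ) := by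
      filter_upwards [hc.mem_nhds hmem] with y hy
      have : ρ (e.symm y) = 0 := image_eq_zero_of_notMem_tsupport hy.2
      simp [densityCoord, this]
    exact (contDiffAt_const.congr_of_eventuallyEq hev).contDiffWithinAt

/-- Multiplication of smooth measures by a function which is smooth on `U`. -/
def mulMeasure {U : Opens M} (g : M → ℂ) (hg : ContMDiffOn 𝓘(ℝ, Eu n) 𝓘(ℝ, ℂ) ∞ g U) :
    smoothMeasure (n := n) U →ₗ[ℂ] smoothMeasure (n := n) U where
  toFun μ := ⟨g * (μ : M → ℂ), mul_mem_smoothMeasure hg μ.2⟩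
  map_add' a b := by ext p; simp [mul_add]
  map_smul' c a := by ext p; simp [mul_left_comm]

theorem isContinuousFunctional_mul {U : Opens M} {g : M → ℂ}
    (hg : ContMDiffOn 𝓘(ℝ, Eu n) 𝓘(ℝ, ℂ) ∞ g U) (σ : Distr n U) :
    IsContinuousFunctional U (σ.toLinearMap ∘ₗ mulMeasure g hg) := by
  intro e he K hK hKe hKU
  obtain ⟨C, N, hC⟩ := σ.continuous' e he K hK hKe hKU
  set O : Set (Eu n) := e.target ∩ e.symm ⁻¹' (U : Set M) with hO
  have ho : IsOpen O := e.isOpen_inter_preimage_symm U.isOpen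
  have hKO : K ⊆ O := fun x hx => ⟨hKe hx, hKU x hx⟩
  have hG := contDiffOn_comp_symm hg he
  have hbd : ∀ i : ℕ, ∃ A : ℝ, 0 ≤ A ∧
      ∀ x ∈ K, ‖iteratedFDerivWithin ℝ i (fun x => g (e.symm x)) O x‖ ≤ A := by
    intro i
    have hcont := (hG.continuousOn_iteratedFDerivWithin (m := i)
      (by exact_mod_cast le_top) ho.uniqueDiffOn).mono hKO
    obtain ⟨A, hA⟩ := hK.exists_bound_of_continuousOn hcont
    exact ⟨max A 0, le_max_right _ _, fun x hx => (hA x hx).trans (le_max_left _ _)⟩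
  choose A hA0 hA using hbd
  refine ⟨C * ∑ m ∈ Finset.range (N + 1), ∑ i ∈ Finset.range (m + 1), (m.choose i : ℝ) * A i, N,
    fun μ hμ B hB hb => ?_⟩
  rw [mul_assoc]
  have hin : ∀ m, 0 ≤ ∑ i ∈ Finset.range (m + 1), (m.choose i : ℝ) * A i := fun m =>
    Finset.sum_nonneg fun i _ => mul_nonneg (Nat.cast_nonneg _) (hA0 i)
  refine hC (mulMeasure g hg μ) (fun p hp => hμ p fun h0 => hp ?_) _
    (mul_nonneg (Finset.sum_nonneg fun m _ => hin m) hB) fun m hm x hx => ?_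
  · change g p * (μ : M → ℂ) p = 0
    rw [h0, mul_zero]
  · change ‖iteratedFDeriv ℝ m (densityCoord e (g * (μ : M → ℂ))) x‖ ≤ _
    rw [densityCoord_mul, ← iteratedFDerivWithin_of_isOpen m ho (hKO hx)]
    have hu : ContDiffOn ℝ ∞ (densityCoord e (μ : M → ℂ)) O :=
      (μ.2.2.2 e he).mono inter_subset_left
    refine (norm_iteratedFDerivWithin_mul_le (N := ∞) hG hu ho.uniqueDiffOn (hKO hx)
      (by exact_mod_cast le_top)).trans ?_
    have h1 : ∑ i ∈ Finset.range (m + 1), (m.choose i : ℝ) *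
          ‖iteratedFDerivWithin ℝ i (fun x => g (e.symm x)) O x‖ *
          ‖iteratedFDerivWithin ℝ (m - i) (densityCoord e (μ : M → ℂ)) O x‖ ≤
        (∑ i ∈ Finset.range (m + 1), (m.choose i : ℝ) * A i) * B := by
      rw [Finset.sum_mul]
      refine Finset.sum_le_sum fun i _ => ?_
      have h2 := hb (m - i) ((Nat.sub_le m i).trans hm) x hx
      rw [← iteratedFDerivWithin_of_isOpen (m - i) ho (hKO hx)] at h2
      have h3 := hA i x hx
      have h4 := hA0 i
      gcongr
    refine h1.trans (mul_le_mul_of_nonneg_right ?_ hB)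
    exact Finset.single_le_sum
      (f := fun m => ∑ i ∈ Finset.range (m + 1), (m.choose i : ℝ) * A i)
      (fun m _ => hin m) (Finset.mem_range.2 (Nat.lt_succ_of_le hm))

/-- The product `g σ` of a distribution `σ` on `U` with a smooth function `g` on `U`:
the integral of `g σ` against `μ` is the integral of `σ` against `g μ`. -/
def Distr.mul {U : Opens M} (g : M → ℂ) (hg : ContMDiffOn 𝓘(ℝ, Eu n) 𝓘(ℝ, ℂ) ∞ g U)
    (σ : Distr n U) : Distr n U where
  toLinearMap := σ.toLinearMap ∘ₗ mulMeasure g hg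
  continuous' := isContinuousFunctional_mul hg σ

end Manifold

/-! ### Differential operators in coordinates, and tangentiality -/

section Coordinates

variable {n : ℕ}

/-- The iterated partial derivative `∂_{i₁} ⋯ ∂_{i_m} u`, for the word `[i₁, …, i_m]`. -/
def iterPartial : List (Fin n) → (Eu n → ℂ) → Eu n → ℂ
  | [], u => u
  | i :: w, u => fun x => fderiv ℝ (iterPartial w u) x (EuclideanSpace.single i 1)

/-- A linear differential operator `∑_w a_w ∂_w` (finite sum) with `C^∞` coefficients
on an open set `V` of `ℝⁿ`. -/
structure DiffOp (V : Opens (Eu n)) where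
  terms : Finset (List (Fin n))
  coeff : List (Fin n) → Eu n → ℂ
  smooth : ∀ w ∈ terms, ContDiffOn ℝ ∞ (coeff w) V

/-- The function `D u`. -/
def DiffOp.apply {V : Opens (Eu n)} (D : DiffOp V) (u : Eu n → ℂ) : Eu n → ℂ := fun x =>
  ∑ w ∈ D.terms, D.coeff w x * iterPartial w u x

/-- The function `Dᵗ u`, for the formal transpose `Dᵗ = ∑_w (-1)^{|w|} ∂_{w reversed} ∘ a_w` of `D`
with respect to Lebesgue measure. -/
def DiffOp.transpose {V : Opens (Eu n)} (D : DiffOp V) (u : Eu n → ℂ) : Eu n → ℂ := fun x =>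
  ∑ w ∈ D.terms, (-1 : ℂ) ^ w.length * iterPartial w.reverse (fun y => D.coeff w y * u y) x

/-- `u` is a section over `W` of the `k`-th power of the ideal sheaf of `S`: locally, `u` is a
finite sum of products of a smooth function with `k` smooth functions vanishing on `S`.
These are the smooth functions on `W` which vanish to order `k` on `S`. -/
def InIdealPow (S : Set (Eu n)) (k : ℕ) (W : Opens (Eu n)) (u : Eu n → ℂ) : Prop :=
  ∀ p ∈ W, ∃ W' : Opens (Eu n), p ∈ W' ∧ W' ≤ W ∧
    ∃ (N : ℕ) (c : Fin N → Eu n → ℂ) (g : Fin N → Fin k → Eu n → ℂ),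
      (∀ i, ContDiffOn ℝ ∞ (c i) W') ∧ (∀ i j, ContDiffOn ℝ ∞ (g i j) W') ∧
      (∀ i j, ∀ x ∈ W', x ∈ S → g i j x = 0) ∧
      ∀ x ∈ W', u x = ∑ i, c i x * ∏ j, g i j x

/-- `D` is tangential to `S`: it maps each power of the ideal sheaf of `S` to itself. -/
def DiffOp.IsTangential {V : Opens (Eu n)} (D : DiffOp V) (S : Set (Eu n)) : Prop :=
  ∀ (k : ℕ) (W : Opens (Eu n)), W ≤ V → ∀ u : Eu n → ℂ,
    InIdealPow S k W u → InIdealPow S k W (D.apply u)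

/-- Measurable, locally bounded functions on the open set `V`. -/
def IsLocBounded (V : Opens (Eu n)) (h : Eu n → ℂ) : Prop :=
  ∀ K : Set (Eu n), IsCompact K → K ⊆ V → MemLp h ⊤ (volume.restrict K)

end Coordinates

/-! ### Vanishing of a distribution along a submanifold -/

section Vanishing

variable {n : ℕ} {M : Type*} [TopologicalSpace M] [ChartedSpace (Eu n) M]

/-- `σ` vanishes to order `k` along `S`: near every point of `S`, on some coordinate neighbourhood
`U_p = e⁻¹(V)`, one has `σ = ∑ f_j D_j h_j` as distributions, with `f_j` smooth and vanishing to
order `k` on `S`, with `D_j` a differential operator tangential to `S`, and with `h_j` measurable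
and locally bounded. All of these are written in the coordinates `e`, and the identity is tested
on all smooth measures `μ` with compact support in `U_p`. -/
def VanishesToOrder (S : Set M) (k : ℕ) (σ : Distr n (⊤ : Opens M)) : Prop :=
  ∀ p ∈ S, ∃ (e : OpenPartialHomeomorph M (Eu n)) (V : Opens (Eu n)),
    IsSmoothChart e ∧ p ∈ e.source ∧ e p ∈ V ∧ (V : Set (Eu n)) ⊆ e.target ∧
    ∃ (N : ℕ) (f : Fin N → Eu n → ℂ) (D : Fin N → DiffOp V) (h : Fin N → Eu n → ℂ),
      (∀ j, InIdealPow (e.symm ⁻¹' S) k V (f j)) ∧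
      (∀ j, (D j).IsTangential (e.symm ⁻¹' S)) ∧
      (∀ j, IsLocBounded V (h j)) ∧
      ∀ μ : smoothMeasure (n := n) (⊤ : Opens M),
        tsupport (μ : M → ℂ) ⊆ e.source ∩ e ⁻¹' (V : Set (Eu n)) →
          σ μ = ∑ j, ∫ x in (V : Set (Eu n)),
            h j x * (D j).transpose (fun y => f j y * densityCoord e μ y) x

/-- `σ` vanishes to infinite order along `S`. -/
def VanishesToInfiniteOrder (S : Set M) (σ : Distr n (⊤ : Opens M)) : Prop :=
  ∀ k : ℕ, VanishesToOrder S k σ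

/-- `τ` extends the distribution `η`, given on the open subset `U`, to all of `M`. -/
def IsExtension {U : Opens M} (η : Distr n U) (τ : Distr n (⊤ : Opens M)) : Prop :=
  τ.restrict le_top = η

/-- `τ` is a canonical extension across the closed set `S = M - U` of the distribution `η`
on `U = M - S`: it extends `η` and vanishes to infinite order along `S`. -/
def IsCanonicalExtension {U : Opens M} (η : Distr n U) (τ : Distr n (⊤ : Opens M)) : Prop :=
  IsExtension η τ ∧ VanishesToInfiniteOrder ((U : Set M)ᶜ) τ

end Vanishing

/-! ### The functions `(sg f)^δ |f|^α (log |f|)^β` -/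

section Weight

variable {M : Type*} [TopologicalSpace M]

/-- The complement of the zero set of a continuous function, as an open set. -/
def nonzeroSet (f : M → ℝ) (hf : Continuous f) : Opens M :=
  ⟨{p | f p ≠ 0}, isOpen_ne_fun hf continuous_const⟩

/-- `(sg f)^δ |f|^α (log |f|)^β`, where `δ ∈ ℤ/2ℤ`; complex powers are principal values. -/
def weight (f : M → ℝ) (δ : ZMod 2) (α β : ℂ) (p : M) : ℂ :=
  ((SignType.sign (f p) : ℝ) : ℂ) ^ δ.val * ((|f p| : ℝ) : ℂ) ^ α *
    ((Real.log |f p| : ℝ) : ℂ) ^ β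

end Weight

/-! ### Extensions of `(sg f)^δ |f|^α (log |f|)^β σ` -/

section Extension

variable {n : ℕ} {M : Type*} [TopologicalSpace M] [ChartedSpace (Eu n) M]

/-- `(sg f)^δ |f|^α (log |f|)^β` is smooth on `M - S`, where `S = {f = 0}`, and `τ` extends the
distribution `(sg f)^δ |f|^α (log |f|)^β σ` on `M - S` to `M`. -/
def ExtendsWeighted (f : M → ℝ) (hf : Continuous f) (δ : ZMod 2) (α β : ℂ)
    (σ τ : Distr n (⊤ : Opens M)) : Prop :=
  ∃ hg : ContMDiffOn 𝓘(ℝ, Eu n) 𝓘(ℝ, ℂ) ∞ (weight f δ α β) (nonzeroSet f hf),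
    IsExtension ((σ.restrict (le_top : nonzeroSet f hf ≤ ⊤)).mul (weight f δ α β) hg) τ

/-- `(sg f)^δ |f|^α (log |f|)^β` is smooth on `M - S`, where `S = {f = 0}`, and `τ` is a canonical
extension of the distribution `(sg f)^δ |f|^α (log |f|)^β σ` on `M - S` across `S`. -/
def CanonicallyExtendsWeighted (f : M → ℝ) (hf : Continuous f) (δ : ZMod 2) (α β : ℂ)
    (σ τ : Distr n (⊤ : Opens M)) : Prop :=
  ∃ hg : ContMDiffOn 𝓘(ℝ, Eu n) 𝓘(ℝ, ℂ) ∞ (weight f δ α β) (nonzeroSet f hf),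
    IsCanonicalExtension ((σ.restrict (le_top : nonzeroSet f hf ≤ ⊤)).mul (weight f δ α β) hg) τ

/-- The order of vanishing of an extension `τ` with parameters `α`, `β`: it vanishes along `S` to
every integral order `0 ≤ ℓ < Re α + k`, and if `β = 0` to every order `0 ≤ ℓ ≤ Re α + k`. -/
def HasExpectedOrder (S : Set M) (k : ℕ) (α β : ℂ) (τ : Distr n (⊤ : Opens M)) : Prop :=
  ∀ ℓ : ℕ, ((ℓ : ℝ) < α.re + k ∨ (β = 0 ∧ (ℓ : ℝ) ≤ α.re + k)) → VanishesToOrder S ℓ τ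

/-- A family `τ(α, β)`, `Re α > -k - 1`, of extensions of `(sg f)^δ |f|^α (log |f|)^β σ` which
have the expected order of vanishing and depend holomorphically on `(α, β)`. -/
structure IsExtensionFamily (f : M → ℝ) (hf : Continuous f) (δ : ZMod 2) (k : ℕ)
    (σ : Distr n (⊤ : Opens M)) (τ : ℂ → ℂ → Distr n (⊤ : Opens M)) : Prop where
  extends_weighted : ∀ α β : ℂ, -(k : ℝ) - 1 < α.re → ExtendsWeighted f hf δ α β σ (τ α β)
  order : ∀ α β : ℂ, -(k : ℝ) - 1 < α.re → HasExpectedOrder {p | f p = 0} k α β (τ α β)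
  holomorphic : ∀ μ : smoothMeasure (n := n) (⊤ : Opens M),
    DifferentiableOn ℂ (fun z : ℂ × ℂ => τ z.1 z.2 μ) {z | -(k : ℝ) - 1 < z.1.re}

/-- The same with a fixed exponent `β` of the logarithm: a family `τ(α)`, `Re α > -k - 1`, which
depends holomorphically on `α`. -/
structure IsExtensionFamilyAt (f : M → ℝ) (hf : Continuous f) (δ : ZMod 2) (k : ℕ) (β : ℂ)
    (σ : Distr n (⊤ : Opens M)) (τ : ℂ → Distr n (⊤ : Opens M)) : Prop where
  extends_weighted : ∀ α : ℂ, -(k : ℝ) - 1 < α.re → ExtendsWeighted f hf δ α β σ (τ α)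
  order : ∀ α : ℂ, -(k : ℝ) - 1 < α.re → HasExpectedOrder {p | f p = 0} k α β (τ α)
  holomorphic : ∀ μ : smoothMeasure (n := n) (⊤ : Opens M),
    DifferentiableOn ℂ (fun α : ℂ => τ α μ) {α | -(k : ℝ) - 1 < α.re}

end Extension

end DistributionVanishing

end

open DistributionVanishing

open Set Topology MeasureTheory TopologicalSpace
open scoped Manifold ContDiff

noncomputable section

namespace DistributionVanishing

/-! ### Hadamard's lemma and coordinates straightening the zero set. -/

section

/-! Near a point of `S` the function `f` can serve as a coordinate, so `I_S^k` is generated by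
`f^k`, and `σ` is a finite sum of terms `f^k c D h` with `c` smooth, `D` tangential and `h` locally
bounded. Multiplication by the weight produces a function of `log |f|` in front of `D`, and
everything depends on carrying that function across `D` to the side of `h`, where it only has to be
integrable.

Two facts make this possible. Since `D` preserves the ideal `(f^b)`, the conjugates `F_b = f^{-b} D
f^b` are again operators with smooth coefficients, and tangential (`RegularOn.exists_conj`).
Moreover, if `D` has order at most `m`, then `Dᵗ(G(log |f|) v)(x)` depends on `G` only through its
`m`-jet at `log |f(x)|`. That jet can be matched by a combination of the exponentials `e^{-b s}`, `b
= 0, …, m` (a Vandermonde system), and these are powers of `1/|f|`, for which the answer is given by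
`F_b`. Hence `Dᵗ(G(log |f|) v) = ∑_b G_b(log |f|) F_bᵗ v`, where `G_b` is a constant-coefficient
combination of the derivatives of `G` (`transpose_jet_mul`).

For `G(s) = e^{γ s} s^β` the `G_b` are `O(e^{(Re γ - η) s})` as `s → -∞`, for every `η > 0`, and
even for `η = 0` if `β = 0`. Writing the weight times `f^k` as `f^ℓ` times a sign and `|f|^γ (log
|f|)^β` with `γ = α + k - ℓ`, one finds that `h G_b` is locally integrable if `Re γ > -1`, and
locally bounded if `Re γ > 0`, or if `β = 0` and `Re γ ≥ 0`. The case `ℓ = 0` gives the extension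
for `Re α > -k - 1`; the other values of `ℓ` exhibit its order of vanishing.

To avoid gluing, the extension is defined globally as the limit of `σ` multiplied by the weight cut
off where `|f| < 1/ν`. In the variable `log |f|` these cutoffs are translates of one function, so
their derivatives are bounded uniformly in `ν` and dominated convergence identifies the limit with
the local integrals (`LocalTerm.tendsto_integral_cut`). Continuity and holomorphy are then local:
near `S` they follow from uniform integrable bounds, and off `S` the weight is a smooth function
depending exponentially on the exponents.

For uniqueness, a distribution vanishing to order `0` is the limit of its own cutoffs, so it is
determined by its restriction to `M - S` (`eq_of_eq_on_nonzeroSet`). This applies for `Re α > -k`,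
and the identity theorem covers the remaining strip. If `σ` vanishes to infinite order, any given
`α` is reached by a large `k`; the same limit serves every `k`. -/

theorem contDiff_nat_integral_param {E : Type} [NormedAddCommGroup E] [NormedSpace ℝ E]
    [FiniteDimensional ℝ E] (m : ℕ) : ∀ {G : Type} [NormedAddCommGroup G] [NormedSpace ℝ G]
    [CompleteSpace G] {F : E × ℝ → G}, ContDiff ℝ ∞ F →
      ContDiff ℝ m (fun x => ∫ t in (0 : ℝ)..1, F (x, t)) := by
  have hprop : ProperSpace E := FiniteDimensional.proper ℝ E
  -- The target space `G` has to vary in the induction: the derivative of the integral takes values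
  -- in `E →L[ℝ] G`.
  induction m with
  | zero =>
    intro G _ _ _ F hF
    refine contDiff_zero.2 ?_
    exact intervalIntegral.continuous_parametric_intervalIntegral_of_continuous'
      (f := fun x t => F (x, t)) (by simpa [Function.uncurry_def] using hF.continuous) 0 1
  | succ m ih =>
    intro G _ _ _ F hF
    set F' : E × ℝ → E →L[ℝ] G := fun z => (fderiv ℝ F z).comp (ContinuousLinearMap.inl ℝ E ℝ)
      with hF'
    have hF's : ContDiff ℝ ∞ F' :=
      (hF.fderiv_right (m := ∞) (by simp)).clm_comp contDiff_const
    push_cast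
    refine contDiff_succ_iff_hasFDerivAt.2 ⟨fun x => ∫ t in (0 : ℝ)..1, F' (x, t), ih hF's,
      fun x => ?_⟩
    obtain ⟨C, hC⟩ := ((isCompact_closedBall x 1).prod (isCompact_Icc (a := (0 : ℝ)) (b := 1))
      ).exists_bound_of_continuousOn hF's.continuous.continuousOn
    refine (intervalIntegral.hasFDerivAt_integral_of_dominated_of_fderiv_le
      (F := fun x t => F (x, t)) (F' := fun x t => F' (x, t)) (bound := fun _ => C)
      (Metric.closedBall_mem_nhds x one_pos) ?_ ?_ ?_ ?_ ?_ ?_)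
    · exact Filter.Eventually.of_forall fun y =>
        (hF.continuous.comp (by fun_prop : Continuous fun t : ℝ => (y, t))).aestronglyMeasurable
    · exact (hF.continuous.comp (by fun_prop : Continuous fun t : ℝ => (x, t))).intervalIntegrable _ _
    · exact (hF's.continuous.comp
        (by fun_prop : Continuous fun t : ℝ => (x, t))).aestronglyMeasurable
    · refine Filter.Eventually.of_forall fun t ht y hy => hC (y, t) ⟨hy, ?_⟩
      rw [uIoc_of_le zero_le_one] at ht
      exact ⟨ht.1.le, ht.2⟩
    · exact intervalIntegrable_const
    · refine Filter.Eventually.of_forall fun t _ y _ => ?_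
      exact ((hF.differentiable (by simp)) (y, t)).hasFDerivAt.comp y (hasFDerivAt_prodMk_left y t)

theorem contDiff_integral_param {E G : Type} [NormedAddCommGroup E] [NormedSpace ℝ E]
    [FiniteDimensional ℝ E] [NormedAddCommGroup G] [NormedSpace ℝ G]
    [CompleteSpace G] {F : E × ℝ → G} (hF : ContDiff ℝ ∞ F) :
    ContDiff ℝ ∞ (fun x => ∫ t in (0 : ℝ)..1, F (x, t)) :=
  contDiff_infty.2 fun m => contDiff_nat_integral_param m hF

variable {n : ℕ}

/-- The `i`-th standard basis vector. -/
abbrev stdVec (i : Fin n) : Eu n := EuclideanSpace.single i (1 : ℝ)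

/-- Hadamard's lemma. The path `y + ((t - 1) y_i) e_i` runs from the projection of `y` to the
hyperplane, where `v = 0`, at `t = 0` to `y` at `t = 1`; its velocity `y_i e_i` supplies the factor.
-/
theorem exists_eq_coord_mul {v : Eu n → ℂ} (hv : ContDiff ℝ ∞ v) (i : Fin n)
    (h0 : ∀ y : Eu n, y i = 0 → v y = 0) :
    ∃ c : Eu n → ℂ, ContDiff ℝ ∞ c ∧ ∀ y, v y = (y i : ℂ) * c y := by
  have hcoord : ContDiff ℝ ∞ (fun y : Eu n => y i) :=
    (EuclideanSpace.proj (𝕜 := ℝ) i).contDiff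
  refine ⟨fun y => ∫ t in (0 : ℝ)..1, fderiv ℝ v (y + ((t - 1) * y i) • stdVec i) (stdVec i),
    contDiff_integral_param
      (F := fun z : Eu n × ℝ => fderiv ℝ v (z.1 + ((z.2 - 1) * z.1 i) • stdVec i) (stdVec i)) ?_,
    fun y => ?_⟩
  · have h1 : ContDiff ℝ ∞ (fun z : Eu n × ℝ => z.1 + ((z.2 - 1) * z.1 i) • stdVec i) :=
      contDiff_fst.add (((contDiff_snd.sub contDiff_const).mul
        (hcoord.comp contDiff_fst)).smul contDiff_const)
    exact ((hv.fderiv_right (m := ∞) (by simp)).comp h1).clm_apply contDiff_const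
  · have hd : ∀ t : ℝ, HasDerivAt (fun t : ℝ => v (y + ((t - 1) * y i) • stdVec i))
        ((y i : ℂ) * fderiv ℝ v (y + ((t - 1) * y i) • stdVec i) (stdVec i)) t := by
      intro t
      have h1 : HasDerivAt (fun t : ℝ => y + ((t - 1) * y i) • stdVec i) (y i • stdVec i) t := by
        have := ((((hasDerivAt_id t).sub_const 1).mul_const (y i)).smul_const
          (stdVec i)).const_add y
        simpa using this
      have h2 := ((hv.differentiable (by simp)) (y + ((t - 1) * y i) • stdVec i)
        ).hasFDerivAt.comp_hasDerivAt t h1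
      rw [map_smul, Complex.real_smul] at h2
      exact h2
    have hcont : Continuous fun t : ℝ =>
        (y i : ℂ) * fderiv ℝ v (y + ((t - 1) * y i) • stdVec i) (stdVec i) := by
      have h3 : Continuous (fderiv ℝ v) := hv.continuous_fderiv (by simp)
      fun_prop
    have := intervalIntegral.integral_eq_sub_of_hasDerivAt (fun t _ => hd t)
      (hcont.intervalIntegrable 0 1)
    rw [intervalIntegral.integral_const_mul] at this
    rw [this]
    have h5 : v (y + ((0 - 1 : ℝ) * y i) • stdVec i) = 0 := h0 _ (by simp)
    rw [h5]
    simp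

/-- Near a noncritical zero of `f`, one may use `f` as one of the coordinates. -/
theorem exists_straightening {V : Set (Eu n)} (hV : IsOpen V) {f : Eu n → ℝ}
    (hf : ContDiffOn ℝ ∞ f V) {p : Eu n} (hp : p ∈ V) (hd : fderiv ℝ f p ≠ 0) :
    ∃ (i : Fin n) (Φ : OpenPartialHomeomorph (Eu n) (Eu n)), p ∈ Φ.source ∧ Φ.source ⊆ V ∧
      (∀ x, Φ x i = f x) ∧ ContDiffOn ℝ ∞ Φ Φ.source ∧ ContDiffOn ℝ ∞ Φ.symm Φ.target ∧
      (∀ x ∈ Φ.source, (fderiv ℝ Φ x).det ≠ 0) := by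
  obtain ⟨i, hi⟩ : ∃ i, fderiv ℝ f p (stdVec i) ≠ 0 := by
    by_contra! h
    refine hd (ContinuousLinearMap.coe_injective ?_)
    refine (EuclideanSpace.basisFun (Fin n) ℝ).toBasis.ext fun j => ?_
    simpa using h j
  -- The `i`-th coordinate is replaced by `f`, the others are kept; `∂_i f(p) ≠ 0` makes this a
  -- local diffeomorphism.
  set φ : Eu n → Eu n := fun x => x + (f x - x i) • stdVec i with hφ
  have hcoord : ContDiff ℝ ∞ (fun y : Eu n => y i) :=
    (EuclideanSpace.proj (𝕜 := ℝ) i).contDiff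
  have hφs : ContDiffOn ℝ ∞ φ V :=
    contDiffOn_id.add ((hf.sub hcoord.contDiffOn).smul contDiffOn_const)
  have hφd : ∀ x ∈ V, ContDiffAt ℝ ∞ φ x := fun x hx => hφs.contDiffAt (hV.mem_nhds hx)
  have hdet : ContinuousOn (fun x => (fderiv ℝ φ x).det) V :=
    ContinuousLinearMap.continuous_det.comp_continuousOn
      (hφs.continuousOn_fderiv_of_isOpen hV (by simp))
  have hder : HasFDerivAt φ (ContinuousLinearMap.id ℝ (Eu n) +
      (fderiv ℝ f p - EuclideanSpace.proj i).smulRight (stdVec i)) p := by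
    have h1 : HasFDerivAt f (fderiv ℝ f p) p :=
      ((hf.contDiffAt (hV.mem_nhds hp)).differentiableAt (by simp)).hasFDerivAt
    have h2 : HasFDerivAt (fun y : Eu n => y i) (EuclideanSpace.proj (𝕜 := ℝ) i) p :=
      (EuclideanSpace.proj (𝕜 := ℝ) i).hasFDerivAt
    exact (hasFDerivAt_id p).add ((h1.sub h2).smul_const (stdVec i))
  have hdet0 : (fderiv ℝ φ p).det ≠ 0 := by
    rw [hder.fderiv]
    change LinearMap.det _ ≠ 0
    -- A kernel vector `v` is a multiple of `e_i`, and comparing `i`-th coordinates gives `df(v) =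
    -- 0`; since `df(e_i) ≠ 0`, it vanishes.
    have hinj : Function.Injective ((ContinuousLinearMap.id ℝ (Eu n) +
        (fderiv ℝ f p - EuclideanSpace.proj i).smulRight (stdVec i) : Eu n →L[ℝ] Eu n) :
        Eu n →ₗ[ℝ] Eu n) := by
      refine (injective_iff_map_eq_zero _).2 fun v hv => ?_
      have hv' : v + (fderiv ℝ f p v - v i) • stdVec i = 0 := by simpa using hv
      have hv2 : v = (-(fderiv ℝ f p v - v i)) • stdVec i := by
        rw [neg_smul]; exact eq_neg_of_add_eq_zero_left hv'
      have h3 : fderiv ℝ f p v = 0 := by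
        have := congrArg (fun w : Eu n => w i) hv'
        simpa using this
      have h4 : fderiv ℝ f p v = (-(fderiv ℝ f p v - v i)) * fderiv ℝ f p (stdVec i) := by
        conv_lhs => rw [hv2]
        rw [map_smul, smul_eq_mul]
      rw [h3] at h4
      have h5 : v i = 0 := by
        rcases mul_eq_zero.1 h4.symm with h | h
        · linarith
        · exact absurd h hi
      rw [hv2, h3, h5]; simp
    intro h
    have := LinearMap.isUnit_iff_isUnit_det _ |>.1
      ((LinearMap.isUnit_iff_ker_eq_bot _).2 (LinearMap.ker_eq_bot.2 hinj))
    exact this.ne_zero h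
  obtain ⟨A, hA⟩ : ∃ A : Eu n ≃L[ℝ] Eu n, (A : Eu n →L[ℝ] Eu n) = fderiv ℝ φ p :=
    ⟨(fderiv ℝ φ p).toContinuousLinearEquivOfDetNeZero hdet0, by simp⟩
  have hstr : HasStrictFDerivAt φ (A : Eu n →L[ℝ] Eu n) p := by
    rw [hA]; exact (hφd p hp).hasStrictFDerivAt (by simp)
  -- The inverse function theorem gives smoothness of the inverse only where the derivative is
  -- invertible, so the source is cut down to such points.
  set O : Set (Eu n) := V ∩ (fun x => (fderiv ℝ φ x).det) ⁻¹' {0}ᶜ with hO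
  have hOo : IsOpen O := hdet.isOpen_inter_preimage hV isOpen_compl_singleton
  set Φ := (hstr.toOpenPartialHomeomorph φ).restrOpen O hOo with hΦ
  have hΦφ : (Φ : Eu n → Eu n) = φ := rfl
  have hsrc : Φ.source ⊆ O := fun x hx => hx.2
  refine ⟨i, Φ, ⟨hstr.mem_toOpenPartialHomeomorph_source, hp, hdet0⟩, fun x hx => (hsrc hx).1,
    fun x => ?_, ?_, fun y hy => ?_, fun x hx => ?_⟩
  · rw [hΦφ]; simp [hφ]
  · rw [hΦφ]; exact hφs.mono fun x hx => (hsrc hx).1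
  · have hx := hsrc (Φ.map_target hy)
    have h1 := hφd _ hx.1
    refine (Φ.contDiffAt_symm (f₀' := (fderiv ℝ φ (Φ.symm y)).toContinuousLinearEquivOfDetNeZero
      hx.2) hy ?_ h1).contDiffWithinAt
    exact (h1.differentiableAt (by simp)).hasFDerivAt
  · rw [hΦφ]; exact (hsrc hx).2

/-- Hadamard's lemma in straightened coordinates. The bump function turns `v ∘ Φ⁻¹` into a smooth
function on all of `ℝⁿ`, zero on the whole hyperplane, and equals `1` near the point of interest. -/
theorem exists_eq_mul_near {V : Set (Eu n)} (hV : IsOpen V) {f : Eu n → ℝ}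
    (hf : ContDiffOn ℝ ∞ f V) {v : Eu n → ℂ} (hv : ContDiffOn ℝ ∞ v V)
    (h0 : ∀ x ∈ V, f x = 0 → v x = 0) {p : Eu n} (hp : p ∈ V)
    (hd : fderiv ℝ f p ≠ 0) :
    ∃ (W : Set (Eu n)) (c : Eu n → ℂ), IsOpen W ∧ p ∈ W ∧ W ⊆ V ∧ ContDiffOn ℝ ∞ c W ∧
      ∀ x ∈ W, v x = f x * c x := by
  obtain ⟨i, Φ, hpΦ, hΦV, hΦi, hΦs, hΦs', -⟩ := exists_straightening hV hf hp hd
  obtain ⟨r, hr, hball⟩ := Metric.isOpen_iff.1 Φ.open_target (Φ p) (Φ.map_source hpΦ)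
  obtain ⟨b, hb1, hb2⟩ : ∃ b : ContDiffBump (Φ p), b.rIn = r / 3 ∧ b.rOut = r / 2 :=
    ⟨⟨r / 3, r / 2, by positivity, by linarith⟩, rfl, rfl⟩
  have hts : tsupport b ⊆ Φ.target := by
    rw [b.tsupport_eq]
    exact (Metric.closedBall_subset_ball (by rw [hb2]; linarith)).trans hball
  have hvs : ContDiff ℝ ∞ (fun y => (b y : ℂ) * v (Φ.symm y)) := by
    rw [contDiff_iff_contDiffAt]
    intro y
    by_cases hy : y ∈ Φ.target
    · have h1 : ContDiffAt ℝ ∞ (fun y => v (Φ.symm y)) y :=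
        ((hv.comp hΦs' fun y hy => hΦV (Φ.map_target hy)).contDiffAt
          (Φ.open_target.mem_nhds hy))
      exact (Complex.ofRealCLM.contDiff.comp b.contDiff).contDiffAt.mul h1
    · have : ∀ᶠ z in 𝓝 y, z ∉ tsupport b :=
        (isClosed_tsupport _).isOpen_compl.mem_nhds fun h => hy (hts h)
      have h2 : ContDiffAt ℝ ∞ (fun _ : Eu n => (0 : ℂ)) y := contDiffAt_const
      refine h2.congr_of_eventuallyEq ?_
      filter_upwards [this] with z hz
      simp [image_eq_zero_of_notMem_tsupport hz]
  have hv0 : ∀ y : Eu n, y i = 0 → (b y : ℂ) * v (Φ.symm y) = 0 := fun y hy => by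
    by_cases hyt : y ∈ Φ.target
    · have hfy : f (Φ.symm y) = 0 := by rw [← hΦi, Φ.right_inv hyt, hy]
      rw [h0 (Φ.symm y) (hΦV (Φ.map_target hyt)) hfy, mul_zero]
    · have hby : b y = 0 := image_eq_zero_of_notMem_tsupport fun h => hyt (hts h)
      rw [hby, Complex.ofReal_zero, zero_mul]
  obtain ⟨c, hc, hvc⟩ := exists_eq_coord_mul hvs i hv0
  have hcs : ContDiffOn ℝ ∞ (c ∘ Φ) Φ.source := hc.comp_contDiffOn hΦs
  have hmem : p ∈ Φ.source ∩ Φ ⁻¹' (Metric.ball (Φ p) (r / 3)) :=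
    mem_inter hpΦ (mem_preimage.2 (Metric.mem_ball_self (div_pos hr three_pos)))
  refine ⟨_, c ∘ Φ, Φ.isOpen_inter_preimage Metric.isOpen_ball, hmem,
    fun x hx => hΦV hx.1, hcs.mono fun x hx => hx.1, fun x hx => ?_⟩
  have h2 : b (Φ x) = 1 := b.one_of_mem_closedBall (by
    rw [hb1]; exact Metric.ball_subset_closedBall hx.2)
  have h1 := hvc (Φ x)
  rw [h2, Φ.left_inv hx.1, hΦi, Complex.ofReal_one, one_mul] at h1
  exact h1

end

/-! ### Regular defining functions: powers of the ideal, and integrals of functions of `f`. -/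

section

variable {n : ℕ}

/-- `f` is smooth on `V`, without critical points on its zero set. -/
structure RegularOn (f : Eu n → ℝ) (V : Opens (Eu n)) : Prop where
  smooth : ContDiffOn ℝ ∞ f V
  regular : ∀ x ∈ V, f x = 0 → fderiv ℝ f x ≠ 0

namespace RegularOn

variable {f : Eu n → ℝ} {V W : Opens (Eu n)}

theorem mono (hf : RegularOn f V) (h : W ≤ V) : RegularOn f W :=
  ⟨hf.smooth.mono h, fun x hx => hf.regular x (h hx)⟩

theorem smooth_ofReal (hf : RegularOn f V) : ContDiffOn ℝ ∞ (fun x => (f x : ℂ)) V :=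
  Complex.ofRealCLM.contDiff.comp_contDiffOn hf.smooth

/-- The zero set has empty interior: if `f` vanished near a point, so would its differential there.
-/
theorem eq_of_eq_off_zero (hf : RegularOn f V) {c₁ c₂ : Eu n → ℂ} (h₁ : ContinuousOn c₁ V)
    (h₂ : ContinuousOn c₂ V) (h : ∀ x ∈ V, f x ≠ 0 → c₁ x = c₂ x) : ∀ x ∈ V, c₁ x = c₂ x := by
  intro x hx
  by_contra hne
  have hV := V.isOpen.mem_nhds hx
  have hev : ∀ᶠ y in 𝓝 x, c₁ y ≠ c₂ y :=
    ((h₁.continuousAt hV).ne_iff_eventually_ne (h₂.continuousAt hV)).1 hne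
  have hf0 : f =ᶠ[𝓝 x] fun _ => 0 := by
    filter_upwards [hev, hV] with y hy hyV
    by_contra h0
    exact hy (h y hyV h0)
  refine hf.regular x hx hf0.self_of_nhds ?_
  rw [hf0.fderiv_eq]
  simp

/-- Local quotients by `f^k` agree where `f ≠ 0`, hence everywhere by density. They therefore glue
without a partition of unity, and one may take at `x` the value of the quotient chosen for `x`. -/
theorem exists_global_quotient (hf : RegularOn f V) (k : ℕ) {u : Eu n → ℂ}
    (hloc : ∀ p ∈ V, ∃ (W : Set (Eu n)) (c : Eu n → ℂ), IsOpen W ∧ p ∈ W ∧ W ⊆ V ∧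
      ContDiffOn ℝ ∞ c W ∧ ∀ x ∈ W, u x = (f x : ℂ) ^ k * c x) :
    ∃ c : Eu n → ℂ, ContDiffOn ℝ ∞ c V ∧ ∀ x ∈ V, u x = (f x : ℂ) ^ k * c x := by
  choose! W c hWo hpW hWV hc huc using hloc
  have hagree : ∀ p ∈ V, ∀ x ∈ W p, c x x = c p x := by
    intro p hp x hx
    have hxV := hWV p hp hx
    set O : Opens (Eu n) := ⟨W p ∩ W x, (hWo p hp).inter (hWo x hxV)⟩ with hO
    have hOV : O ≤ V := fun y hy => hWV p hp hy.1
    refine (hf.mono hOV).eq_of_eq_off_zero (c₁ := c x) (c₂ := c p)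
      ((hc x hxV).continuousOn.mono fun y hy => hy.2)
      ((hc p hp).continuousOn.mono fun y hy => hy.1) (fun y hy h0 => ?_) x ⟨hx, hpW x hxV⟩
    have h1 := huc p hp y hy.1
    rw [huc x hxV y hy.2] at h1
    exact mul_left_cancel₀ (pow_ne_zero k (Complex.ofReal_ne_zero.2 h0)) h1
  refine ⟨fun x => c x x, fun p hp => ?_, fun x hx => huc x hx x (hpW x hx)⟩
  have h1 := (hc p hp).contDiffAt ((hWo p hp).mem_nhds (hpW p hp))
  refine (h1.congr_of_eventuallyEq ?_).contDiffWithinAt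
  filter_upwards [(hWo p hp).mem_nhds (hpW p hp)] with x hx using hagree p hp x hx

theorem exists_eq_mul (hf : RegularOn f V) {v : Eu n → ℂ} (hv : ContDiffOn ℝ ∞ v V)
    (h0 : ∀ x ∈ V, f x = 0 → v x = 0) :
    ∃ c : Eu n → ℂ, ContDiffOn ℝ ∞ c V ∧ ∀ x ∈ V, v x = f x * c x := by
  have := hf.exists_global_quotient 1 (u := v) fun p hp => by
    by_cases hp0 : f p = 0
    · obtain ⟨W, c, h1, h2, h3, h4, h5⟩ :=
        exists_eq_mul_near V.isOpen hf.smooth hv h0 hp (hf.regular p hp hp0)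
      exact ⟨W, c, h1, h2, h3, h4, by simpa using h5⟩
    · have ho : IsOpen ((V : Set (Eu n)) ∩ f ⁻¹' {0}ᶜ) :=
        hf.smooth.continuousOn.isOpen_inter_preimage V.isOpen isOpen_compl_singleton
      refine ⟨_, fun x => v x * (f x : ℂ)⁻¹, ho, ⟨hp, hp0⟩, inter_subset_left, ?_, ?_⟩
      · refine (hv.mono inter_subset_left).mul
          ((hf.smooth_ofReal.mono inter_subset_left).inv fun x hx => ?_)
        exact Complex.ofReal_ne_zero.2 hx.2
      · intro x hx
        have : (f x : ℂ) ≠ 0 := Complex.ofReal_ne_zero.2 hx.2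
        field_simp
  simpa using this

/-- On the zero set of a regular function `f`, the `k`-th power of the ideal sheaf is generated
by `f ^ k`. -/
theorem inIdealPow_iff (hf : RegularOn f V) {S : Set (Eu n)}
    (hS : ∀ x ∈ V, x ∈ S ↔ f x = 0) (hW : W ≤ V) {k : ℕ} {u : Eu n → ℂ} :
    InIdealPow S k W u ↔ ∃ c : Eu n → ℂ, ContDiffOn ℝ ∞ c W ∧ ∀ x ∈ W, u x = (f x : ℂ) ^ k * c x := by
  constructor
  · intro h
    refine (hf.mono hW).exists_global_quotient k fun p hp => ?_
    obtain ⟨W', hpW', hW'W, N, c, g, hc, hg, hg0, hu⟩ := h p hp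
    have hdiv : ∀ i j, ∃ d : Eu n → ℂ, ContDiffOn ℝ ∞ d W' ∧ ∀ x ∈ W', g i j x = f x * d x :=
      fun i j => (hf.mono (hW'W.trans hW)).exists_eq_mul (hg i j) fun x hx hx0 =>
        hg0 i j x hx ((hS x (hW (hW'W hx))).2 hx0)
    choose d hd hgd using hdiv
    refine ⟨W', fun x => ∑ i, c i x * ∏ j, d i j x, W'.isOpen, hpW', hW'W, ?_, fun x hx => ?_⟩
    · exact ContDiffOn.sum fun i _ => (hc i).mul (contDiffOn_prod fun j _ => hd i j)
    · rw [hu x hx, Finset.mul_sum]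
      refine Finset.sum_congr rfl fun i _ => ?_
      rw [Finset.prod_congr rfl fun j _ => hgd i j x hx, Finset.prod_mul_distrib]
      simp only [Finset.prod_const, Finset.card_univ, Fintype.card_fin]
      ring
  · rintro ⟨c, hc, hu⟩ p hp
    refine ⟨W, hp, le_rfl, 1, fun _ => c, fun _ _ x => f x, fun _ => hc,
      fun _ _ => hf.smooth_ofReal.mono hW, fun _ _ x hx hxS => ?_, fun x hx => ?_⟩
    · simp [(hS x (hW hx)).1 hxS]
    · rw [hu x hx]; simp [mul_comm]

end RegularOn

/-- Fubini on a box: the constant is the product of the lengths of the other sides. -/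
theorem lintegral_box_coord (i : Fin n) (a : Eu n) {k : ℝ → ENNReal} (hk : Measurable k) :
    ∃ C : ENNReal, C ≠ ⊤ ∧ ∫⁻ y in {y : Eu n | ∀ j, y j ∈ Ioo (a j - 1) (a j + 1)}, k (y i) =
      C * ∫⁻ t in Ioo (a i - 1) (a i + 1), k t := by
  classical
  refine ⟨∏ j ∈ Finset.univ.erase i, (volume.restrict (Ioo (a j - 1) (a j + 1))) Set.univ, ?_, ?_⟩
  · refine ENNReal.prod_ne_top fun j _ => ?_
    simp
  have hmp := EuclideanSpace.volume_preserving_symm_measurableEquiv_toLp (Fin n)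
  set B : Set (Fin n → ℝ) := Set.univ.pi fun j => Ioo (a j - 1) (a j + 1) with hB
  have hBm : MeasurableSet B := MeasurableSet.univ_pi fun j => measurableSet_Ioo
  have h1 := (hmp.restrict_preimage hBm).lintegral_comp
    (f := fun z : Fin n → ℝ => k (z i)) (hk.comp (measurable_pi_apply i))
  have h2 : ∫⁻ z in B, k (z i) =
      ∫⁻ t, k t ∂((volume.restrict B).map (Function.eval i)) := by
    rw [lintegral_map hk (measurable_pi_apply i)]
  rw [h2, hB, volume_pi, Measure.restrict_pi_pi, Measure.pi_map_eval,
    lintegral_smul_measure] at h1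
  rw [smul_eq_mul] at h1
  rw [← h1]
  congr 2
  ext y
  simp [Set.mem_pi]

/-- Near a noncritical zero of `f`, integrals of functions of `f` are controlled by
one-dimensional integrals. -/
theorem RegularOn.exists_lintegral_le {f : Eu n → ℝ} {V : Opens (Eu n)} (hf : RegularOn f V)
    {p : Eu n} (hp : p ∈ V) (hp0 : f p = 0) :
    ∃ W : Opens (Eu n), p ∈ W ∧ W ≤ V ∧ ∀ k : ℝ → ENNReal, Measurable k →
      ∃ C : ENNReal, C ≠ ⊤ ∧ ∫⁻ x in (W : Set (Eu n)), k (f x) ≤ C * ∫⁻ t in Ioo (-1 : ℝ) 1, k t := by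
  obtain ⟨i, Φ, hpΦ, hΦV, hΦi, hΦs, -, hdet⟩ :=
    exists_straightening V.isOpen hf.smooth hp (hf.regular p hp hp0)
  have hdc : ContinuousOn (fun x => |(fderiv ℝ Φ x).det|) Φ.source :=
    (ContinuousLinearMap.continuous_det.comp_continuousOn
      (hΦs.continuousOn_fderiv_of_isOpen Φ.open_source (by simp))).abs
  -- Half the Jacobian at `p` bounds the Jacobian from below nearby, so integrals in `x` are at most
  -- `1/d` times integrals in the straightened coordinates.
  set d : ℝ := |(fderiv ℝ Φ p).det| / 2 with hd
  have hd0 : 0 < d := half_pos (abs_pos.2 (hdet p hpΦ))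
  have ho1 : IsOpen (Φ.source ∩ (fun x => |(fderiv ℝ Φ x).det|) ⁻¹' (Ioi d)) :=
    hdc.isOpen_inter_preimage Φ.open_source isOpen_Ioi
  have hbox : IsOpen {y : Eu n | ∀ j, y j ∈ Ioo (Φ p j - 1) (Φ p j + 1)} := by
    simp only [ofPred_forall]
    exact isOpen_iInter_of_finite fun j =>
      isOpen_Ioo.preimage (EuclideanSpace.proj (𝕜 := ℝ) j).continuous
  have ho2 := Φ.isOpen_inter_preimage hbox
  refine ⟨⟨_, ho1.inter ho2⟩, ⟨⟨hpΦ, ?_⟩, hpΦ, fun j => ⟨by linarith, by linarith⟩⟩,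
    fun x hx => hΦV hx.1.1, fun k hk => ?_⟩
  · change d < |(fderiv ℝ Φ p).det|
    rw [hd]; linarith [hd0]
  set W := (Φ.source ∩ (fun x => |(fderiv ℝ Φ x).det|) ⁻¹' (Ioi d)) ∩
    (Φ.source ∩ Φ ⁻¹' {y : Eu n | ∀ j, y j ∈ Ioo (Φ p j - 1) (Φ p j + 1)}) with hW
  obtain ⟨C, hC, hCk⟩ := lintegral_box_coord i (Φ p) hk
  have hWm : MeasurableSet W := (ho1.inter ho2).measurableSet
  have hcov := lintegral_image_eq_lintegral_abs_det_fderiv_mul volume hWm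
    (f := Φ) (f' := fderiv ℝ Φ) (fun x hx =>
      (((hΦs.contDiffAt (Φ.open_source.mem_nhds hx.2.1)).differentiableAt
        (by simp)).hasFDerivAt).hasFDerivWithinAt) (Φ.injOn.mono fun x hx => hx.2.1)
    (fun y => k (y i))
  have hd' : ENNReal.ofReal d ≠ 0 := by simpa using hd0
  refine ⟨(ENNReal.ofReal d)⁻¹ * C, ENNReal.mul_ne_top (ENNReal.inv_ne_top.2 hd') hC, ?_⟩
  have h3 : ENNReal.ofReal d * ∫⁻ x in W, k (f x) ≤ C * ∫⁻ t in Ioo (-1 : ℝ) 1, k t := by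
    calc ENNReal.ofReal d * ∫⁻ x in W, k (f x)
        = ∫⁻ x in W, ENNReal.ofReal d * k (f x) :=
          (lintegral_const_mul' _ _ ENNReal.ofReal_ne_top).symm
      _ ≤ ∫⁻ x in W, ENNReal.ofReal |(fderiv ℝ Φ x).det| * k (Φ x i) := by
          refine setLIntegral_mono' hWm fun x hx => ?_
          rw [hΦi]
          have : d < |(fderiv ℝ Φ x).det| := hx.1.2
          gcongr
      _ = ∫⁻ y in Φ '' W, k (y i) := hcov.symm
      _ ≤ ∫⁻ y in {y : Eu n | ∀ j, y j ∈ Ioo (Φ p j - 1) (Φ p j + 1)}, k (y i) := by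
          refine lintegral_mono_set ?_
          rintro _ ⟨x, hx, rfl⟩
          exact hx.2.2
      _ = C * ∫⁻ t in Ioo (-1 : ℝ) 1, k t := by
          -- The `i`-th side of the box is centred at `f p = 0`, whence the interval `(-1, 1)`.
          rw [hCk, hΦi, hp0]; norm_num
  rw [mul_assoc]
  calc ∫⁻ x in W, k (f x) = (ENNReal.ofReal d)⁻¹ * (ENNReal.ofReal d * ∫⁻ x in W, k (f x)) := by
        rw [← mul_assoc, ENNReal.inv_mul_cancel hd' ENNReal.ofReal_ne_top, one_mul]
    _ ≤ _ := by gcongr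

end

/-! ### Differential operators, their formal transposes, and conjugation by powers of `f`. -/

section

variable {n : ℕ}

/-! ### Iterated partial derivatives -/

theorem iterPartial_congr {u v : Eu n → ℂ} {x : Eu n} (h : u =ᶠ[𝓝 x] v) (w : List (Fin n)) :
    iterPartial w u =ᶠ[𝓝 x] iterPartial w v := by
  induction w with
  | nil => exact h
  | cons i w ih =>
    filter_upwards [ih.fderiv (𝕜 := ℝ)] with y hy
    simp only [iterPartial]
    rw [hy]

theorem iterPartial_append (w w' : List (Fin n)) (u : Eu n → ℂ) :
    iterPartial (w ++ w') u = iterPartial w (iterPartial w' u) := by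
  induction w with
  | nil => rfl
  | cons i w ih => simp only [List.cons_append, iterPartial, ih]

theorem contDiffOn_partial {O : Set (Eu n)} (hO : IsOpen O) {u : Eu n → ℂ}
    (hu : ContDiffOn ℝ ∞ u O) (i : Fin n) :
    ContDiffOn ℝ ∞ (fun x => fderiv ℝ u x (stdVec i)) O :=
  (hu.fderiv_of_isOpen hO (m := ∞) (by simp)).clm_apply contDiffOn_const

theorem contDiffOn_iterPartial {O : Set (Eu n)} (hO : IsOpen O) {u : Eu n → ℂ}
    (hu : ContDiffOn ℝ ∞ u O) (w : List (Fin n)) : ContDiffOn ℝ ∞ (iterPartial w u) O := by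
  induction w with
  | nil => exact hu
  | cons i w ih => exact contDiffOn_partial hO ih i

theorem differentiableAt_of_smooth {O : Set (Eu n)} (hO : IsOpen O) {u : Eu n → ℂ}
    (hu : ContDiffOn ℝ ∞ u O) {x : Eu n} (hx : x ∈ O) : DifferentiableAt ℝ u x :=
  (hu.contDiffAt (hO.mem_nhds hx)).differentiableAt (by simp)

theorem iterPartial_sum {ι : Type*} {O : Set (Eu n)} (hO : IsOpen O) (s : Finset ι)
    {u : ι → Eu n → ℂ} (hu : ∀ j ∈ s, ContDiffOn ℝ ∞ (u j) O) (w : List (Fin n)) :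
    ∀ x ∈ O, iterPartial w (fun x => ∑ j ∈ s, u j x) x = ∑ j ∈ s, iterPartial w (u j) x := by
  induction w with
  | nil => intro x _; rfl
  | cons i w ih =>
    intro x hx
    have h : iterPartial w (fun x => ∑ j ∈ s, u j x) =ᶠ[𝓝 x]
        fun x => ∑ j ∈ s, iterPartial w (u j) x := by
      filter_upwards [hO.mem_nhds hx] with y hy using ih y hy
    simp only [iterPartial]
    rw [h.fderiv_eq, fderiv_fun_sum fun j hj =>
      differentiableAt_of_smooth hO (contDiffOn_iterPartial hO (hu j hj) w) hx]
    simp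

theorem iterPartial_const_mul {O : Set (Eu n)} (hO : IsOpen O) (c : ℂ) {u : Eu n → ℂ}
    (hu : ContDiffOn ℝ ∞ u O) (w : List (Fin n)) :
    ∀ x ∈ O, iterPartial w (fun x => c * u x) x = c * iterPartial w u x := by
  induction w with
  | nil => intro x _; rfl
  | cons i w ih =>
    intro x hx
    have h : iterPartial w (fun x => c * u x) =ᶠ[𝓝 x] fun x => c * iterPartial w u x := by
      filter_upwards [hO.mem_nhds hx] with y hy using ih y hy
    simp only [iterPartial]
    rw [h.fderiv_eq, fderiv_const_mul
      (differentiableAt_of_smooth hO (contDiffOn_iterPartial hO hu w) hx)]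
    simp

theorem partial_mul {O : Set (Eu n)} (hO : IsOpen O) {a u : Eu n → ℂ}
    (ha : ContDiffOn ℝ ∞ a O) (hu : ContDiffOn ℝ ∞ u O) (i : Fin n) {x : Eu n} (hx : x ∈ O) :
    fderiv ℝ (fun y => a y * u y) x (stdVec i) =
      fderiv ℝ a x (stdVec i) * u x + a x * fderiv ℝ u x (stdVec i) := by
  rw [fderiv_fun_mul (differentiableAt_of_smooth hO ha hx) (differentiableAt_of_smooth hO hu hx)]
  simp
  ring

theorem partial_comm {O : Set (Eu n)} (hO : IsOpen O) {u : Eu n → ℂ} (hu : ContDiffOn ℝ ∞ u O)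
    (i j : Fin n) {x : Eu n} (hx : x ∈ O) :
    iterPartial [i, j] u x = iterPartial [j, i] u x := by
  have hsym : IsSymmSndFDerivAt ℝ u x :=
    (hu.contDiffAt (hO.mem_nhds hx)).isSymmSndFDerivAt
      (by simp only [minSmoothness_of_isRCLikeNormedField]; exact WithTop.coe_le_coe.2 le_top)
  have hd : DifferentiableAt ℝ (fderiv ℝ u) x :=
    ((hu.fderiv_of_isOpen hO (m := ∞) (by simp)).contDiffAt (hO.mem_nhds hx)).differentiableAt
      (by simp)
  simp only [iterPartial]
  rw [fderiv_clm_apply hd (differentiableAt_const _), fderiv_clm_apply hd (differentiableAt_const _)]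
  simpa using hsym (stdVec i) (stdVec j)

theorem iterPartial_perm {O : Set (Eu n)} (hO : IsOpen O) {u : Eu n → ℂ}
    (hu : ContDiffOn ℝ ∞ u O) {w w' : List (Fin n)} (h : w.Perm w') :
    ∀ x ∈ O, iterPartial w u x = iterPartial w' u x := by
  induction h with
  | nil => intro x _; rfl
  | cons i _ ih =>
    intro x hx
    simp only [iterPartial]
    rw [Filter.EventuallyEq.fderiv_eq]
    filter_upwards [hO.mem_nhds hx] with y hy using ih y hy
  | swap i j w =>
    intro x hx
    exact partial_comm hO (contDiffOn_iterPartial hO hu w) j i hx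
  | trans _ _ ih1 ih2 => exact fun x hx => (ih1 x hx).trans (ih2 x hx)

theorem contDiffOn_transpose {V W : Opens (Eu n)} (D : DiffOp V) (hW : W ≤ V) {u : Eu n → ℂ}
    (hu : ContDiffOn ℝ ∞ u W) : ContDiffOn ℝ ∞ (D.transpose u) W :=
  ContDiffOn.sum fun w hw => contDiffOn_const.mul
    (contDiffOn_iterPartial W.isOpen (((D.smooth w hw).mono hW).mul hu) _)

theorem contDiffOn_apply {V W : Opens (Eu n)} (D : DiffOp V) (hW : W ≤ V) {u : Eu n → ℂ}
    (hu : ContDiffOn ℝ ∞ u W) : ContDiffOn ℝ ∞ (D.apply u) W :=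
  ContDiffOn.sum fun w hw => ((D.smooth w hw).mono hW).mul
    (contDiffOn_iterPartial W.isOpen hu _)

theorem DiffOp.transpose_congr {V : Opens (Eu n)} (D : DiffOp V) {u v : Eu n → ℂ} {x : Eu n}
    (h : u =ᶠ[𝓝 x] v) : D.transpose u x = D.transpose v x := by
  refine Finset.sum_congr rfl fun w _ => ?_
  have h1 : (fun y => D.coeff w y * u y) =ᶠ[𝓝 x] fun y => D.coeff w y * v y := by
    filter_upwards [h] with y hy; rw [hy]
  rw [(iterPartial_congr h1 _).self_of_nhds]

theorem DiffOp.transpose_sum {V W : Opens (Eu n)} (D : DiffOp V) (hW : W ≤ V) {ι : Type*}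
    (s : Finset ι) {u : ι → Eu n → ℂ} (hu : ∀ j ∈ s, ContDiffOn ℝ ∞ (u j) W) {x : Eu n}
    (hx : x ∈ W) :
    D.transpose (fun y => ∑ j ∈ s, u j y) x = ∑ j ∈ s, D.transpose (u j) x := by
  simp only [DiffOp.transpose]
  rw [Finset.sum_comm]
  refine Finset.sum_congr rfl fun w hw => ?_
  rw [← Finset.mul_sum, ← iterPartial_sum W.isOpen s
    (fun j hj => ((D.smooth w hw).mono hW).mul (hu j hj)) _ x hx]
  simp only [Finset.mul_sum]

theorem DiffOp.transpose_const_mul {V W : Opens (Eu n)} (D : DiffOp V) (hW : W ≤ V) (c : ℂ)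
    {u : Eu n → ℂ} (hu : ContDiffOn ℝ ∞ u W) {x : Eu n} (hx : x ∈ W) :
    D.transpose (fun y => c * u y) x = c * D.transpose u x := by
  simp only [DiffOp.transpose, Finset.mul_sum]
  refine Finset.sum_congr rfl fun w hw => ?_
  rw [mul_left_comm, ← iterPartial_const_mul W.isOpen c
    (((D.smooth w hw).mono hW).mul hu) _ x hx]
  simp only [mul_left_comm]

/-! ### Operators represented with sorted words -/

/-- On smooth functions, `L` and `L'` are a differential operator with smooth coefficients on `V`,
written with sorted words, and its formal transpose. -/
def IsDiffPair (V : Opens (Eu n)) (L L' : (Eu n → ℂ) → Eu n → ℂ) : Prop :=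
  ∃ D : DiffOp V, (∀ w ∈ D.terms, w.Pairwise (· ≤ ·)) ∧
    ∀ W : Opens (Eu n), W ≤ V → ∀ u : Eu n → ℂ, ContDiffOn ℝ ∞ u W → ∀ x ∈ W,
      L u x = D.apply u x ∧ L' u x = D.transpose u x

namespace IsDiffPair

variable {V : Opens (Eu n)} {L L' L₁ L₁' L₂ L₂' : (Eu n → ℂ) → Eu n → ℂ}

theorem congr (h : IsDiffPair V L₁ L₁')
    (he : ∀ W : Opens (Eu n), W ≤ V → ∀ u : Eu n → ℂ, ContDiffOn ℝ ∞ u W → ∀ x ∈ W,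
      L u x = L₁ u x ∧ L' u x = L₁' u x) : IsDiffPair V L L' := by
  obtain ⟨D, hD, h⟩ := h
  exact ⟨D, hD, fun W hW u hu x hx =>
    ⟨(he W hW u hu x hx).1.trans (h W hW u hu x hx).1,
      (he W hW u hu x hx).2.trans (h W hW u hu x hx).2⟩⟩

theorem zero : IsDiffPair V (fun _ _ => 0) (fun _ _ => 0) :=
  ⟨⟨∅, fun _ _ => 0, by simp⟩, by simp, fun W hW u hu x hx => by
    simp [DiffOp.apply, DiffOp.transpose]⟩

theorem single {a : Eu n → ℂ} (ha : ContDiffOn ℝ ∞ a V) (w : List (Fin n)) :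
    IsDiffPair V (fun u x => a x * iterPartial w u x)
      (fun u x => (-1) ^ w.length * iterPartial w.reverse (fun y => a y * u y) x) := by
  have hp : (w.insertionSort (· ≤ ·)).Perm w := List.perm_insertionSort _ w
  refine ⟨⟨{w.insertionSort (· ≤ ·)}, fun _ => a, fun _ _ => ha⟩, ?_, fun W hW u hu x hx => ?_⟩
  · simp only [Finset.mem_singleton, forall_eq]
    exact List.pairwise_insertionSort _ w
  · simp only [DiffOp.apply, DiffOp.transpose, Finset.sum_singleton]
    rw [hp.length_eq, iterPartial_perm W.isOpen hu hp x hx,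
      iterPartial_perm W.isOpen ((ha.mono hW).mul hu) (w' := w.reverse)
        ((List.reverse_perm _).trans (hp.trans (List.reverse_perm _).symm)) x hx]
    exact ⟨rfl, rfl⟩

theorem add (h₁ : IsDiffPair V L₁ L₁') (h₂ : IsDiffPair V L₂ L₂') :
    IsDiffPair V (fun u x => L₁ u x + L₂ u x) (fun u x => L₁' u x + L₂' u x) := by
  classical
  obtain ⟨D₁, hD₁, h₁⟩ := h₁
  obtain ⟨D₂, hD₂, h₂⟩ := h₂
  -- Padding with zero coefficients lets two operators be written over one common set of words.
  have key : ∀ D : DiffOp V, ∀ T : Finset (List (Fin n)), D.terms ⊆ T → ∀ u x,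
      D.apply u x = ∑ w ∈ T, (if w ∈ D.terms then D.coeff w else 0) x * iterPartial w u x ∧
      D.transpose u x = ∑ w ∈ T, (-1) ^ w.length * iterPartial w.reverse
        (fun y => (if w ∈ D.terms then D.coeff w else 0) y * u y) x := by
    intro D T hT u x
    have hz : ∀ w : List (Fin n), ∀ y : Eu n, iterPartial w (fun _ => (0 : ℂ)) y = 0 := by
      intro w
      induction w with
      | nil => intro y; rfl
      | cons i w ih =>
        intro y
        have : iterPartial w (fun _ : Eu n => (0 : ℂ)) = fun _ => 0 := funext ih
        simp [iterPartial, this]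
    constructor
    · rw [DiffOp.apply, ← Finset.sum_subset hT]
      · exact Finset.sum_congr rfl fun w hw => by simp [hw]
      · intro w _ hw; simp [hw]
    · rw [DiffOp.transpose, ← Finset.sum_subset hT]
      · exact Finset.sum_congr rfl fun w hw => by simp [hw]
      · intro w _ hw; simp [hw, hz]
  have hsm : ∀ D : DiffOp V, ∀ w, ContDiffOn ℝ ∞ (if w ∈ D.terms then D.coeff w else 0) V := by
    intro D w
    split_ifs with h
    · exact D.smooth w h
    · exact contDiffOn_const
  refine ⟨⟨D₁.terms ∪ D₂.terms, fun w x => (if w ∈ D₁.terms then D₁.coeff w else 0) x +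
    (if w ∈ D₂.terms then D₂.coeff w else 0) x, fun w _ => (hsm D₁ w).add (hsm D₂ w)⟩, ?_,
    fun W hW u hu x hx => ⟨?_, ?_⟩⟩
  · intro w hw
    rcases Finset.mem_union.1 hw with h | h
    · exact hD₁ w h
    · exact hD₂ w h
  · beta_reduce
    rw [(h₁ W hW u hu x hx).1, (h₂ W hW u hu x hx).1,
      (key D₁ (D₁.terms ∪ D₂.terms) Finset.subset_union_left u x).1,
      (key D₂ (D₁.terms ∪ D₂.terms) Finset.subset_union_right u x).1, ← Finset.sum_add_distrib]
    exact Finset.sum_congr rfl fun w _ => by simp only [add_mul]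
  · beta_reduce
    rw [(h₁ W hW u hu x hx).2, (h₂ W hW u hu x hx).2,
      (key D₁ (D₁.terms ∪ D₂.terms) Finset.subset_union_left u x).2,
      (key D₂ (D₁.terms ∪ D₂.terms) Finset.subset_union_right u x).2, ← Finset.sum_add_distrib]
    refine Finset.sum_congr rfl fun w _ => ?_
    rw [← mul_add]
    congr 1
    have := iterPartial_sum W.isOpen (Finset.univ : Finset (Fin 2))
      (u := ![fun y => (if w ∈ D₁.terms then D₁.coeff w else 0) y * u y,
        fun y => (if w ∈ D₂.terms then D₂.coeff w else 0) y * u y]) (by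
        intro j _
        fin_cases j
        · exact ((hsm D₁ w).mono hW).mul hu
        · exact ((hsm D₂ w).mono hW).mul hu) w.reverse x hx
    simp only [Fin.sum_univ_two, Matrix.cons_val_zero, Matrix.cons_val_one] at this
    rw [← this]
    simp only [add_mul]

theorem sum {ι : Type*} (s : Finset ι) {M M' : ι → (Eu n → ℂ) → Eu n → ℂ}
    (h : ∀ j ∈ s, IsDiffPair V (M j) (M' j)) :
    IsDiffPair V (fun u x => ∑ j ∈ s, M j u x) (fun u x => ∑ j ∈ s, M' j u x) := by
  classical
  induction s using Finset.induction_on with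
  | empty => simpa using zero
  | insert j s hj ih =>
    simp only [Finset.sum_insert hj]
    exact (h j (Finset.mem_insert_self _ _)).add
      (ih fun i hi => h i (Finset.mem_insert_of_mem hi))

theorem mul_left {a : Eu n → ℂ} (ha : ContDiffOn ℝ ∞ a V) (h : IsDiffPair V L L') :
    IsDiffPair V (fun u x => a x * L u x) (fun u => L' (fun y => a y * u y)) := by
  obtain ⟨D, hD, h⟩ := h
  refine ⟨⟨D.terms, fun w x => a x * D.coeff w x, fun w hw => ha.mul (D.smooth w hw)⟩, hD,
    fun W hW u hu x hx => ⟨?_, ?_⟩⟩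
  · beta_reduce
    rw [(h W hW u hu x hx).1]
    simp [DiffOp.apply, Finset.mul_sum, mul_assoc]
  · beta_reduce
    rw [(h W hW _ ((ha.mono hW).mul hu) x hx).2]
    simp only [DiffOp.transpose, mul_left_comm, mul_assoc]

/-- Leibniz rule. An operator and its transpose are carried along together, so that an identity
between operators passes to transposes algebraically, without integration by parts. -/
theorem partial_left (h : IsDiffPair V L L') (i : Fin n) :
    IsDiffPair V (fun u x => fderiv ℝ (L u) x (stdVec i))
      (fun u x => - L' (fun y => fderiv ℝ u y (stdVec i)) x) := by
  obtain ⟨D, hD, h⟩ := h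
  have h1 : IsDiffPair V
      (fun u x => ∑ w ∈ D.terms, (fderiv ℝ (D.coeff w) x (stdVec i) * iterPartial w u x +
        D.coeff w x * iterPartial (i :: w) u x))
      (fun u x => ∑ w ∈ D.terms, ((-1) ^ w.length * iterPartial w.reverse
          (fun y => fderiv ℝ (D.coeff w) y (stdVec i) * u y) x +
        (-1) ^ (i :: w).length * iterPartial (i :: w).reverse (fun y => D.coeff w y * u y) x)) :=
    sum _ fun w hw => (single (contDiffOn_partial V.isOpen (D.smooth w hw) i) w).add
      (single (D.smooth w hw) (i :: w))
  refine h1.congr fun W hW u hu x hx => ⟨?_, ?_⟩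
  · have he : L u =ᶠ[𝓝 x] D.apply u := by
      filter_upwards [W.isOpen.mem_nhds hx] with y hy using (h W hW u hu y hy).1
    have hterm : ∀ w ∈ D.terms, ContDiffOn ℝ ∞ (fun y => D.coeff w y * iterPartial w u y) W :=
      fun w hw => ((D.smooth w hw).mono hW).mul (contDiffOn_iterPartial W.isOpen hu w)
    rw [he.fderiv_eq]
    have h2 := iterPartial_sum W.isOpen D.terms hterm [i] x hx
    simp only [iterPartial] at h2
    change fderiv ℝ (fun x => ∑ w ∈ D.terms, D.coeff w x * iterPartial w u x) x _ = _
    rw [h2]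
    refine Finset.sum_congr rfl fun w hw => ?_
    exact partial_mul W.isOpen ((D.smooth w hw).mono hW) (contDiffOn_iterPartial W.isOpen hu w) i hx
  · rw [(h W hW _ (contDiffOn_partial W.isOpen hu i) x hx).2, DiffOp.transpose,
      ← Finset.sum_neg_distrib]
    refine Finset.sum_congr rfl fun w hw => ?_
    have ha := (D.smooth w hw).mono hW
    have hda := contDiffOn_partial W.isOpen ha i
    have hdu := contDiffOn_partial W.isOpen hu i
    have h2 : iterPartial [i] (fun y => D.coeff w y * u y) =ᶠ[𝓝 x] fun y => ∑ j : Fin 2,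
        (![fun y => fderiv ℝ (D.coeff w) y (stdVec i) * u y,
          fun y => D.coeff w y * fderiv ℝ u y (stdVec i)] : Fin 2 → Eu n → ℂ) j y := by
      filter_upwards [W.isOpen.mem_nhds hx] with y hy
      simp only [iterPartial, Fin.sum_univ_two, Matrix.cons_val_zero, Matrix.cons_val_one]
      exact partial_mul W.isOpen ha hu i hy
    have h3 := iterPartial_sum W.isOpen (Finset.univ : Finset (Fin 2))
      (u := ![fun y => fderiv ℝ (D.coeff w) y (stdVec i) * u y,
          fun y => D.coeff w y * fderiv ℝ u y (stdVec i)]) (by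
        intro j _
        fin_cases j
        · exact hda.mul hu
        · exact ha.mul hdu) w.reverse x hx
    rw [List.reverse_cons, iterPartial_append, (iterPartial_congr h2 w.reverse).self_of_nhds, h3]
    simp only [Fin.sum_univ_two, Matrix.cons_val_zero, Matrix.cons_val_one, List.length_cons]
    ring

theorem iterPartial_mul {a : Eu n → ℂ} (ha : ContDiffOn ℝ ∞ a V) (w : List (Fin n)) :
    IsDiffPair V (fun u => iterPartial w (fun y => a y * u y))
      (fun u x => (-1) ^ w.length * (a x * iterPartial w.reverse u x)) := by
  induction w with
  | nil =>
    refine (single ha []).congr fun W hW u hu x hx => ?_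
    simp [iterPartial]
  | cons i w ih =>
    refine (ih.partial_left i).congr fun W hW u hu x hx => ⟨rfl, ?_⟩
    rw [List.reverse_cons, iterPartial_append, List.length_cons, pow_succ]
    simp only [iterPartial]
    ring

/-- Used with `a = f^b`: it puts `D ∘ f^b` in normal form, so that divisibility by `f^b` can be
tested on the coefficients, while the transpose stays `f^b Dᵗ`. -/
theorem apply_mul (D : DiffOp V) {a : Eu n → ℂ} (ha : ContDiffOn ℝ ∞ a V) :
    IsDiffPair V (fun u => D.apply (fun y => a y * u y)) (fun u x => a x * D.transpose u x) := by
  refine (sum D.terms fun w hw => (iterPartial_mul ha w).mul_left (D.smooth w hw)).congr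
    fun W hW u hu x hx => ⟨rfl, ?_⟩
  simp only [DiffOp.transpose, Finset.mul_sum]
  exact Finset.sum_congr rfl fun w _ => by ring

end IsDiffPair

/-! ### Division of coefficients -/

/-- The exponential function `e^{ξ · x}`. -/
def expLin (ξ : Fin n → ℂ) (x : Eu n) : ℂ := Complex.exp (∑ i, ξ i * (x i : ℂ))

theorem contDiff_expLin (ξ : Fin n → ℂ) : ContDiff ℝ ∞ (expLin ξ) := by
  refine ContDiff.cexp (ContDiff.sum fun i _ => contDiff_const.mul ?_)
  exact Complex.ofRealCLM.contDiff.comp (EuclideanSpace.proj (𝕜 := ℝ) i).contDiff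

theorem iterPartial_expLin (ξ : Fin n → ℂ) (w : List (Fin n)) :
    iterPartial w (expLin ξ) = fun x => (w.map ξ).prod * expLin ξ x := by
  induction w with
  | nil => funext x; simp [iterPartial]
  | cons i w ih =>
    funext x
    have h1 : ∀ j : Fin n, HasFDerivAt (fun y : Eu n => ξ j * (y j : ℂ))
        (ξ j • Complex.ofRealCLM.comp (EuclideanSpace.proj (𝕜 := ℝ) j)) x := fun j =>
      ((Complex.ofRealCLM.comp (EuclideanSpace.proj (𝕜 := ℝ) j)).hasFDerivAt).const_mul (ξ j)
    have h2 : HasFDerivAt (expLin ξ) _ x := (HasFDerivAt.fun_sum fun j _ => h1 j).cexp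
    simp only [iterPartial, ih]
    rw [fderiv_const_mul h2.differentiableAt, h2.fderiv]
    simp [expLin, PiLp.single_apply, apply_ite]
    ring

/-- A linear functional on the quotient by `J` turns the hypothesis into a polynomial in `ξ` that
vanishes identically, so its coefficients vanish; such functionals separate points. Sorted words
ensure that distinct words give distinct monomials. -/
theorem mem_of_forall_expLin {J : Submodule ℂ (Eu n → ℂ)} {T : Finset (List (Fin n))}
    (hT : ∀ w ∈ T, w.Pairwise (· ≤ ·)) {a : List (Fin n) → Eu n → ℂ}
    (h : ∀ ξ : Fin n → ℂ, (fun x => ∑ w ∈ T, (w.map ξ).prod * a w x) ∈ J) :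
    ∀ w ∈ T, a w ∈ J := by
  classical
  intro w hw
  rw [← Submodule.Quotient.mk_eq_zero J, ← Module.forall_dual_apply_eq_zero_iff ℂ]
  intro φ
  set P : MvPolynomial (Fin n) ℂ := ∑ v ∈ T, MvPolynomial.monomial
    (Multiset.toFinsupp (v : Multiset (Fin n))) (φ (J.mkQ (a v))) with hP
  have hP0 : P = 0 := by
    refine MvPolynomial.funext fun ξ => ?_
    have h1 : J.mkQ (∑ v ∈ T, (v.map ξ).prod • a v) = 0 := by
      rw [Submodule.mkQ_apply, Submodule.Quotient.mk_eq_zero]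
      convert h ξ using 1
      funext x
      simp
    have h2 := congrArg φ h1
    rw [map_sum, map_sum, map_zero] at h2
    rw [hP, map_sum, map_zero, ← h2]
    refine Finset.sum_congr rfl fun v _ => ?_
    rw [MvPolynomial.eval_monomial, map_smul, map_smul, smul_eq_mul, mul_comm]
    congr 1
    rw [← Multiset.prod_coe, ← Multiset.map_coe, Finset.prod_multiset_map_count,
      Finsupp.prod, Multiset.toFinsupp_support]
    simp
  have h3 := congrArg (MvPolynomial.coeff (Multiset.toFinsupp (w : Multiset (Fin n)))) hP0
  rw [hP, MvPolynomial.coeff_sum, Finset.sum_eq_single w, MvPolynomial.coeff_monomial,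
    if_pos rfl, MvPolynomial.coeff_zero] at h3
  · exact h3
  · intro v hv hne
    rw [MvPolynomial.coeff_monomial, if_neg]
    intro he
    have h4 : (v : Multiset (Fin n)) = w := Multiset.toFinsupp.injective he
    exact hne ((Multiset.coe_eq_coe.1 h4).eq_of_pairwise' (hT v hv) (hT w hw))
  · exact fun h => absurd hw h

namespace RegularOn

variable {f : Eu n → ℝ} {V : Opens (Eu n)}

/-- Conjugation of a tangential operator by a power of the defining function. -/
theorem exists_conj (hf : RegularOn f V) {S : Set (Eu n)} (hS : ∀ x ∈ V, x ∈ S ↔ f x = 0)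
    {D : DiffOp V} (hD : D.IsTangential S) (b : ℕ) :
    ∃ F : DiffOp V, F.IsTangential S ∧ ∀ W : Opens (Eu n), W ≤ V → ∀ u : Eu n → ℂ,
      ContDiffOn ℝ ∞ u W → ∀ x ∈ W,
        F.transpose (fun y => (f y : ℂ) ^ b * u y) x = (f x : ℂ) ^ b * D.transpose u x := by
  have hfb : ContDiffOn ℝ ∞ (fun x => (f x : ℂ) ^ b) V := hf.smooth_ofReal.pow b
  obtain ⟨A, hAs, hA⟩ := IsDiffPair.apply_mul D hfb
  beta_reduce at hA
  -- The functions divisible by `f^b` on `V`.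
  let J : Submodule ℂ (Eu n → ℂ) :=
    { carrier := {u | ∃ c : Eu n → ℂ, ContDiffOn ℝ ∞ c V ∧ ∀ x ∈ V, u x = (f x : ℂ) ^ b * c x}
      add_mem' := by
        rintro u v ⟨c, hc, hu⟩ ⟨d, hd, hv⟩
        exact ⟨fun x => c x + d x, hc.add hd, fun x hx => by
          rw [Pi.add_apply, hu x hx, hv x hx, mul_add]⟩
      zero_mem' := ⟨fun _ => 0, contDiffOn_const, fun x hx => by simp⟩
      smul_mem' := by
        rintro a u ⟨c, hc, hu⟩
        exact ⟨fun x => a * c x, contDiffOn_const.mul hc, fun x hx => by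
          rw [Pi.smul_apply, hu x hx, smul_eq_mul, mul_left_comm]⟩ }
  -- Tangentiality makes `D(f^b e^{ξ·x})` divisible by `f^b`. After division by `e^{ξ·x}` it is the
  -- full symbol of `D ∘ f^b` at `ξ`, so every coefficient of `D ∘ f^b` is divisible by `f^b`.
  have hcoef : ∀ w ∈ A.terms, A.coeff w ∈ J := by
    refine mem_of_forall_expLin hAs fun ξ => ?_
    have hξ := (contDiff_expLin ξ).contDiffOn (s := (V : Set (Eu n)))
    obtain ⟨c, hc, hu⟩ := (hf.inIdealPow_iff hS le_rfl).1
      (hD b V le_rfl _ ((hf.inIdealPow_iff hS le_rfl).2 ⟨expLin ξ, hξ, fun x _ => rfl⟩))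
    refine ⟨fun x => c x * expLin (-ξ) x, hc.mul (contDiff_expLin _).contDiffOn, fun x hx => ?_⟩
    have h1 := (hA V le_rfl _ hξ x hx).1
    rw [hu x hx] at h1
    have h2 : expLin ξ x * expLin (-ξ) x = 1 := by
      simp [expLin, ← Complex.exp_add]
    rw [← mul_assoc, h1, DiffOp.apply, Finset.sum_mul]
    refine Finset.sum_congr rfl fun w _ => ?_
    rw [iterPartial_expLin]
    linear_combination (-((w.map ξ).prod * A.coeff w x)) * h2
  choose! c hc hcA using hcoef
  set F : DiffOp V := ⟨A.terms, c, hc⟩ with hF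
  have hFA : ∀ u x, x ∈ V → A.apply u x = (f x : ℂ) ^ b * F.apply u x := by
    intro u x hx
    simp only [DiffOp.apply, hF, Finset.mul_sum]
    exact Finset.sum_congr rfl fun w hw => by rw [hcA w hw x hx, mul_assoc]
  refine ⟨F, fun k W hW u hu => ?_, fun W hW u hu x hx => ?_⟩
  · obtain ⟨d, hd, hud⟩ := (hf.inIdealPow_iff hS hW).1 hu
    have hus : ContDiffOn ℝ ∞ u W :=
      (((hf.smooth_ofReal.mono hW).pow k).mul hd).congr hud
    -- If `u` lies in the `k`-th power of the ideal, then `D(f^b u) = f^b F u` lies in the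
    -- `(k+b)`-th; cancelling `f^b` off the zero set leaves `F u` in the `k`-th.
    obtain ⟨e, he, hue⟩ := (hf.inIdealPow_iff hS hW).1 (hD (k + b) W hW
      (fun y => (f y : ℂ) ^ b * u y) ((hf.inIdealPow_iff hS hW).2 ⟨d, hd, fun x hx => by
        rw [hud x hx]; ring⟩))
    refine (hf.inIdealPow_iff hS hW).2 ⟨e, he, (hf.mono hW).eq_of_eq_off_zero
      (contDiffOn_apply F hW hus).continuousOn
      (((hf.smooth_ofReal.mono hW).pow k).mul he).continuousOn fun x hx h0 => ?_⟩
    have h1 := (hA W hW u hus x hx).1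
    rw [hue x hx, hFA u x (hW hx)] at h1
    refine mul_left_cancel₀ (pow_ne_zero b (Complex.ofReal_ne_zero.2 h0)) (h1.symm.trans ?_)
    ring
  · rw [(hA W hW u hu x hx).2]
    simp only [DiffOp.transpose, hF]
    refine Finset.sum_congr rfl fun w hw => ?_
    congr 1
    refine (iterPartial_congr ?_ _).self_of_nhds
    filter_upwards [W.isOpen.mem_nhds hx] with y hy
    rw [hcA w hw y (hW hy)]
    ring

end RegularOn

end

/-! ### Carrying a function of `log |f|` across a tangential operator. -/

section

variable {n : ℕ}

/-- `G i` is the `i`-th derivative of `G 0` on the set `O`. -/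
def IsJet (O : Set ℝ) (G : ℕ → ℝ → ℂ) : Prop :=
  ∀ i, ∀ s ∈ O, HasDerivAt (G i) (G (i + 1) s) s

theorem IsJet.contDiffOn {O : Set ℝ} (hO : IsOpen O) {G : ℕ → ℝ → ℂ} (hG : IsJet O G) (i : ℕ) :
    ContDiffOn ℝ ∞ (G i) O := by
  refine contDiffOn_infty.2 fun m => ?_
  induction m generalizing i with
  | zero => exact contDiffOn_zero.2 fun s hs => (hG i s hs).continuousAt.continuousWithinAt
  | succ m ih =>
    push_cast
    refine (contDiffOn_succ_iff_deriv_of_isOpen hO).2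
      ⟨fun s hs => (hG i s hs).differentiableAt.differentiableWithinAt, by simp, ?_⟩
    exact (ih (i + 1)).congr fun s hs => (hG i s hs).deriv

theorem IsJet.const_mul {O : Set ℝ} {G : ℕ → ℝ → ℂ} (hG : IsJet O G) (c : ℂ) :
    IsJet O (fun i s => c * G i s) :=
  fun i s hs => (hG i s hs).const_mul c

theorem IsJet.mono {O O' : Set ℝ} {G : ℕ → ℝ → ℂ} (hG : IsJet O G) (h : O' ⊆ O) : IsJet O' G :=
  fun i s hs => hG i s (h hs)

/-- By the chain rule each differentiation either raises the index `j` of `G j` by one or falls on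
the other factor. A word of length `r` thus involves only `G j, …, G (j + r)` at `L x`. -/
theorem iterPartial_eq_zero_of_jet {W : Set (Eu n)} (hW : IsOpen W) {L : Eu n → ℝ}
    (hL : ContDiffOn ℝ ∞ L W) {O : Set ℝ} (hO : IsOpen O) (hLO : MapsTo L W O)
    {G : ℕ → ℝ → ℂ} (hG : IsJet O G) {x : Eu n} (hx : x ∈ W) {m : ℕ}
    (h0 : ∀ i ≤ m, G i (L x) = 0) (w : List (Fin n)) :
    ∀ (j : ℕ) (u : Eu n → ℂ), ContDiffOn ℝ ∞ u W → j + w.length ≤ m →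
      iterPartial w (fun y => G j (L y) * u y) x = 0 := by
  -- The innermost derivative is peeled off first, so that its two Leibniz terms again have the
  -- shape `G j (L y) * u y`.
  induction w using List.reverseRecOn with
  | nil =>
    intro j u _ hj
    simp only [iterPartial]
    rw [h0 j (by simpa using hj), zero_mul]
  | append_singleton w i ih =>
    intro j u hu hj
    rw [List.length_append, List.length_singleton] at hj
    have hGL : ∀ j, ContDiffOn ℝ ∞ (fun y => G j (L y)) W := fun j =>
      (hG.contDiffOn hO j).comp hL hLO
    have hLi : ContDiffOn ℝ ∞ (fun y => ((fderiv ℝ L y (stdVec i) : ℝ) : ℂ)) W :=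
      Complex.ofRealCLM.contDiff.comp_contDiffOn
        ((hL.fderiv_of_isOpen hW (m := ∞) (by simp)).clm_apply contDiffOn_const)
    have hui := contDiffOn_partial hW hu i
    have h1 : iterPartial [i] (fun y => G j (L y) * u y) =ᶠ[𝓝 x] fun y => ∑ k : Fin 2,
        (![fun y => G (j + 1) (L y) * (((fderiv ℝ L y (stdVec i) : ℝ) : ℂ) * u y),
          fun y => G j (L y) * fderiv ℝ u y (stdVec i)] : Fin 2 → Eu n → ℂ) k y := by
      filter_upwards [hW.mem_nhds hx] with y hy
      simp only [iterPartial, Fin.sum_univ_two, Matrix.cons_val_zero, Matrix.cons_val_one]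
      rw [partial_mul hW (hGL j) hu i hy]
      have hd : HasFDerivAt L (fderiv ℝ L y) y :=
        ((hL.contDiffAt (hW.mem_nhds hy)).differentiableAt (by simp)).hasFDerivAt
      have h2 := (hG j (L y) (hLO hy)).hasFDerivAt.comp y hd
      have h3 : fderiv ℝ (fun y => G j (L y)) y = _ := h2.fderiv
      rw [h3]
      simp
      ring
    rw [iterPartial_append, (iterPartial_congr h1 w).self_of_nhds, iterPartial_sum hW]
    · simp only [Fin.sum_univ_two, Matrix.cons_val_zero, Matrix.cons_val_one]
      rw [ih (j + 1) _ (hLi.mul hu) (by omega), ih j _ hui (by omega), add_zero]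
    · intro k _
      fin_cases k
      · exact (hGL _).mul (hLi.mul hu)
      · exact (hGL _).mul hui
    · exact hx

/-- The number `(-b)^i` is the `i`-th derivative of `e^{-b s}` at `0`. The Vandermonde matrix with
the distinct nodes `0, -1, …, -m` is invertible, so combinations of these exponentials realise every
`m`-jet. -/
theorem exists_interpolation (m : ℕ) : ∃ κ : ℕ → ℕ → ℂ, ∀ i ≤ m, ∀ j ≤ m,
    ∑ b ∈ Finset.range (m + 1), κ b j * (-(b : ℂ)) ^ i = if i = j then 1 else 0 := by
  set A : Matrix (Fin (m + 1)) (Fin (m + 1)) ℂ :=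
    Matrix.vandermonde fun b => -((b : ℕ) : ℂ) with hA
  have hdet : IsUnit A.det := by
    refine isUnit_iff_ne_zero.2 (Matrix.det_vandermonde_ne_zero_iff.2 fun a b hab => ?_)
    simpa [Fin.ext_iff] using hab
  have hinv := Matrix.nonsing_inv_mul A hdet
  refine ⟨fun b j => if h : b < m + 1 ∧ j < m + 1 then A⁻¹ ⟨j, h.2⟩ ⟨b, h.1⟩ else 0,
    fun i hi j hj => ?_⟩
  have h1 := congrFun (congrFun hinv ⟨j, Nat.lt_succ_of_le hj⟩) ⟨i, Nat.lt_succ_of_le hi⟩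
  rw [Matrix.mul_apply, Matrix.one_apply] at h1
  rw [Finset.sum_range]
  simp only [Fin.mk.injEq] at h1
  rw [if_congr eq_comm rfl rfl, ← h1]
  refine Finset.sum_congr rfl fun b _ => ?_
  have hAb : A b ⟨i, Nat.lt_succ_of_le hi⟩ = (-((b : ℕ) : ℂ)) ^ i := by
    rw [hA, Matrix.vandermonde_apply]
  rw [hAb]
  congr 1
  exact dif_pos ⟨b.2, Nat.lt_succ_of_le hj⟩

/-- Interpolation coefficients for differential operators of order at most `m`. -/
def kap (m : ℕ) : ℕ → ℕ → ℂ := (exists_interpolation m).choose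

theorem kap_spec (m : ℕ) : ∀ i ≤ m, ∀ j ≤ m,
    ∑ b ∈ Finset.range (m + 1), kap m b j * (-(b : ℂ)) ^ i = if i = j then 1 else 0 :=
  (exists_interpolation m).choose_spec

/-- `F b` is the conjugate of `D` by the `b`-th power of `f`, in transposed form. -/
def IsConj (f : Eu n → ℝ) {V : Opens (Eu n)} (D : DiffOp V) (F : ℕ → DiffOp V) : Prop :=
  ∀ b, ∀ W : Opens (Eu n), W ≤ V → ∀ u : Eu n → ℂ, ContDiffOn ℝ ∞ u W → ∀ x ∈ W,
    (F b).transpose (fun y => (f y : ℂ) ^ b * u y) x = (f x : ℂ) ^ b * D.transpose u x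

/-- The coefficient of the `b`-th conjugate. -/
def jetCoeff (m b : ℕ) (G : ℕ → ℝ → ℂ) (s : ℝ) : ℂ :=
  ∑ i ∈ Finset.range (m + 1), kap m b i * G i s

theorem contDiffOn_logAbs {W : Set (Eu n)} {f : Eu n → ℝ} (hf : ContDiffOn ℝ ∞ f W)
    (h0 : ∀ x ∈ W, f x ≠ 0) : ContDiffOn ℝ ∞ (fun x => Real.log |f x|) W := by
  simp only [Real.log_abs]
  exact hf.log h0

/-- The key identity. At `x`, with `s₀ = log |f x|`, replace `G 0` by the combination of `e^{-b (s -
s₀)}` having the same `m`-jet at `s₀`; the error is invisible to an operator of order at most `m`.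
Since `e^{-b (log |f y| - s₀)} = (f x / f y)^b` for `f y` of the sign of `f x`, the conjugation
relation evaluates each exponential. -/
theorem transpose_jet_mul {f : Eu n → ℝ} {V W : Opens (Eu n)} (hf : ContDiffOn ℝ ∞ f V)
    {D : DiffOp V} {F : ℕ → DiffOp V} (hF : IsConj f D F) {m : ℕ}
    (hm : ∀ w ∈ D.terms, w.length ≤ m) (hW : W ≤ V) {v : Eu n → ℂ} (hv : ContDiffOn ℝ ∞ v W)
    {x : Eu n} (hx : x ∈ W) (hx0 : f x ≠ 0) {O : Set ℝ} (hO : IsOpen O)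
    (hxO : Real.log |f x| ∈ O) {G : ℕ → ℝ → ℂ} (hG : IsJet O G) :
    D.transpose (fun y => G 0 (Real.log |f y|) * v y) x =
      ∑ b ∈ Finset.range (m + 1), jetCoeff m b G (Real.log |f x|) * (F b).transpose v x := by
  set s₀ := Real.log |f x| with hs₀
  have hfW := hf.mono hW
  have hpos : IsOpen ((W : Set (Eu n)) ∩ (fun y => f y * f x) ⁻¹' Ioi 0) :=
    (hfW.continuousOn.mul continuousOn_const).isOpen_inter_preimage W.isOpen isOpen_Ioi
  -- Here `f` has the sign of `f x`, so `|f x| / |f y| = f x / f y` holds without absolute values.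
  set W₁ := (W : Set (Eu n)) ∩ (fun y => f y * f x) ⁻¹' Ioi 0 with hW₁
  have hne : ∀ y ∈ W₁, f y ≠ 0 := fun y hy h => by
    have : 0 < f y * f x := hy.2
    simp [h] at this
  have hL₁ := contDiffOn_logAbs (hfW.mono fun y hy => (hy.1 : y ∈ W)) hne
  have hW₀o : IsOpen (W₁ ∩ (fun y => Real.log |f y|) ⁻¹' O) :=
    hL₁.continuousOn.isOpen_inter_preimage hpos hO
  set W₀ : Opens (Eu n) := ⟨W₁ ∩ (fun y => Real.log |f y|) ⁻¹' O, hW₀o⟩ with hW₀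
  have hxW₀ : x ∈ W₀ := ⟨⟨hx, mul_self_pos.2 hx0⟩, hxO⟩
  have hW₀W : W₀ ≤ W := fun y hy => hy.1.1
  have hL : ContDiffOn ℝ ∞ (fun y => Real.log |f y|) W₀ := hL₁.mono fun y hy => hy.1
  have hLO : MapsTo (fun y => Real.log |f y|) (W₀ : Set (Eu n)) O := fun y hy => hy.2
  have hvW₀ : ContDiffOn ℝ ∞ v W₀ := hv.mono hW₀W
  -- The derivatives of `e^{-b (s - s₀)}`.
  set E : ℕ → ℕ → ℝ → ℂ := fun b i s => (-(b : ℂ)) ^ i * Complex.exp (-(b : ℂ) * ((s - s₀ : ℝ) : ℂ))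
    with hE
  have hEjet : ∀ b, IsJet O (E b) := by
    intro b i s _
    have h1 : HasDerivAt (fun s : ℝ => -(b : ℂ) * ((s - s₀ : ℝ) : ℂ)) (-(b : ℂ) * 1) s := by
      have h2 : HasDerivAt (fun s : ℝ => ((s - s₀ : ℝ) : ℂ)) 1 s := by
        simpa using ((hasDerivAt_id s).sub_const s₀).ofReal_comp
      exact h2.const_mul _
    have h3 := h1.cexp.const_mul ((-(b : ℂ)) ^ i)
    have h4 : E b (i + 1) s = (-(b : ℂ)) ^ i *
        (Complex.exp (-(b : ℂ) * ((s - s₀ : ℝ) : ℂ)) * (-(b : ℂ) * 1)) := by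
      change (-(b : ℂ)) ^ (i + 1) * _ = _
      rw [pow_succ]
      ring
    rw [h4]
    exact h3
  -- The interpolation error; its `m`-jet at `s₀` vanishes.
  set R : ℕ → ℝ → ℂ := fun i s => G i s -
    ∑ b ∈ Finset.range (m + 1), jetCoeff m b G s₀ * E b i s with hR
  have hRjet : IsJet O R := fun i s hs =>
    (hG i s hs).sub (HasDerivAt.fun_sum fun b _ => (hEjet b i s hs).const_mul _)
  have hR0 : ∀ i ≤ m, R i s₀ = 0 := by
    intro i hi
    simp only [hR, hE, jetCoeff, sub_self, Complex.ofReal_zero, mul_zero, Complex.exp_zero, mul_one,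
      Finset.sum_mul]
    rw [Finset.sum_comm]
    have h1 : ∀ j ∈ Finset.range (m + 1), ∑ b ∈ Finset.range (m + 1),
        kap m b j * G j s₀ * (-(b : ℂ)) ^ i = if i = j then G j s₀ else 0 := by
      intro j hj
      have h2 := kap_spec m i hi j (Nat.lt_succ_iff.1 (Finset.mem_range.1 hj))
      have h3 : ∑ b ∈ Finset.range (m + 1), kap m b j * G j s₀ * (-(b : ℂ)) ^ i =
          G j s₀ * ∑ b ∈ Finset.range (m + 1), kap m b j * (-(b : ℂ)) ^ i := by
        rw [Finset.mul_sum]; exact Finset.sum_congr rfl fun b _ => by ring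
      rw [h3, h2]; split_ifs <;> simp
    rw [Finset.sum_congr rfl h1, Finset.sum_ite_eq, if_pos (Finset.mem_range.2 (by omega)), sub_self]
  have hcomp : ∀ {H : ℕ → ℝ → ℂ}, IsJet O H → ContDiffOn ℝ ∞ (fun y => H 0 (Real.log |f y|)) W₀ :=
    fun hH => (hH.contDiffOn hO 0).comp hL hLO
  have hDR : D.transpose (fun y => R 0 (Real.log |f y|) * v y) x = 0 := by
    refine Finset.sum_eq_zero fun w hw => ?_
    have h1 := iterPartial_eq_zero_of_jet W₀.isOpen hL hO hLO hRjet hxW₀ hR0 w.reverse 0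
      (fun y => D.coeff w y * v y) (((D.smooth w hw).mono (hW₀W.trans hW)).mul hvW₀)
      (by simpa using hm w hw)
    have h2 : (fun y => D.coeff w y * (R 0 (Real.log |f y|) * v y)) =
        fun y => R 0 (Real.log |f y|) * (D.coeff w y * v y) := by
      funext y; ring
    rw [h2, h1, mul_zero]
  -- The conjugation relation is applied to `(f x / f y)^b v`, whose product with `f^b` is the
  -- constant `f(x)^b` times `v`; this constant then cancels.
  have hDE : ∀ b, D.transpose (fun y => E b 0 (Real.log |f y|) * v y) x = (F b).transpose v x := by
    intro b
    have h1 := hF b W₀ (hW₀W.trans hW) _ ((hcomp (hEjet b)).mul hvW₀) x hxW₀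
    have h2 : (fun y => (f y : ℂ) ^ b * (E b 0 (Real.log |f y|) * v y)) =ᶠ[𝓝 x]
        fun y => (f x : ℂ) ^ b * v y := by
      filter_upwards [W₀.isOpen.mem_nhds hxW₀] with y hy
      have hy0 : f y ≠ 0 := hne y hy.1
      have hyx : 0 < f y * f x := hy.1.2
      have h3 : Complex.exp (-(b : ℂ) * ((Real.log |f y| - s₀ : ℝ) : ℂ)) =
          (((|f x| / |f y|) ^ b : ℝ) : ℂ) := by
        rw [show (-(b : ℂ) * ((Real.log |f y| - s₀ : ℝ) : ℂ)) =
          ((b * (s₀ - Real.log |f y|) : ℝ) : ℂ) by push_cast; ring, ← Complex.ofReal_exp,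
          Real.exp_nat_mul, Real.exp_sub, hs₀, Real.exp_log (abs_pos.2 hx0),
          Real.exp_log (abs_pos.2 hy0)]
      have h4 : f y * (|f x| / |f y|) = f x := by
        rcases lt_or_gt_of_ne hy0 with h | h
        · have : f x < 0 := by nlinarith
          rw [abs_of_neg h, abs_of_neg this]
          field_simp
        · have : 0 < f x := by nlinarith
          rw [abs_of_pos h, abs_of_pos this]
          field_simp
      have h5 : (f x : ℂ) = f y * ((|f x| / |f y| : ℝ) : ℂ) := by
        rw [← Complex.ofReal_mul, h4]
      simp only [hE, pow_zero, one_mul]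
      rw [h3]
      conv_rhs => rw [h5, mul_pow]
      push_cast
      ring
    rw [(F b).transpose_congr h2, (F b).transpose_const_mul (hW₀W.trans hW) _ hvW₀ hxW₀] at h1
    exact (mul_left_cancel₀ (pow_ne_zero b (Complex.ofReal_ne_zero.2 hx0)) h1).symm
  -- The error term is stored as the summand of index `m + 1`, so that additivity of `Dᵗ` is used
  -- for a single sum.
  have hsplit : (fun y => G 0 (Real.log |f y|) * v y) = fun y =>
      ∑ k ∈ Finset.range (m + 2), (if k = m + 1 then R 0 (Real.log |f y|) * v y
        else jetCoeff m k G s₀ * (E k 0 (Real.log |f y|) * v y)) := by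
    funext y
    rw [Finset.sum_range_succ, if_pos rfl, Finset.sum_congr rfl fun k hk => by
      rw [if_neg (by have := Finset.mem_range.1 hk; omega : k ≠ m + 1)]]
    simp only [hR, sub_mul, Finset.sum_mul, mul_assoc]
    ring
  rw [hsplit, D.transpose_sum (hW₀W.trans hW) _ _ hxW₀]
  · rw [Finset.sum_range_succ]
    simp only [if_true]
    rw [hDR, add_zero]
    refine Finset.sum_congr rfl fun k hk => ?_
    have hk' : k ≠ m + 1 := by have := Finset.mem_range.1 hk; omega
    simp only [if_neg hk']
    rw [D.transpose_const_mul (hW₀W.trans hW) _ ((hcomp (hEjet k)).mul hvW₀) hxW₀, hDE]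
  · intro k _
    split_ifs
    · exact (hcomp hRjet).mul hvW₀
    · exact contDiffOn_const.mul ((hcomp (hEjet k)).mul hvW₀)

end

/-! ### One-variable estimates: powers, cutoffs and integrability. -/

section

/-! ### The functions `e^{γ s} s^β` on the negative half-line -/

/-- The `j`-th derivative of `e^{γ s} s^β`, for `s < 0` and the principal branch. -/
def powJet : ℕ → ℂ → ℂ → ℝ → ℂ
  | 0, γ, β, s => Complex.exp (γ * s + β * (Real.log (-s) + Real.pi * Complex.I))
  | j + 1, γ, β, s => γ * powJet j γ β s + β * powJet j γ (β - 1) s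

theorem powJet_zero_sub_one (γ β : ℂ) {s : ℝ} (hs : s < 0) :
    powJet 0 γ (β - 1) s = powJet 0 γ β s * (s : ℂ)⁻¹ := by
  have h1 : Complex.exp (Real.log (-s) + Real.pi * Complex.I) = s := by
    rw [Complex.exp_add, Complex.exp_pi_mul_I, ← Complex.ofReal_exp, Real.exp_log (by linarith)]
    simp
  simp only [powJet]
  rw [← h1, ← Complex.exp_neg, ← Complex.exp_add, h1]
  congr 1
  ring

theorem isJet_powJet (γ β : ℂ) : IsJet (Iio 0) (fun j => powJet j γ β) := by
  intro j
  induction j generalizing β with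
  | zero =>
    intro s hs
    have hs' : s < 0 := hs
    have h1 : HasDerivAt (fun s : ℝ => ((s : ℝ) : ℂ)) 1 s := by
      simpa using (hasDerivAt_id s).ofReal_comp
    have h2 : HasDerivAt (fun s : ℝ => ((Real.log (-s) : ℝ) : ℂ)) (((s⁻¹ : ℝ)) : ℂ) s := by
      have := ((hasDerivAt_id s).neg.log (by simpa using hs'.ne)).ofReal_comp
      have hinv : s⁻¹ = -1 / (-id) s := by
        change s⁻¹ = -1 / -s
        rw [neg_div_neg_eq, one_div]
      rw [hinv]
      exact this
    have h3 := ((h1.const_mul γ).add ((h2.add_const (Real.pi * Complex.I)).const_mul β)).cexp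
    have h4 : powJet 1 γ β s = Complex.exp (γ * s + β * (Real.log (-s) + Real.pi * Complex.I)) *
        (γ * 1 + β * ((s⁻¹ : ℝ) : ℂ)) := by
      change γ * powJet 0 γ β s + β * powJet 0 γ (β - 1) s = _
      rw [powJet_zero_sub_one γ β hs', Complex.ofReal_inv]
      simp only [powJet]
      ring
    change HasDerivAt (powJet 0 γ β) (powJet 1 γ β s) s
    rw [h4]
    exact h3
  | succ j ih =>
    intro s hs
    exact ((ih β s hs).const_mul γ).add ((ih (β - 1) s hs).const_mul β)

theorem differentiable_powJet {E : Type*} [NormedAddCommGroup E] [NormedSpace ℂ E] (j : ℕ) (s : ℝ)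
    {g b : E → ℂ} (hg : Differentiable ℂ g) (hb : Differentiable ℂ b) :
    Differentiable ℂ (fun z => powJet j (g z) (b z) s) := by
  induction j generalizing b with
  | zero =>
    simp only [powJet]
    fun_prop
  | succ j ih => exact (hg.mul (ih hb)).add (hb.mul (ih (hb.sub_const 1)))

theorem powJet_zero_right (j : ℕ) (γ : ℂ) (s : ℝ) :
    powJet j γ 0 s = γ ^ j * Complex.exp (γ * s) := by
  induction j with
  | zero => simp [powJet]
  | succ j ih => simp only [powJet]; rw [ih]; ring

theorem norm_powJet_zero_right_le (j : ℕ) (γ : ℂ) (s : ℝ) :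
    ‖powJet j γ 0 s‖ ≤ ‖γ‖ ^ j * Real.exp (γ.re * s) := by
  rw [powJet_zero_right, norm_mul, norm_pow, Complex.norm_exp]
  simp

/-- As `s → -∞` the factor `s^β` is negligible against `e^{-η s}`, because `log (-s) ≤ ε (-s) - 1 -
log ε`. The constant is uniform for bounded exponents, which holomorphy in `(γ, β)` requires; `s ≤
-1` makes `log (-s)` nonnegative. -/
theorem exists_norm_powJet_le (j : ℕ) (R : ℝ) {η : ℝ} (hη : 0 < η) :
    ∃ C : ℝ, 0 ≤ C ∧ ∀ (γ β : ℂ) (s : ℝ), ‖γ‖ ≤ R → ‖β‖ ≤ R → s ≤ -1 →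
      ‖powJet j γ β s‖ ≤ C * Real.exp ((γ.re - η) * s) := by
  induction j generalizing R with
  | zero =>
    -- Chosen so that `(|R| + 1) ε = η`, where `|R| + 1` dominates `Re β`.
    set ε := η / (|R| + 1) with hε
    have hR1 : 0 < |R| + 1 := by positivity
    have hε0 : 0 < ε := by positivity
    refine ⟨Real.exp ((|R| + 1) * (-1 - Real.log ε) + |R| * Real.pi), (Real.exp_pos _).le,
      fun γ β s hγ hβ hs => ?_⟩
    simp only [powJet]
    rw [Complex.norm_exp, ← Real.exp_add, Real.exp_le_exp]
    have hlog0 : 0 ≤ Real.log (-s) := Real.log_nonneg (by linarith)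
    have hlog1 : Real.log (-s) ≤ ε * (-s) - 1 - Real.log ε := by
      have h1 := Real.log_le_sub_one_of_pos (x := ε * (-s)) (by nlinarith)
      rw [Real.log_mul hε0.ne' (by linarith)] at h1
      linarith
    have hre : |β.re| ≤ |R| := (Complex.abs_re_le_norm β).trans (hβ.trans (le_abs_self R))
    have him : |β.im| ≤ |R| := (Complex.abs_im_le_norm β).trans (hβ.trans (le_abs_self R))
    have h2 : β.re * Real.log (-s) ≤ (|R| + 1) * (ε * (-s) - 1 - Real.log ε) := by
      calc β.re * Real.log (-s) ≤ (|R| + 1) * Real.log (-s) :=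
            mul_le_mul_of_nonneg_right (by linarith [le_abs_self β.re]) hlog0
        _ ≤ _ := mul_le_mul_of_nonneg_left hlog1 hR1.le
    have h3 : (|R| + 1) * ε = η := by rw [hε]; field_simp
    have h4 : -(β.im * Real.pi) ≤ |R| * Real.pi := by
      rw [← neg_mul]
      exact mul_le_mul_of_nonneg_right ((neg_le_abs _).trans him) Real.pi_pos.le
    have h5 : (γ * s + β * (Real.log (-s) + Real.pi * Complex.I)).re =
        γ.re * s + (β.re * Real.log (-s) - β.im * Real.pi) := by
      simp
    rw [h5]
    have h6 : (|R| + 1) * (ε * (-s) - 1 - Real.log ε) =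
      ((|R| + 1) * ε) * (-s) + (|R| + 1) * (-1 - Real.log ε) := by ring
    rw [h6, h3] at h2
    linarith
  | succ j ih =>
    -- Differentiation brings in the exponent `β - 1`, whose norm may exceed `R` by one.
    obtain ⟨C, hC0, hC⟩ := ih (|R| + 1)
    refine ⟨|R| * C + |R| * C, by positivity, fun γ β s hγ hβ hs => ?_⟩
    have hγ' : ‖γ‖ ≤ |R| := hγ.trans (le_abs_self R)
    have hβ' : ‖β‖ ≤ |R| := hβ.trans (le_abs_self R)
    have hβ1 : ‖β - 1‖ ≤ |R| + 1 := (norm_sub_le _ _).trans (by simpa using hβ')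
    have h1 := hC γ β s (by linarith) (by linarith) hs
    have h2 := hC γ (β - 1) s (by linarith) hβ1 hs
    simp only [powJet]
    refine (norm_add_le _ _).trans ?_
    rw [norm_mul, norm_mul, add_mul, mul_assoc]
    gcongr

/-! ### Cutoff functions -/

/-- The cutoff function in the logarithmic variable. -/
def cutLog (s : ℝ) : ℂ := (Real.smoothTransition (Real.exp (2 * s) - 1) : ℝ)

theorem contDiff_cutLog : ContDiff ℝ ∞ cutLog :=
  Complex.ofRealCLM.contDiff.comp (Real.smoothTransition.contDiff.comp
    ((contDiff_const.mul contDiff_id).exp.sub contDiff_const))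

theorem cutLog_of_neg {s : ℝ} (hs : s < 0) : cutLog s = 0 := by
  rw [cutLog, Real.smoothTransition.zero_of_nonpos, Complex.ofReal_zero]
  have := Real.exp_le_one_iff.2 (by linarith : 2 * s ≤ 0)
  linarith

theorem cutLog_of_one_lt {s : ℝ} (hs : 1 < s) : cutLog s = 1 := by
  rw [cutLog, Real.smoothTransition.one_of_one_le, Complex.ofReal_one]
  have := Real.add_one_le_exp (2 * s)
  linarith

theorem iterate_deriv_eq_zero_of_eqOn_const {f : ℝ → ℂ} {U : Set ℝ} (hU : IsOpen U) {c : ℂ}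
    (h : ∀ s ∈ U, f s = c) (l : ℕ) : ∀ s ∈ U, deriv^[l + 1] f s = 0 := by
  induction l generalizing f c with
  | zero =>
    intro s hs
    have : f =ᶠ[𝓝 s] fun _ => c := by filter_upwards [hU.mem_nhds hs] with t ht using h t ht
    rw [Function.iterate_one, this.deriv_eq, deriv_const]
  | succ l ih =>
    intro s hs
    rw [Function.iterate_succ_apply]
    refine ih (c := 0) (fun t ht => ?_) s hs
    have : f =ᶠ[𝓝 t] fun _ => c := by filter_upwards [hU.mem_nhds ht] with r hr using h r hr
    rw [this.deriv_eq, deriv_const]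

/-- The derivatives of the translated cutoff function. -/
def cutJet (ν : ℝ) (l : ℕ) (s : ℝ) : ℂ := deriv^[l] cutLog (s + Real.log ν)

theorem isJet_cutJet (ν : ℝ) : IsJet univ (cutJet ν) := by
  intro l s _
  have h1 : HasDerivAt (deriv^[l] cutLog) (deriv^[l + 1] cutLog (s + Real.log ν))
      (s + Real.log ν) := by
    rw [Function.iterate_succ_apply']
    exact ((contDiff_cutLog.iterate_deriv l).differentiable (by simp)).differentiableAt.hasDerivAt
  exact h1.comp_add_const s (Real.log ν)

/-- Uniform in `ν`: changing `ν` only translates the cutoff in the logarithmic variable, and the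
cutoff is constant outside `[0, 1]`. -/
theorem exists_norm_cutJet_le (l : ℕ) : ∃ C : ℝ, 0 ≤ C ∧ ∀ ν s, ‖cutJet ν l s‖ ≤ C := by
  obtain ⟨C, hC⟩ := (isCompact_Icc (a := (0 : ℝ)) (b := 1)).exists_bound_of_continuousOn
    (contDiff_cutLog.iterate_deriv l).continuous.continuousOn
  refine ⟨max C 1, zero_le_one.trans (le_max_right _ _), fun ν s => ?_⟩
  simp only [cutJet]
  generalize s + Real.log ν = t
  rcases lt_or_ge t 0 with h | h
  · rcases l with _ | l
    · simp [cutLog_of_neg h]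
    · rw [iterate_deriv_eq_zero_of_eqOn_const isOpen_Iio (fun s hs => cutLog_of_neg hs) l t h]
      simp
  · rcases lt_or_ge 1 t with h' | h'
    · rcases l with _ | l
      · simp [cutLog_of_one_lt h']
      · rw [iterate_deriv_eq_zero_of_eqOn_const isOpen_Ioi (fun s hs => cutLog_of_one_lt hs) l t h']
        simp
    · exact (hC t ⟨h, h'⟩).trans (le_max_left _ _)

theorem cutJet_of_lt {ν s : ℝ} (h : 1 < s + Real.log ν) (l : ℕ) :
    cutJet ν l s = if l = 0 then 1 else 0 := by
  rcases l with _ | l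
  · simpa [cutJet] using cutLog_of_one_lt h
  · simp only [cutJet]
    rw [iterate_deriv_eq_zero_of_eqOn_const isOpen_Ioi (fun s hs => cutLog_of_one_lt hs) l _ h]
    simp

/-- The derivatives of a product. -/
def prodJet : ℕ → (ℕ → ℝ → ℂ) → (ℕ → ℝ → ℂ) → ℝ → ℂ
  | 0, A, B, s => A 0 s * B 0 s
  | i + 1, A, B, s => prodJet i (fun l => A (l + 1)) B s + prodJet i A (fun l => B (l + 1)) s

theorem IsJet.shift {O : Set ℝ} {A : ℕ → ℝ → ℂ} (hA : IsJet O A) : IsJet O (fun l => A (l + 1)) :=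
  fun i s hs => hA (i + 1) s hs

theorem IsJet.prod {O : Set ℝ} {A B : ℕ → ℝ → ℂ} (hA : IsJet O A) (hB : IsJet O B) :
    IsJet O (fun i => prodJet i A B) := by
  intro i
  induction i generalizing A B with
  | zero => exact fun s hs => (hA 0 s hs).mul (hB 0 s hs)
  | succ i ih => exact fun s hs => (ih hA.shift hB s hs).add (ih hA hB.shift s hs)

theorem norm_prodJet_le (i : ℕ) {A B : ℕ → ℝ → ℂ} {s a b : ℝ} (ha : 0 ≤ a)
    (hA : ∀ l ≤ i, ‖A l s‖ ≤ a) (hB : ∀ l ≤ i, ‖B l s‖ ≤ b) :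
    ‖prodJet i A B s‖ ≤ 2 ^ i * (a * b) := by
  induction i generalizing A B with
  | zero =>
    simp only [prodJet, norm_mul, pow_zero, one_mul]
    exact mul_le_mul (hA 0 le_rfl) (hB 0 le_rfl) (norm_nonneg _) ha
  | succ i ih =>
    have h1 := ih (A := fun l => A (l + 1)) (B := B) (fun l hl => hA (l + 1) (by omega))
      (fun l hl => hB l (by omega))
    have h2 := ih (A := A) (B := fun l => B (l + 1)) (fun l hl => hA l (by omega))
      (fun l hl => hB (l + 1) (by omega))
    refine (norm_add_le _ _).trans ?_
    rw [pow_succ]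
    linarith

theorem prodJet_zero_left (i : ℕ) {A B : ℕ → ℝ → ℂ} {s : ℝ} (hA : ∀ l, A l s = 0) :
    prodJet i A B s = 0 := by
  induction i generalizing A B with
  | zero => simp [prodJet, hA]
  | succ i ih => simp only [prodJet]; rw [ih fun l => hA (l + 1), ih hA, add_zero]

theorem prodJet_one_left (i : ℕ) {A B : ℕ → ℝ → ℂ} {s : ℝ}
    (hA : ∀ l, A l s = if l = 0 then 1 else 0) : prodJet i A B s = B i s := by
  induction i generalizing B with
  | zero => simp [prodJet, hA]
  | succ i ih =>
    simp only [prodJet]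
    rw [prodJet_zero_left i (fun l => by simp [hA]), ih, zero_add]

/-- The derivatives of the cut off function `e^{γ s} s^β`. -/
def cutPowJet (ν : ℝ) (γ β : ℂ) (i : ℕ) (s : ℝ) : ℂ :=
  prodJet i (cutJet ν) (fun j => powJet j γ β) s

theorem isJet_cutPowJet (ν : ℝ) (γ β : ℂ) : IsJet (Iio 0) (cutPowJet ν γ β) :=
  ((isJet_cutJet ν).mono (subset_univ _)).prod (isJet_powJet γ β)

theorem cutPowJet_eq {ν s : ℝ} (h : 1 < s + Real.log ν) (γ β : ℂ) (i : ℕ) :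
    cutPowJet ν γ β i s = powJet i γ β s :=
  prodJet_one_left i (cutJet_of_lt h)

/-- One majorant serves both the weight and all its cutoffs; it is what dominated convergence needs
as `ν → ∞`. -/
theorem exists_norm_jetCoeff_le (m b : ℕ) (R : ℝ) {η : ℝ} (hη : 0 < η) :
    ∃ C : ℝ, 0 ≤ C ∧ ∀ (γ β : ℂ) (s : ℝ), ‖γ‖ ≤ R → ‖β‖ ≤ R → s ≤ -1 →
      ‖jetCoeff m b (fun j => powJet j γ β) s‖ ≤ C * Real.exp ((γ.re - η) * s) ∧
      ∀ ν, ‖jetCoeff m b (cutPowJet ν γ β) s‖ ≤ C * Real.exp ((γ.re - η) * s) := by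
  choose P hP0 hP using fun j => exists_norm_powJet_le j R hη
  choose Q hQ0 hQ using exists_norm_cutJet_le
  set A : ℝ := ∑ l ∈ Finset.range (m + 1), Q l with hA
  set B : ℝ := ∑ l ∈ Finset.range (m + 1), P l with hB
  have hA0 : 0 ≤ A := Finset.sum_nonneg fun l _ => hQ0 l
  have hB0 : 0 ≤ B := Finset.sum_nonneg fun l _ => hP0 l
  have hQA : ∀ l ≤ m, Q l ≤ A := fun l hl =>
    Finset.single_le_sum (f := Q) (fun l _ => hQ0 l) (Finset.mem_range.2 (by omega))
  have hPB : ∀ l ≤ m, P l ≤ B := fun l hl =>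
    Finset.single_le_sum (f := P) (fun l _ => hP0 l) (Finset.mem_range.2 (by omega))
  refine ⟨∑ i ∈ Finset.range (m + 1), ‖kap m b i‖ * (P i + 2 ^ i * (A * B)),
    Finset.sum_nonneg fun i _ => by have := hP0 i; positivity, fun γ β s hγ hβ hs => ?_⟩
  have hpow : ∀ l, ‖powJet l γ β s‖ ≤ P l * Real.exp ((γ.re - η) * s) :=
    fun l => hP l γ β s hγ hβ hs
  have he := (Real.exp_pos ((γ.re - η) * s)).le
  constructor
  · refine (norm_sum_le _ _).trans ?_
    rw [Finset.sum_mul]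
    refine Finset.sum_le_sum fun i _ => ?_
    rw [norm_mul, mul_assoc]
    refine mul_le_mul_of_nonneg_left ((hpow i).trans ?_) (norm_nonneg _)
    refine mul_le_mul_of_nonneg_right (le_add_of_nonneg_right ?_) he
    positivity
  · intro ν
    refine (norm_sum_le _ _).trans ?_
    rw [Finset.sum_mul]
    refine Finset.sum_le_sum fun i hi => ?_
    have him : i ≤ m := by have := Finset.mem_range.1 hi; omega
    rw [norm_mul, mul_assoc]
    refine mul_le_mul_of_nonneg_left ?_ (norm_nonneg _)
    have h1 := norm_prodJet_le i (A := cutJet ν) (B := fun j => powJet j γ β) (s := s) hA0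
      (fun l hl => (hQ l ν s).trans (hQA l (hl.trans him)))
      (b := B * Real.exp ((γ.re - η) * s))
      (fun l hl => (hpow l).trans (mul_le_mul_of_nonneg_right (hPB l (hl.trans him)) he))
    refine h1.trans ?_
    have h2 := mul_nonneg (hP0 i) he
    linarith

/-- Without a logarithm there is no loss `η` in the exponent. This is why `ℓ = Re α + k` is allowed
when `β = 0`. -/
theorem exists_norm_jetCoeff_zero_right_le (m b : ℕ) (γ : ℂ) :
    ∃ C : ℝ, 0 ≤ C ∧ ∀ s : ℝ,
      ‖jetCoeff m b (fun j => powJet j γ 0) s‖ ≤ C * Real.exp (γ.re * s) := by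
  refine ⟨∑ i ∈ Finset.range (m + 1), ‖kap m b i‖ * ‖γ‖ ^ i,
    Finset.sum_nonneg fun i _ => by positivity, fun s => (norm_sum_le _ _).trans ?_⟩
  rw [Finset.sum_mul]
  refine Finset.sum_le_sum fun i _ => ?_
  rw [norm_mul, mul_assoc]
  exact mul_le_mul_of_nonneg_left (norm_powJet_zero_right_le i γ s) (norm_nonneg _)

theorem tendsto_jetCoeff_cut (m b : ℕ) (γ β : ℂ) (s : ℝ) :
    ∀ᶠ ν : ℕ in Filter.atTop,
      jetCoeff m b (cutPowJet ν γ β) s = jetCoeff m b (fun j => powJet j γ β) s := by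
  have h : Filter.Tendsto (fun ν : ℕ => s + Real.log ν) Filter.atTop Filter.atTop :=
    Filter.tendsto_atTop_add_const_left _ _
      (Real.tendsto_log_atTop.comp tendsto_natCast_atTop_atTop)
  filter_upwards [h.eventually_gt_atTop 1] with ν hν
  simp only [jetCoeff, cutPowJet_eq hν]

theorem lintegral_exp_log_abs_lt_top {r : ℝ} (hr : -1 < r) :
    ∫⁻ t in Ioo (-1 : ℝ) 1, ENNReal.ofReal (Real.exp (r * Real.log |t|)) < ⊤ := by
  have h1 : IntervalIntegrable (fun t : ℝ => |t| ^ r) volume 0 1 := by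
    refine (intervalIntegral.intervalIntegrable_rpow' hr (a := 0) (b := 1)).congr ?_
    intro t ht
    rw [uIoc_of_le zero_le_one] at ht
    simp only
    rw [abs_of_pos ht.1]
  have h2 : IntervalIntegrable (fun t : ℝ => |t| ^ r) volume (-1) 0 := by
    rw [IntervalIntegrable.iff_comp_neg]
    simpa using h1.symm
  have h3 := (h2.trans h1)
  rw [intervalIntegrable_iff_integrableOn_Ioo_of_le (by norm_num)] at h3
  have h4 : IntegrableOn (fun t : ℝ => Real.exp (r * Real.log |t|)) (Ioo (-1) 1) := by
    refine h3.congr ?_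
    refine ae_restrict_of_ae ?_
    -- At `t = 0` the two expressions may differ, because `Real.log 0 = 0`; a null set.
    have : ∀ᵐ t : ℝ, t ≠ 0 := by simp [ae_iff]
    filter_upwards [this] with t ht
    rw [Real.rpow_def_of_pos (abs_pos.2 ht), mul_comm]
  have h5 := h4.2
  rw [hasFiniteIntegral_iff_ofReal (Filter.Eventually.of_forall fun t => (Real.exp_pos _).le)] at h5
  exact h5

end

/-! ### Integrals depending on parameters, and the local integrals for the extension. -/

section

variable {n : ℕ}

/-! ### Holomorphic dependence of integrals on two parameters -/

/-- Cauchy's estimate on the complex line through `z` in the direction `v`, for a disc of radius `r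
/ (2‖v‖)`. -/
theorem norm_fderiv_le_of_ball {E : Type*} [NormedAddCommGroup E] [NormedSpace ℂ E] {F : E → ℂ}
    {z : E} {r B : ℝ} (hr : 0 < r) (hF : DifferentiableOn ℂ F (Metric.ball z r))
    (hB : ∀ w ∈ Metric.ball z r, ‖F w‖ ≤ B) : ‖fderiv ℂ F z‖ ≤ 2 * B / r := by
  have hB0 : 0 ≤ B := (norm_nonneg _).trans (hB z (Metric.mem_ball_self hr))
  refine ContinuousLinearMap.opNorm_le_bound _ (by positivity) fun v => ?_
  rcases eq_or_ne v 0 with rfl | hv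
  · simp
  have hv0 : 0 < ‖v‖ := norm_pos_iff.2 hv
  have hρ : 0 < r / (2 * ‖v‖) := by positivity
  have hin : ∀ s : ℂ, ‖s‖ ≤ r / (2 * ‖v‖) → z + s • v ∈ Metric.ball z r := by
    intro s hs
    rw [mem_ball_iff_norm, add_sub_cancel_left, norm_smul]
    calc ‖s‖ * ‖v‖ ≤ r / (2 * ‖v‖) * ‖v‖ := by gcongr
      _ = r / 2 := by field_simp
      _ < r := by linarith
  have hline : ∀ s : ℂ, HasDerivAt (fun s : ℂ => z + s • v) v s := fun s => by
    simpa using ((hasDerivAt_id s).smul_const v).const_add z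
  have hd : ∀ s : ℂ, ‖s‖ ≤ r / (2 * ‖v‖) → DifferentiableAt ℂ (fun s : ℂ => F (z + s • v)) s :=
    fun s hs => ((hF.differentiableAt (Metric.isOpen_ball.mem_nhds (hin s hs)))).comp s
      (hline s).differentiableAt
  have h1 : ‖deriv (fun s : ℂ => F (z + s • v)) 0‖ ≤ B / (r / (2 * ‖v‖)) := by
    refine Complex.norm_deriv_le_of_forall_mem_sphere_norm_le hρ ⟨?_, ?_⟩ fun s hs => ?_
    · intro s hs
      refine (hd s ?_).differentiableWithinAt
      rw [mem_ball_zero_iff] at hs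
      exact hs.le
    · intro s hs
      rw [closure_ball _ hρ.ne', mem_closedBall_zero_iff] at hs
      exact (hd s hs).continuousAt.continuousWithinAt
    · refine hB _ (hin s ?_)
      rw [mem_sphere_zero_iff_norm] at hs
      exact hs.le
  have hFz : HasFDerivAt F (fderiv ℂ F z) (z + (0 : ℂ) • v) := by
    rw [zero_smul, add_zero]
    exact (hF.differentiableAt (Metric.isOpen_ball.mem_nhds (Metric.mem_ball_self hr))).hasFDerivAt
  have h2 : deriv (fun s : ℂ => F (z + s • v)) 0 = fderiv ℂ F z v :=
    (hFz.comp_hasDerivAt (0 : ℂ) (hline 0)).deriv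
  rw [h2] at h1
  refine h1.trans (le_of_eq ?_)
  field_simp

/-- An integrable majorant of the functions alone suffices: on the ball of half the radius, Cauchy's
estimate turns it into a majorant of their derivatives. -/
theorem differentiableAt_integral_of_bound {X : Type*} [MeasurableSpace X] {μ : Measure X}
    {F : ℂ × ℂ → X → ℂ} {z₀ : ℂ × ℂ} {r : ℝ} (hr : 0 < r) {B : X → ℝ} (hB : Integrable B μ)
    (hmeas : ∀ z ∈ Metric.ball z₀ r, AEStronglyMeasurable (F z) μ)
    (hbd : ∀ᵐ x ∂μ, ∀ z ∈ Metric.ball z₀ r, ‖F z x‖ ≤ B x)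
    (hd : ∀ x, DifferentiableOn ℂ (fun z => F z x) (Metric.ball z₀ r)) :
    DifferentiableAt ℂ (fun z => ∫ x, F z x ∂μ) z₀ := by
  have hz₀ : z₀ ∈ Metric.ball z₀ r := Metric.mem_ball_self hr
  have hmeasd : ∀ v : ℂ × ℂ, AEStronglyMeasurable (fun x => fderiv ℂ (fun z => F z x) z₀ v) μ := by
    intro v
    have hlim : Filter.Tendsto (fun j : ℕ => z₀ + (((j : ℝ) + 1)⁻¹ : ℝ) • v) Filter.atTop (𝓝 z₀) := by
      have h1 : Filter.Tendsto (fun j : ℕ => (((j : ℝ) + 1)⁻¹ : ℝ)) Filter.atTop (𝓝 0) := by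
        simpa [one_div] using tendsto_one_div_add_atTop_nhds_zero_nat (𝕜 := ℝ)
      have h2 : Filter.Tendsto (fun j : ℕ => (((j : ℝ) + 1)⁻¹ : ℝ) • v) Filter.atTop (𝓝 0) := by
        simpa using h1.smul_const v
      simpa using h2.const_add z₀
    -- Derivatives are measurable as limits of difference quotients; starting at index `N` keeps the
    -- points inside the ball.
    obtain ⟨N, hN⟩ := Filter.eventually_atTop.1 (hlim.eventually (Metric.ball_mem_nhds z₀ hr))
    refine aestronglyMeasurable_of_tendsto_ae Filter.atTop
      (f := fun j : ℕ => fun x => ((((j + N : ℕ) : ℝ) + 1 : ℝ)) •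
        (F (z₀ + ((((j + N : ℕ) : ℝ) + 1)⁻¹ : ℝ) • v) x - F z₀ x)) (fun j => ?_) ?_
    · exact AEStronglyMeasurable.const_smul (𝕜 := ℝ)
        ((hmeas _ (hN (j + N) (by omega))).sub (hmeas _ hz₀)) _
    · refine Filter.Eventually.of_forall fun x => ?_
      have h2 : HasFDerivAt (fun z => F z x) ((fderiv ℂ (fun z => F z x) z₀).restrictScalars ℝ) z₀ :=
        ((hd x).differentiableAt (Metric.ball_mem_nhds z₀ hr)).hasFDerivAt.restrictScalars ℝ
      have h4 : Filter.Tendsto (fun j : ℕ => (((j + N : ℕ) : ℝ) + 1 : ℝ)) Filter.atTop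
          Filter.atTop :=
        Filter.tendsto_atTop_add_const_right _ _
          (tendsto_natCast_atTop_atTop.comp (Filter.tendsto_add_atTop_nat N))
      exact (h2.lim_real v).comp h4
  have hF' : AEStronglyMeasurable (fun x => fderiv ℂ (fun z => F z x) z₀) μ := by
    have he : (fun x => fderiv ℂ (fun z => F z x) z₀) = fun x =>
        fderiv ℂ (fun z => F z x) z₀ (1, 0) • ContinuousLinearMap.fst ℂ ℂ ℂ +
          fderiv ℂ (fun z => F z x) z₀ (0, 1) • ContinuousLinearMap.snd ℂ ℂ ℂ := by
      funext x
      ext <;> simp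
    rw [he]
    exact ((hmeasd _).smul_const _).add ((hmeasd _).smul_const _)
  refine (hasFDerivAt_integral_of_dominated_of_fderiv_le (𝕜 := ℂ) (s := Metric.ball z₀ (r / 2))
    (F' := fun z x => fderiv ℂ (fun z => F z x) z) (bound := fun x => 2 * B x / (r / 2))
    (Metric.ball_mem_nhds z₀ (half_pos hr)) ?_ ?_ hF' ?_ ?_ ?_).differentiableAt
  · filter_upwards [Metric.ball_mem_nhds z₀ hr] with z hz using hmeas z hz
  · exact hB.mono' (hmeas z₀ hz₀) (by filter_upwards [hbd] with x hx using hx z₀ hz₀)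
  · filter_upwards [hbd] with x hx z hz
    have hsub : Metric.ball z (r / 2) ⊆ Metric.ball z₀ r := by
      refine Metric.ball_subset_ball' ?_
      rw [Metric.mem_ball] at hz
      linarith
    exact norm_fderiv_le_of_ball (half_pos hr) ((hd x).mono hsub) fun w hw => hx w (hsub hw)
  · exact (hB.const_mul 2).div_const _
  · refine Filter.Eventually.of_forall fun x z hz => ?_
    have hz' : z ∈ Metric.ball z₀ r := Metric.ball_subset_ball (by linarith) hz
    exact ((hd x).differentiableAt (Metric.isOpen_ball.mem_nhds hz')).hasFDerivAt

/-! ### The local integrals -/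

/-- A neighbourhood of a piece of the zero set of `f` which is small enough. -/
structure IsGoodDomain (f : Eu n → ℝ) (V : Opens (Eu n)) : Prop extends RegularOn f V where
  small : ∀ x ∈ V, |f x| < Real.exp (-1)
  null : volume ((V : Set (Eu n)) ∩ {x | f x = 0}) = 0
  integrable : ∀ r : ℝ, -1 < r →
    ∫⁻ x in (V : Set (Eu n)), ENNReal.ofReal (Real.exp (r * Real.log |f x|)) < ⊤

theorem IsGoodDomain.log_le {f : Eu n → ℝ} {V : Opens (Eu n)} (hV : IsGoodDomain f V) {x : Eu n}
    (hx : x ∈ V) (h0 : f x ≠ 0) : Real.log |f x| ≤ -1 :=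
  (Real.log_le_iff_le_exp (abs_pos.2 h0)).2 (hV.small x hx).le

theorem RegularOn.exists_isGoodDomain {f : Eu n → ℝ} {V : Opens (Eu n)} (hf : RegularOn f V)
    {p : Eu n} (hp : p ∈ V) (hp0 : f p = 0) :
    ∃ W : Opens (Eu n), p ∈ W ∧ W ≤ V ∧ IsGoodDomain f W := by
  obtain ⟨W₁, hpW₁, hW₁V, hint⟩ := hf.exists_lintegral_le hp hp0
  have ho : IsOpen ((W₁ : Set (Eu n)) ∩ (fun x => |f x|) ⁻¹' Iio (Real.exp (-1))) :=
    (hf.smooth.continuousOn.mono hW₁V).abs.isOpen_inter_preimage W₁.isOpen isOpen_Iio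
  have hsub : ((W₁ : Set (Eu n)) ∩ (fun x => |f x|) ⁻¹' Iio (Real.exp (-1))) ⊆ W₁ :=
    inter_subset_left
  refine ⟨⟨_, ho⟩, ⟨hpW₁, by simp [hp0, Real.exp_pos]⟩, fun x hx => hW₁V hx.1,
    { toRegularOn := hf.mono fun x hx => hW₁V hx.1, small := fun x hx => hx.2,
      null := ?_, integrable := fun r hr => ?_ }⟩
  -- Comparison with the indicator function of `{0}` shows that the zero set is null.
  · obtain ⟨C, hC, h⟩ := hint (indicator {0} fun _ => 1) (measurable_one.indicator
      (measurableSet_singleton 0))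
    have h0 : ∫⁻ t in Ioo (-1 : ℝ) 1, (indicator {0} (fun _ => (1 : ENNReal)) t) = 0 := by
      rw [lintegral_indicator (measurableSet_singleton 0)]
      simp
    rw [h0, mul_zero] at h
    have hm : MeasurableSet ((W₁ : Set (Eu n)) ∩ {x | f x = 0}) := by
      have h3 : (W₁ : Set (Eu n)) ∩ {x | f x = 0} =
          (W₁ : Set (Eu n)) \ ((W₁ : Set (Eu n)) ∩ f ⁻¹' {0}ᶜ) := by
        ext x; simp
      rw [h3]
      exact W₁.isOpen.measurableSet.diff ((hf.smooth.continuousOn.mono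
        hW₁V).isOpen_inter_preimage W₁.isOpen isOpen_compl_singleton).measurableSet
    have h1 : volume ((W₁ : Set (Eu n)) ∩ {x | f x = 0}) = 0 := by
      refine le_antisymm ?_ zero_le
      calc volume ((W₁ : Set (Eu n)) ∩ {x | f x = 0})
          = ∫⁻ x in (W₁ : Set (Eu n)) ∩ {x | f x = 0}, 1 := by simp
        _ ≤ ∫⁻ x in (W₁ : Set (Eu n)) ∩ {x | f x = 0}, indicator {0} (fun _ => 1) (f x) := by
            refine setLIntegral_mono' hm fun x hx => ?_
            have : f x ∈ ({0} : Set ℝ) := hx.2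
            simp [indicator_of_mem this]
        _ ≤ ∫⁻ x in (W₁ : Set (Eu n)), indicator {0} (fun _ => 1) (f x) :=
            lintegral_mono_set inter_subset_left
        _ ≤ 0 := h
    exact measure_mono_null (inter_subset_inter_left _ hsub) h1
  · obtain ⟨C, hC, h⟩ := hint (fun t => ENNReal.ofReal (Real.exp (r * Real.log |t|)))
      (by fun_prop)
    refine ((lintegral_mono_set hsub).trans h).trans_lt ?_
    exact ENNReal.mul_lt_top hC.lt_top (lintegral_exp_log_abs_lt_top hr)

/-- A term `f^k c D h` of a distribution near the zero set of `f`, with the conjugates of the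
differential operator `D` by powers of `f`. -/
structure LocalTerm (f : Eu n → ℝ) (V : Opens (Eu n)) where
  D : DiffOp V
  F : ℕ → DiffOp V
  order : ℕ
  c : Eu n → ℂ
  h : Eu n → ℂ
  conj : IsConj f D F
  order_le : ∀ w ∈ D.terms, w.length ≤ order
  smooth : ContDiffOn ℝ ∞ c V
  bounded : IsLocBounded V h

/-- The `d`-th power of the sign of `t`. -/
def sgnPow (d : ℕ) (t : ℝ) : ℂ := ((SignType.sign t : ℝ) : ℂ) ^ d

theorem norm_sgnPow_le (d : ℕ) (t : ℝ) : ‖sgnPow d t‖ ≤ 1 := by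
  rw [sgnPow, norm_pow]
  refine pow_le_one₀ (norm_nonneg _) ?_
  rcases lt_trichotomy t 0 with h | h | h <;> simp [h]

/-- The multiplier of the `b`-th conjugate. -/
def LocalTerm.kernel {f : Eu n → ℝ} {V : Opens (Eu n)} (T : LocalTerm f V) (d b : ℕ) (γ β : ℂ)
    (x : Eu n) : ℂ :=
  T.h x * (sgnPow d (f x) *
    jetCoeff T.order b (fun j => powJet j γ β) (Real.log |f x|))

/-- The integral representing `(sg f)^d |f|^γ (log |f|)^β D h` near the zero set of `f`. -/
def LocalTerm.integral {f : Eu n → ℝ} {V : Opens (Eu n)} (T : LocalTerm f V) (d : ℕ) (γ β : ℂ)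
    (u : Eu n → ℂ) : ℂ :=
  ∫ x in (V : Set (Eu n)), ∑ b ∈ Finset.range (T.order + 1),
    T.kernel d b γ β x * (T.F b).transpose (fun y => T.c y * u y) x

theorem measurable_powJet (j : ℕ) (γ β : ℂ) : Measurable (powJet j γ β) := by
  induction j generalizing β with
  | zero =>
    change Measurable fun s : ℝ => Complex.exp (γ * s + β * (Real.log (-s) + Real.pi * Complex.I))
    fun_prop
  | succ j ih => exact ((ih β).const_mul γ).add ((ih (β - 1)).const_mul β)

theorem measurable_sgnPow (d : ℕ) : Measurable (sgnPow d) := by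
  have : Measurable fun t : ℝ => (SignType.sign t : ℝ) := by
    have h : (fun t : ℝ => (SignType.sign t : ℝ)) =
        fun t => if 0 < t then 1 else if t < 0 then -1 else 0 := by
      funext t
      rcases lt_trichotomy t 0 with h | h | h <;> simp [h, not_lt.2 h.le]
    rw [h]
    exact Measurable.ite measurableSet_Ioi measurable_const
      (Measurable.ite measurableSet_Iio measurable_const measurable_const)
  exact (Complex.measurable_ofReal.comp this).pow_const d

theorem IsGoodDomain.ae_mem_ne_zero {f : Eu n → ℝ} {V : Opens (Eu n)}
    (hV : IsGoodDomain f V) {K : Set (Eu n)} (hK : IsCompact K) (hKV : K ⊆ V) :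
    ∀ᵐ x ∂(volume.restrict K), x ∈ K ∧ f x ≠ 0 := by
  have h1 : ∀ᵐ x ∂(volume.restrict K), x ∉ (V : Set (Eu n)) ∩ {x | f x = 0} :=
    ae_restrict_of_ae (measure_eq_zero_iff_ae_notMem.1 hV.null)
  filter_upwards [h1, ae_restrict_mem hK.isClosed.measurableSet] with x hx hxK
  exact ⟨hxK, fun h0 => hx ⟨hKV hxK, h0⟩⟩

namespace LocalTerm

variable {f : Eu n → ℝ} {V : Opens (Eu n)} (T : LocalTerm f V)

theorem aestronglyMeasurable_kernel (hf : ContinuousOn f V) {K : Set (Eu n)} (hK : IsCompact K)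
    (hKV : K ⊆ V) (d b : ℕ) (γ β : ℂ) :
    AEStronglyMeasurable (T.kernel d b γ β) (volume.restrict K) := by
  have h1 : AEMeasurable f (volume.restrict K) :=
    ((hf.mono hKV).aestronglyMeasurable hK.isClosed.measurableSet).aemeasurable
  have h2 : Measurable fun t : ℝ => sgnPow d t *
      jetCoeff T.order b (fun j => powJet j γ β) (Real.log |t|) := by
    refine (measurable_sgnPow d).mul ?_
    simp only [jetCoeff]
    refine Finset.measurable_sum _ fun i _ => ?_
    refine ((measurable_powJet i γ β).comp ?_).const_mul _
    exact Real.measurable_log.comp measurable_norm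
  exact (T.bounded K hK hKV).1.mul (h2.comp_aemeasurable h1).aestronglyMeasurable

theorem exists_ae_bound {K : Set (Eu n)} (hK : IsCompact K) (hKV : K ⊆ V) :
    ∃ H : ℝ, 0 ≤ H ∧ ∀ᵐ x ∂(volume.restrict K), ‖T.h x‖ ≤ H := by
  have h1 := (T.bounded K hK hKV)
  refine ⟨(eLpNorm T.h ⊤ (volume.restrict K)).toReal, ENNReal.toReal_nonneg, ?_⟩
  have h2 := ae_le_eLpNormEssSup (f := T.h) (μ := volume.restrict K)
  filter_upwards [h2] with x hx
  rw [← eLpNorm_exponent_top] at hx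
  have h3 := ENNReal.toReal_mono h1.2.ne hx
  simpa using h3

/-- Integrable bounds, uniform in the parameters. -/
theorem exists_bound (hV : IsGoodDomain f V) {K : Set (Eu n)} (hK : IsCompact K) (hKV : K ⊆ V)
    (R : ℝ) {r₀ : ℝ} (hr₀ : -1 < r₀) :
    ∃ B : Eu n → ℝ, IntegrableOn B K ∧ (∀ x, 0 ≤ B x) ∧ ∀ᵐ x ∂(volume.restrict K),
      ∀ (γ β : ℂ), ‖γ‖ ≤ R → ‖β‖ ≤ R → r₀ ≤ γ.re → ∀ b ∈ Finset.range (T.order + 1), ∀ d,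
        ‖T.kernel d b γ β x‖ ≤ B x ∧ ∀ ν, ‖T.h x * (sgnPow d (f x) *
          jetCoeff T.order b (cutPowJet ν γ β) (Real.log |f x|))‖ ≤ B x := by
  obtain ⟨H, hH0, hH⟩ := T.exists_ae_bound hK hKV
  -- With this loss the exponent becomes `r₀ - (r₀ + 1)/2 = (r₀ - 1)/2`, still greater than `-1`.
  have hη : 0 < (r₀ + 1) / 2 := by linarith
  choose C hC0 hC using fun b => exists_norm_jetCoeff_le T.order b R hη
  set Ct := ∑ b ∈ Finset.range (T.order + 1), C b with hCt
  set r := (r₀ - 1) / 2 with hr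
  have hCle : ∀ b ∈ Finset.range (T.order + 1), C b ≤ Ct := fun b hb =>
    Finset.single_le_sum (f := C) (fun b _ => hC0 b) hb
  have hCt0 : 0 ≤ Ct := Finset.sum_nonneg fun b _ => hC0 b
  have hfm : AEMeasurable f (volume.restrict K) :=
    ((hV.smooth.continuousOn.mono hKV).aestronglyMeasurable hK.isClosed.measurableSet).aemeasurable
  refine ⟨fun x => H * (Ct * Real.exp (r * Real.log |f x|)), ?_, fun x => by positivity, ?_⟩
  · refine ((Integrable.const_mul ?_ Ct).const_mul H)
    refine ⟨?_, ?_⟩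
    · have h2 : Measurable fun t : ℝ => Real.exp (r * Real.log |t|) :=
        Real.measurable_exp.comp ((Real.measurable_log.comp measurable_norm).const_mul r)
      exact (h2.comp_aemeasurable hfm).aestronglyMeasurable
    · rw [hasFiniteIntegral_iff_ofReal (Filter.Eventually.of_forall fun t => (Real.exp_pos _).le)]
      exact (lintegral_mono_set hKV).trans_lt (hV.integrable r (by rw [hr]; linarith))
  · filter_upwards [hH, hV.ae_mem_ne_zero hK hKV] with x hx hxK γ β hγ hβ hγr b hb d
    have hlog := hV.log_le (hKV hxK.1) hxK.2
    have hle : Real.exp ((γ.re - (r₀ + 1) / 2) * Real.log |f x|) ≤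
        Real.exp (r * Real.log |f x|) := by
      rw [Real.exp_le_exp]
      refine mul_le_mul_of_nonpos_right ?_ (by linarith)
      rw [hr]; linarith
    have key : ∀ a : ℂ, ‖a‖ ≤ C b * Real.exp ((γ.re - (r₀ + 1) / 2) * Real.log |f x|) →
        ‖T.h x * (sgnPow d (f x) * a)‖ ≤ H * (Ct * Real.exp (r * Real.log |f x|)) := by
      intro a ha
      rw [norm_mul, norm_mul]
      have h3 : ‖a‖ ≤ Ct * Real.exp (r * Real.log |f x|) :=
        ha.trans (mul_le_mul (hCle b hb) hle (Real.exp_pos _).le hCt0)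
      have h4 : ‖sgnPow d (f x)‖ * ‖a‖ ≤ Ct * Real.exp (r * Real.log |f x|) := by
        calc _ ≤ 1 * ‖a‖ := mul_le_mul_of_nonneg_right (norm_sgnPow_le _ _) (norm_nonneg _)
          _ ≤ _ := by rwa [one_mul]
      exact mul_le_mul hx h4 (by positivity) hH0
    have h5 := hC b γ β _ hγ hβ hlog
    exact ⟨key _ h5.1, fun ν => key _ (h5.2 ν)⟩

end LocalTerm

end

/-! ### Seminorm estimates and passage to the limit in the cut off integrals. -/

section

variable {n : ℕ}

/-! ### Bounds by derivatives -/

theorem exists_norm_iteratedFDeriv_mul_le {O K : Set (Eu n)} (hO : IsOpen O) (hK : IsCompact K)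
    (hKO : K ⊆ O) {a : Eu n → ℂ} (ha : ContDiffOn ℝ ∞ a O) (N : ℕ) :
    ∃ C : ℝ, 0 ≤ C ∧ ∀ u : Eu n → ℂ, ContDiffOn ℝ ∞ u O → ∀ x ∈ K, ∀ B : ℝ, 0 ≤ B →
      (∀ m ≤ N, ‖iteratedFDeriv ℝ m u x‖ ≤ B) →
        ∀ m ≤ N, ‖iteratedFDeriv ℝ m (fun y => a y * u y) x‖ ≤ C * B := by
  have hbd : ∀ i : ℕ, ∃ A : ℝ, 0 ≤ A ∧ ∀ x ∈ K, ‖iteratedFDerivWithin ℝ i a O x‖ ≤ A := by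
    intro i
    obtain ⟨A, hA⟩ := hK.exists_bound_of_continuousOn
      ((ha.continuousOn_iteratedFDerivWithin (m := i) (by exact_mod_cast le_top)
        hO.uniqueDiffOn).mono hKO)
    exact ⟨max A 0, le_max_right _ _, fun x hx => (hA x hx).trans (le_max_left _ _)⟩
  choose A hA0 hA using hbd
  have hin : ∀ m, 0 ≤ ∑ i ∈ Finset.range (m + 1), (m.choose i : ℝ) * A i := fun m =>
    Finset.sum_nonneg fun i _ => mul_nonneg (Nat.cast_nonneg _) (hA0 i)
  refine ⟨∑ m ∈ Finset.range (N + 1), ∑ i ∈ Finset.range (m + 1), (m.choose i : ℝ) * A i,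
    Finset.sum_nonneg fun m _ => hin m, fun u hu x hx B hB hb m hm => ?_⟩
  rw [← iteratedFDerivWithin_of_isOpen m hO (hKO hx)]
  refine (norm_iteratedFDerivWithin_mul_le (N := ∞) ha hu hO.uniqueDiffOn (hKO hx)
    (by exact_mod_cast le_top)).trans ?_
  have h1 : ∑ i ∈ Finset.range (m + 1), (m.choose i : ℝ) *
      ‖iteratedFDerivWithin ℝ i a O x‖ * ‖iteratedFDerivWithin ℝ (m - i) u O x‖ ≤
      (∑ i ∈ Finset.range (m + 1), (m.choose i : ℝ) * A i) * B := by
    rw [Finset.sum_mul]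
    refine Finset.sum_le_sum fun i _ => ?_
    have h2 := hb (m - i) ((Nat.sub_le m i).trans hm)
    rw [← iteratedFDerivWithin_of_isOpen (m - i) hO (hKO hx)] at h2
    have h3 := hA i x hx
    have h4 := hA0 i
    gcongr
  refine h1.trans (mul_le_mul_of_nonneg_right ?_ hB)
  exact Finset.single_le_sum
    (f := fun m => ∑ i ∈ Finset.range (m + 1), (m.choose i : ℝ) * A i)
    (fun m _ => hin m) (Finset.mem_range.2 (Nat.lt_succ_of_le hm))

theorem iterPartial_eq_iteratedFDeriv {O : Set (Eu n)} (hO : IsOpen O) {u : Eu n → ℂ}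
    (hu : ContDiffOn ℝ ∞ u O) (w : List (Fin n)) : ∀ x ∈ O,
    iterPartial w u x = iteratedFDeriv ℝ w.length u x fun j => stdVec (w.get j) := by
  induction w with
  | nil => intro x _; simp [iterPartial]
  | cons i w ih =>
    intro x hx
    have h1 : iterPartial w u =ᶠ[𝓝 x] fun y =>
        iteratedFDeriv ℝ w.length u y fun j => stdVec (w.get j) := by
      filter_upwards [hO.mem_nhds hx] with y hy using ih y hy
    have h2 : DifferentiableAt ℝ (iteratedFDeriv ℝ w.length u) x :=
      (((hu.contDiffAt (hO.mem_nhds hx)).iteratedFDeriv_right (m := ∞) (i := w.length)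
        (by exact_mod_cast le_top)).differentiableAt (by simp))
    simp only [iterPartial]
    rw [h1.fderiv_eq]
    refine Eq.trans ?_ (iteratedFDeriv_succ_apply_left (𝕜 := ℝ) (f := u) (x := x) (n := w.length)
      (fun j : Fin (w.length + 1) => stdVec ((i :: w).get j))).symm
    have h3 := (ContinuousMultilinearMap.apply ℝ (fun _ : Fin w.length => Eu n) ℂ
      (fun j => stdVec (w.get j))).hasFDerivAt.comp x h2.hasFDerivAt
    have h4 : fderiv ℝ (fun y => iteratedFDeriv ℝ w.length u y fun j => stdVec (w.get j)) x = _ :=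
      h3.fderiv
    rw [h4]
    rfl

theorem norm_iterPartial_le {O : Set (Eu n)} (hO : IsOpen O) {u : Eu n → ℂ}
    (hu : ContDiffOn ℝ ∞ u O) (w : List (Fin n)) {x : Eu n} (hx : x ∈ O) :
    ‖iterPartial w u x‖ ≤ ‖iteratedFDeriv ℝ w.length u x‖ := by
  rw [iterPartial_eq_iteratedFDeriv hO hu w x hx]
  refine (ContinuousMultilinearMap.le_opNorm _ _).trans (le_of_eq ?_)
  simp

theorem DiffOp.exists_norm_transpose_le {V : Opens (Eu n)} (D : DiffOp V) {K : Set (Eu n)}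
    (hK : IsCompact K) (hKV : K ⊆ V) : ∃ (C : ℝ) (N : ℕ), 0 ≤ C ∧
      ∀ u : Eu n → ℂ, ContDiffOn ℝ ∞ u V → ∀ x ∈ K, ∀ B : ℝ, 0 ≤ B →
        (∀ m ≤ N, ‖iteratedFDeriv ℝ m u x‖ ≤ B) → ‖D.transpose u x‖ ≤ C * B := by
  set N := D.terms.sup List.length with hN
  have h : ∀ w, ∃ C : ℝ, 0 ≤ C ∧ (w ∈ D.terms → ∀ u : Eu n → ℂ, ContDiffOn ℝ ∞ u V → ∀ x ∈ K,
      ∀ B : ℝ, 0 ≤ B → (∀ m ≤ N, ‖iteratedFDeriv ℝ m u x‖ ≤ B) →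
        ∀ m ≤ N, ‖iteratedFDeriv ℝ m (fun y => D.coeff w y * u y) x‖ ≤ C * B) := by
    intro w
    by_cases hw : w ∈ D.terms
    · obtain ⟨C, hC0, hC⟩ := exists_norm_iteratedFDeriv_mul_le V.isOpen hK hKV (D.smooth w hw) N
      exact ⟨C, hC0, fun _ => hC⟩
    · exact ⟨0, le_rfl, fun h => absurd h hw⟩
  choose C hC0 hC using h
  refine ⟨∑ w ∈ D.terms, C w, N, Finset.sum_nonneg fun w _ => hC0 w, fun u hu x hx B hB hb => ?_⟩
  refine (norm_sum_le _ _).trans ?_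
  rw [Finset.sum_mul]
  refine Finset.sum_le_sum fun w hw => ?_
  rw [norm_mul, norm_pow, norm_neg, norm_one, one_pow, one_mul]
  refine (norm_iterPartial_le V.isOpen ((D.smooth w hw).mul hu) _ (hKV hx)).trans ?_
  rw [List.length_reverse]
  exact hC w hw u hu x hx B hB hb _ (Finset.le_sup (f := List.length) hw)

theorem DiffOp.transpose_eq_zero {V : Opens (Eu n)} (D : DiffOp V) {u : Eu n → ℂ} {K : Set (Eu n)}
    (hK : IsCompact K) (hu : ∀ y ∈ V, y ∉ K → u y = 0) {x : Eu n} (hx : x ∈ V) (hxK : x ∉ K) :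
    D.transpose u x = 0 := by
  have h1 : u =ᶠ[𝓝 x] fun _ => (0 : ℂ) * 0 := by
    filter_upwards [V.isOpen.mem_nhds hx, hK.isClosed.isOpen_compl.mem_nhds hxK] with y hy hyK
    rw [hu y hy hyK, zero_mul]
  rw [D.transpose_congr h1, D.transpose_const_mul le_rfl (u := fun _ => 0) 0 contDiffOn_const hx,
    zero_mul]

/-! ### The cut off weight in one variable -/

/-- A function vanishing near `0` which tends to `1` away from `0` as `ν → ∞`. -/
def cutoff (ν : ℕ) (t : ℝ) : ℝ := Real.smoothTransition ((ν : ℝ) ^ 2 * t ^ 2 - 1)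

theorem contDiff_cutoff (ν : ℕ) : ContDiff ℝ ∞ (cutoff ν) :=
  Real.smoothTransition.contDiff.comp ((contDiff_const.mul (contDiff_id.pow 2)).sub contDiff_const)

/-- The weight as a function of the value of `f`. -/
def wt (δ : ZMod 2) (α β : ℂ) (t : ℝ) : ℂ :=
  ((SignType.sign t : ℝ) : ℂ) ^ δ.val * ((|t| : ℝ) : ℂ) ^ α * ((Real.log |t| : ℝ) : ℂ) ^ β

theorem cutoff_eq_cutLog {ν : ℕ} (hν : 0 < ν) {t : ℝ} (ht : t ≠ 0) :
    ((cutoff ν t : ℝ) : ℂ) = cutLog (Real.log |t| + Real.log ν) := by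
  have hν' : (0 : ℝ) < ν := Nat.cast_pos.2 hν
  rw [cutoff, cutLog]
  congr 3
  rw [← Real.log_mul (abs_pos.2 ht).ne' hν'.ne', mul_comm 2, Real.exp_mul, Real.exp_log (by positivity)]
  norm_num
  rw [mul_pow, sq_abs]
  ring

theorem ofReal_eq_sgn_mul_abs (t : ℝ) : (t : ℂ) = ((SignType.sign t : ℝ) : ℂ) * ((|t| : ℝ) : ℂ) := by
  rw [← Complex.ofReal_mul, sign_mul_abs]

/-- The bookkeeping that gives `γ = α + k - ℓ` and the sign exponent: `t^k = sg^k |t|^k` is absorbed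
in the weight, and `t^ℓ` is split off again. The hypothesis `log |t| < 0` puts the principal
logarithm of `log |t|` on the branch with argument `π` used in `powJet`. -/
theorem cutoff_mul_wt {ν : ℕ} (hν : 0 < ν) {t : ℝ} (ht : t ≠ 0) (hlog : Real.log |t| < 0)
    (δ : ZMod 2) (α β : ℂ) (k ℓ : ℕ) :
    (cutoff ν t : ℂ) * wt δ α β t * (t : ℂ) ^ k =
      sgnPow (δ.val + k + ℓ) t * cutPowJet ν (α + k - ℓ) β 0 (Real.log |t|) * (t : ℂ) ^ ℓ := by
  have habs : (0 : ℝ) < |t| := abs_pos.2 ht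
  have habs' : ((|t| : ℝ) : ℂ) ≠ 0 := Complex.ofReal_ne_zero.2 habs.ne'
  set s := Real.log |t| with hs
  have hs' : (s : ℂ) ≠ 0 := Complex.ofReal_ne_zero.2 hlog.ne
  have h1 : cutPowJet ν (α + k - ℓ) β 0 s =
      (cutoff ν t : ℂ) * (Complex.exp ((α + k - ℓ) * s + β * (Real.log (-s) + Real.pi * Complex.I))) := by
    rw [cutoff_eq_cutLog hν ht]; rfl
  have h2 : Complex.log (s : ℂ) = Real.log (-s) + Real.pi * Complex.I := by
    have h3 : (s : ℂ) = -((-s : ℝ) : ℂ) := by push_cast; ring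
    have h4 : Complex.arg (s : ℂ) = Real.pi := Complex.arg_ofReal_of_neg hlog
    rw [Complex.log, h4]
    congr 2
    rw [Complex.norm_real, Real.norm_eq_abs, abs_of_neg hlog]
  have h5 : Complex.log ((|t| : ℝ) : ℂ) = s := by rw [hs, Complex.ofReal_log habs.le]
  have h6 : Complex.exp ((α + k - ℓ) * s + β * (Real.log (-s) + Real.pi * Complex.I)) *
      ((|t| : ℝ) : ℂ) ^ ℓ = ((|t| : ℝ) : ℂ) ^ α * ((|t| : ℝ) : ℂ) ^ k * (s : ℂ) ^ β := by
    rw [Complex.cpow_def_of_ne_zero habs', Complex.cpow_def_of_ne_zero hs', h2, h5]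
    have h7 : ((|t| : ℝ) : ℂ) = Complex.exp s := by
      rw [← h5, Complex.exp_log habs']
    rw [h7, ← Complex.exp_nat_mul, ← Complex.exp_nat_mul, ← Complex.exp_add, ← Complex.exp_add,
      ← Complex.exp_add]
    congr 1
    ring
  -- Splitting off `t^ℓ` costs a factor `sg^ℓ`, which is its own inverse.
  have hsg : ((SignType.sign t : ℝ) : ℂ) ^ ℓ * ((SignType.sign t : ℝ) : ℂ) ^ ℓ = 1 := by
    rw [← mul_pow]
    rcases lt_or_gt_of_ne ht with h | h <;> simp [h]
  rw [h1, wt, sgnPow, ofReal_eq_sgn_mul_abs t, mul_pow, mul_pow, pow_add, pow_add]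
  linear_combination (-(cutoff ν t : ℂ) * ((SignType.sign t : ℝ) : ℂ) ^ δ.val *
    ((SignType.sign t : ℝ) : ℂ) ^ k) * (h6 * (((SignType.sign t : ℝ) : ℂ) ^ ℓ * ((SignType.sign t : ℝ) : ℂ) ^ ℓ)) +
    (-(cutoff ν t : ℂ) * ((SignType.sign t : ℝ) : ℂ) ^ δ.val *
    ((SignType.sign t : ℝ) : ℂ) ^ k * (((|t| : ℝ) : ℂ) ^ α * ((|t| : ℝ) : ℂ) ^ k * (s : ℂ) ^ β)) * hsg

namespace LocalTerm

variable {f : Eu n → ℝ} {V : Opens (Eu n)} (T : LocalTerm f V)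

theorem transpose_cut (hV : IsGoodDomain f V) {u : Eu n → ℂ} (hu : ContDiffOn ℝ ∞ u V) {x : Eu n}
    (hx : x ∈ V) (hx0 : f x ≠ 0) {ν : ℕ} (hν : 0 < ν) (δ : ZMod 2) (α β : ℂ) (k ℓ : ℕ) :
    T.D.transpose (fun y => (f y : ℂ) ^ k * T.c y * ((cutoff ν (f y) : ℂ) * wt δ α β (f y) * u y)) x =
      ∑ b ∈ Finset.range (T.order + 1), sgnPow (δ.val + k + ℓ) (f x) *
        jetCoeff T.order b (cutPowJet ν (α + k - ℓ) β) (Real.log |f x|) *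
          (T.F b).transpose (fun y => T.c y * ((f y : ℂ) ^ ℓ * u y)) x := by
  have hlog : ∀ y ∈ V, f y ≠ 0 → Real.log |f y| < 0 := fun y hy hy0 =>
    (hV.log_le hy hy0).trans_lt (by norm_num)
  -- The sign of `f` is constant near `x`, so it can be treated as a scalar and included in the jet.
  set σ := sgnPow (δ.val + k + ℓ) (f x) with hσ
  have hpos : IsOpen ((V : Set (Eu n)) ∩ (fun y => f y * f x) ⁻¹' Ioi 0) :=
    (hV.smooth.continuousOn.mul continuousOn_const).isOpen_inter_preimage V.isOpen isOpen_Ioi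
  have h1 : (fun y => (f y : ℂ) ^ k * T.c y * ((cutoff ν (f y) : ℂ) * wt δ α β (f y) * u y)) =ᶠ[𝓝 x]
      fun y => (σ * cutPowJet ν (α + k - ℓ) β 0 (Real.log |f y|)) *
        (T.c y * ((f y : ℂ) ^ ℓ * u y)) := by
    filter_upwards [hpos.mem_nhds ⟨hx, mul_self_pos.2 hx0⟩] with y hy
    have hyx : 0 < f y * f x := hy.2
    have hy0 : f y ≠ 0 := fun h => by simp [h] at hyx
    have hsgn : sgnPow (δ.val + k + ℓ) (f y) = σ := by
      rw [hσ, sgnPow, sgnPow]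
      have : SignType.sign (f y) = SignType.sign (f x) := by
        rcases lt_or_gt_of_ne hy0 with h | h
        · have h' : f x < 0 := by nlinarith
          rw [sign_neg h, sign_neg h']
        · have h' : 0 < f x := by nlinarith
          rw [sign_pos h, sign_pos h']
      rw [this]
    have h2 := cutoff_mul_wt hν hy0 (hlog y hy.1 hy0) δ α β k ℓ
    rw [hsgn] at h2
    linear_combination (T.c y * u y) * h2
  rw [T.D.transpose_congr h1]
  have h3 := transpose_jet_mul hV.smooth T.conj T.order_le le_rfl
    (T.smooth.mul ((hV.smooth_ofReal.pow ℓ).mul hu)) hx hx0 isOpen_Iio (hlog x hx hx0)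
    ((isJet_cutPowJet ν (α + k - ℓ) β).const_mul σ)
  rw [h3]
  refine Finset.sum_congr rfl fun b _ => ?_
  congr 1
  simp only [jetCoeff, Finset.mul_sum]
  exact Finset.sum_congr rfl fun i _ => by ring

variable {K : Set (Eu n)} {u : Eu n → ℂ}

theorem setIntegral_eq_of_support {g : Eu n → ℂ} (hKV : K ⊆ V)
    (hg : ∀ x ∈ V, x ∉ K → g x = 0) :
    ∫ x in (V : Set (Eu n)), g x = ∫ x in K, g x :=
  setIntegral_eq_of_subset_of_forall_sdiff_eq_zero V.isOpen.measurableSet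
      hKV fun x hx => hg x hx.1 hx.2

theorem integral_eq (hK : IsCompact K) (hKV : K ⊆ V) (hu0 : ∀ y ∈ V, y ∉ K → u y = 0)
    (d : ℕ) (γ β : ℂ) :
    T.integral d γ β u = ∫ x in K, ∑ b ∈ Finset.range (T.order + 1),
      T.kernel d b γ β x * (T.F b).transpose (fun y => T.c y * u y) x := by
  refine setIntegral_eq_of_support hKV fun x hx hxK => Finset.sum_eq_zero fun b _ => ?_
  rw [(T.F b).transpose_eq_zero hK (fun y hy hyK => by rw [hu0 y hy hyK, mul_zero]) hx hxK, mul_zero]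

theorem exists_norm_transpose_le (hK : IsCompact K) (hKV : K ⊆ V) (hu : ContDiffOn ℝ ∞ u V) :
    ∃ A : ℝ, 0 ≤ A ∧ ∀ b ∈ Finset.range (T.order + 1), ∀ x ∈ K,
      ‖(T.F b).transpose (fun y => T.c y * u y) x‖ ≤ A := by
  have h : ∀ b, ∃ A : ℝ, ∀ x ∈ K, ‖(T.F b).transpose (fun y => T.c y * u y) x‖ ≤ A := fun b =>
    hK.exists_bound_of_continuousOn
      ((contDiffOn_transpose (T.F b) le_rfl (T.smooth.mul hu)).continuousOn.mono hKV)
  choose A hA using h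
  refine ⟨∑ b ∈ Finset.range (T.order + 1), |A b|, Finset.sum_nonneg fun b _ => abs_nonneg _,
    fun b hb x hx => ((hA b x hx).trans (le_abs_self _)).trans ?_⟩
  exact Finset.single_le_sum (f := fun b => |A b|) (fun b _ => abs_nonneg _) hb

/-- Dominated convergence. For finite `ν` the cut off weight is a smooth multiplier; after it has
been carried across `D`, the integrands have a majorant independent of `ν`, and at each point with
`f ≠ 0` the cutoff eventually has no effect. -/
theorem tendsto_integral_cut (hV : IsGoodDomain f V) (hK : IsCompact K) (hKV : K ⊆ V)
    (hu : ContDiffOn ℝ ∞ u V) (hu0 : ∀ y ∈ V, y ∉ K → u y = 0) (δ : ZMod 2) (α β : ℂ) (k ℓ : ℕ)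
    (hγ : -1 < (α + k - ℓ).re)
    (hg : ∀ ν, ContDiffOn ℝ ∞ (fun y => (cutoff ν (f y) : ℂ) * wt δ α β (f y)) V) :
    Filter.Tendsto (fun ν => ∫ x in (V : Set (Eu n)), T.h x * T.D.transpose
      (fun y => (f y : ℂ) ^ k * T.c y * ((cutoff ν (f y) : ℂ) * wt δ α β (f y) * u y)) x)
      Filter.atTop
      (𝓝 (T.integral (δ.val + k + ℓ) (α + k - ℓ) β (fun y => (f y : ℂ) ^ ℓ * u y))) := by
  set γ := α + k - ℓ with hγ'
  set d := δ.val + k + ℓ with hd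
  have hfu : ContDiffOn ℝ ∞ (fun y => (f y : ℂ) ^ ℓ * u y) V := (hV.smooth_ofReal.pow ℓ).mul hu
  obtain ⟨B, hBint, hB0, hB⟩ := T.exists_bound hV hK hKV (max ‖γ‖ ‖β‖) hγ
  obtain ⟨A, hA0, hA⟩ := T.exists_norm_transpose_le hK hKV hfu
  rw [T.integral_eq hK hKV fun y hy hyK => by rw [hu0 y hy hyK, mul_zero]]
  have hsupp : ∀ ν, ∫ x in (V : Set (Eu n)), T.h x * T.D.transpose
      (fun y => (f y : ℂ) ^ k * T.c y * ((cutoff ν (f y) : ℂ) * wt δ α β (f y) * u y)) x =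
      ∫ x in K, T.h x * T.D.transpose
      (fun y => (f y : ℂ) ^ k * T.c y * ((cutoff ν (f y) : ℂ) * wt δ α β (f y) * u y)) x := fun ν =>
    setIntegral_eq_of_support hKV fun x hx hxK => by
      rw [T.D.transpose_eq_zero hK (fun y hy hyK => by rw [hu0 y hy hyK]; simp) hx hxK, mul_zero]
  simp only [hsupp]
  have hform : ∀ᵐ x ∂(volume.restrict K), ∀ ν : ℕ, 0 < ν → T.h x * T.D.transpose
      (fun y => (f y : ℂ) ^ k * T.c y * ((cutoff ν (f y) : ℂ) * wt δ α β (f y) * u y)) x =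
      ∑ b ∈ Finset.range (T.order + 1), T.h x * (sgnPow d (f x) *
        jetCoeff T.order b (cutPowJet ν γ β) (Real.log |f x|)) *
          (T.F b).transpose (fun y => T.c y * ((f y : ℂ) ^ ℓ * u y)) x := by
    filter_upwards [hV.ae_mem_ne_zero hK hKV] with x hx ν hν
    rw [T.transpose_cut hV hu (hKV hx.1) hx.2 hν δ α β k ℓ, Finset.mul_sum]
    exact Finset.sum_congr rfl fun b _ => by ring
  -- The index `ν = 0` is skipped: the description of the cutoff through `log ν` needs `ν > 0`.
  refine (Filter.tendsto_add_atTop_iff_nat 1).1 ?_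
  refine tendsto_integral_of_dominated_convergence
    (fun x => ∑ b ∈ Finset.range (T.order + 1), B x * A) (fun ν => ?_) ?_ (fun ν => ?_) ?_
  · refine (T.bounded K hK hKV).1.mul ?_
    refine ContinuousOn.aestronglyMeasurable ?_ hK.isClosed.measurableSet
    exact (contDiffOn_transpose T.D le_rfl (((hV.smooth_ofReal.pow k).mul T.smooth).mul
      ((hg _).mul hu))).continuousOn.mono hKV
  · exact integrable_finsetSum _ fun b _ => hBint.mul_const A
  · filter_upwards [hform, hB, ae_restrict_mem hK.isClosed.measurableSet] with x hx hBx hxK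
    rw [hx (ν + 1) (Nat.succ_pos ν)]
    refine (norm_sum_le _ _).trans (Finset.sum_le_sum fun b hb => ?_)
    rw [norm_mul]
    exact mul_le_mul ((hBx γ β (le_max_left _ _) (le_max_right _ _) le_rfl b hb d).2 _)
      (hA b hb x hxK) (norm_nonneg _) (hB0 x)
  · filter_upwards [hform] with x hx
    refine Filter.Tendsto.congr (fun ν => (hx (ν + 1) (Nat.succ_pos ν)).symm) ?_
    refine tendsto_finsetSum _ fun b _ => ?_
    refine Filter.Tendsto.mul_const _ (Filter.Tendsto.const_mul _ (Filter.Tendsto.const_mul _ ?_))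
    exact (Filter.tendsto_add_atTop_iff_nat 1).2
      (tendsto_const_nhds.congr' ((tendsto_jetCoeff_cut T.order b γ β _).mono fun ν h => h.symm))

/-- With all exponents zero the multiplier is the constant `1`, so the expansion over the conjugates
collapses to `D` itself. This identifies the limit of the cutoffs of `σ` with `σ`, which yields
uniqueness. -/
theorem integral_zero (hV : IsGoodDomain f V) (hK : IsCompact K) (hKV : K ⊆ V)
    (hu : ContDiffOn ℝ ∞ u V) (hu0 : ∀ y ∈ V, y ∉ K → u y = 0) :
    T.integral 0 0 0 u = ∫ x in (V : Set (Eu n)), T.h x * T.D.transpose (fun y => T.c y * u y) x := by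
  rw [T.integral_eq hK hKV hu0, setIntegral_eq_of_support hKV fun x hx hxK => by
    rw [T.D.transpose_eq_zero hK (fun y hy hyK => by rw [hu0 y hy hyK, mul_zero]) hx hxK, mul_zero]]
  refine integral_congr_ae ?_
  filter_upwards [hV.ae_mem_ne_zero hK hKV] with x hx
  have hlog : Real.log |f x| < 0 := (hV.log_le (hKV hx.1) hx.2).trans_lt (by norm_num)
  have h1 := transpose_jet_mul hV.smooth T.conj T.order_le le_rfl (T.smooth.mul hu) (hKV hx.1) hx.2
    isOpen_Iio hlog (isJet_powJet 0 0)
  have h2 : (fun y => powJet 0 0 0 (Real.log |f y|) * (T.c y * u y)) = fun y => T.c y * u y := by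
    funext y; simp [powJet]
  rw [h2] at h1
  rw [h1, Finset.mul_sum]
  refine Finset.sum_congr rfl fun b _ => ?_
  simp only [kernel, sgnPow, pow_zero, one_mul]
  ring

theorem exists_norm_integral_le (hV : IsGoodDomain f V) (hK : IsCompact K) (hKV : K ⊆ V)
    (d : ℕ) {γ : ℂ} (hγ : -1 < γ.re) (β : ℂ) :
    ∃ (C : ℝ) (N : ℕ), 0 ≤ C ∧ ∀ u : Eu n → ℂ, ContDiffOn ℝ ∞ u V → (∀ y ∈ V, y ∉ K → u y = 0) →
      ∀ b : ℝ, 0 ≤ b → (∀ m ≤ N, ∀ x ∈ K, ‖iteratedFDeriv ℝ m u x‖ ≤ b) →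
        ‖T.integral d γ β u‖ ≤ C * b := by
  obtain ⟨B, hBint, hB0, hB⟩ := T.exists_bound hV hK hKV (max ‖γ‖ ‖β‖) hγ
  choose C N hC0 hC using fun b => (T.F b).exists_norm_transpose_le hK hKV
  set N' := (Finset.range (T.order + 1)).sup N with hN'
  obtain ⟨C', hC'0, hC'⟩ := exists_norm_iteratedFDeriv_mul_le V.isOpen hK hKV T.smooth N'
  refine ⟨(∑ b ∈ Finset.range (T.order + 1), C b * C') * ∫ x in K, B x, N',
    mul_nonneg (Finset.sum_nonneg fun b _ => mul_nonneg (hC0 b) hC'0)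
      (integral_nonneg hB0), fun u hu hu0 a ha hua => ?_⟩
  rw [T.integral_eq hK hKV hu0]
  have h1 : ∀ᵐ x ∂(volume.restrict K), ‖∑ b ∈ Finset.range (T.order + 1),
      T.kernel d b γ β x * (T.F b).transpose (fun y => T.c y * u y) x‖ ≤
      (∑ b ∈ Finset.range (T.order + 1), C b * C') * a * B x := by
    filter_upwards [hB, ae_restrict_mem hK.isClosed.measurableSet] with x hBx hxK
    refine (norm_sum_le _ _).trans ?_
    rw [Finset.sum_mul, Finset.sum_mul]
    refine Finset.sum_le_sum fun b hb => ?_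
    rw [norm_mul, mul_comm]
    refine mul_le_mul ?_ (hBx γ β (le_max_left _ _) (le_max_right _ _) le_rfl b hb d).1
      (norm_nonneg _) (mul_nonneg (mul_nonneg (hC0 b) hC'0) ha)
    have h2 := hC' u hu x hxK a ha (fun m hm => hua m hm x hxK)
    rw [mul_assoc]
    exact hC b _ (T.smooth.mul hu) x hxK _ (mul_nonneg hC'0 ha) fun m hm =>
      h2 m (hm.trans (Finset.le_sup (f := N) hb))
  refine (norm_integral_le_of_norm_le (hBint.const_mul _) h1).trans (le_of_eq ?_)
  rw [integral_const_mul]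
  ring

theorem differentiableAt_integral (hV : IsGoodDomain f V) (hK : IsCompact K) (hKV : K ⊆ V)
    (hu : ContDiffOn ℝ ∞ u V) (hu0 : ∀ y ∈ V, y ∉ K → u y = 0) (d : ℕ) (a : ℂ) {z₀ : ℂ × ℂ}
    (hz₀ : -1 < (z₀.1 + a).re) :
    DifferentiableAt ℂ (fun z : ℂ × ℂ => T.integral d (z.1 + a) z.2 u) z₀ := by
  -- Half the distance to the line `Re = -1`: on the ball of this radius the real part stays above
  -- `((z₀.1 + a).re - 1)/2 > -1`.
  set r := ((z₀.1 + a).re + 1) / 2 with hr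
  have hr0 : 0 < r := by rw [hr]; linarith
  obtain ⟨B, hBint, hB0, hB⟩ := T.exists_bound hV hK hKV (‖z₀‖ + r + ‖a‖)
    (r₀ := ((z₀.1 + a).re - 1) / 2) (by linarith)
  obtain ⟨A, hA0, hA⟩ := T.exists_norm_transpose_le hK hKV hu
  simp only [T.integral_eq hK hKV hu0]
  refine differentiableAt_integral_of_bound hr0
    (B := fun x => ∑ b ∈ Finset.range (T.order + 1), B x * A) ?_ (fun z _ => ?_) ?_ (fun x => ?_)
  · exact integrable_finsetSum _ fun b _ => hBint.mul_const A
  · refine Finset.aestronglyMeasurable_fun_sum _ fun b _ => ?_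
    refine (T.aestronglyMeasurable_kernel hV.smooth.continuousOn hK hKV d b _ _).mul ?_
    refine ContinuousOn.aestronglyMeasurable ?_ hK.isClosed.measurableSet
    exact (contDiffOn_transpose (T.F b) le_rfl (T.smooth.mul hu)).continuousOn.mono hKV
  · filter_upwards [hB, ae_restrict_mem hK.isClosed.measurableSet] with x hBx hxK z hz
    refine (norm_sum_le _ _).trans (Finset.sum_le_sum fun b hb => ?_)
    rw [norm_mul]
    have hz' : ‖z - z₀‖ < r := by rwa [mem_ball_iff_norm] at hz
    have hzn : ‖z‖ ≤ ‖z₀‖ + r := by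
      have := norm_sub_norm_le z z₀
      linarith
    have h1 : ‖z.1 + a‖ ≤ ‖z₀‖ + r + ‖a‖ :=
      (norm_add_le _ _).trans (by linarith [norm_fst_le z])
    have h2 : ‖z.2‖ ≤ ‖z₀‖ + r + ‖a‖ := by linarith [norm_snd_le z, norm_nonneg a]
    have h3 : ((z₀.1 + a).re - 1) / 2 ≤ (z.1 + a).re := by
      have h4 : |(z.1 - z₀.1).re| < r :=
        ((Complex.abs_re_le_norm _).trans (norm_fst_le (z - z₀))).trans_lt hz'
      have h5 := (abs_lt.1 h4).1
      simp only [Complex.sub_re, Complex.add_re] at h5 hr ⊢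
      linarith
    exact mul_le_mul (hBx _ _ h1 h2 h3 b hb d).1 (hA b hb x hxK) (norm_nonneg _) (hB0 x)
  · refine Differentiable.differentiableOn ?_
    refine Differentiable.fun_sum fun b _ => ?_
    refine Differentiable.mul_const ?_ _
    simp only [kernel, jetCoeff]
    refine (((Differentiable.fun_sum fun i _ => ?_).const_mul _).const_mul _)
    exact (differentiable_powJet i _ (differentiable_fst.add_const a) differentiable_snd).const_mul _

end LocalTerm

end

/-! ### Densities in different charts, and localisation by partitions of unity. -/

section

variable {n : ℕ} {M : Type*} [TopologicalSpace M] [ChartedSpace (Eu n) M]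

/-! ### Changes of coordinates -/

theorem contDiffOn_transition {e e₀ : OpenPartialHomeomorph M (Eu n)} (he : IsSmoothChart e)
    (he₀ : IsSmoothChart e₀) :
    ContDiffOn ℝ ∞ (fun x => e₀ (e.symm x)) (e.target ∩ e.symm ⁻¹' e₀.source) :=
  ((contMDiffOn_of_mem_maximalAtlas (I := 𝓘(ℝ, Eu n)) he₀).comp
    ((contMDiffOn_symm_of_mem_maximalAtlas (I := 𝓘(ℝ, Eu n)) he).mono inter_subset_left)
    fun _ hx => hx.2).contDiffOn

theorem isOpen_transition {X : Type*} [TopologicalSpace X]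
    (e e₀ : OpenPartialHomeomorph X (Eu n)) :
    IsOpen (e.target ∩ e.symm ⁻¹' e₀.source) :=
  e.isOpen_inter_preimage_symm e₀.open_source

theorem hasFDerivAt_transition {e e₀ : OpenPartialHomeomorph M (Eu n)} (he : IsSmoothChart e)
    (he₀ : IsSmoothChart e₀) {x : Eu n} (hx : x ∈ e.target) (hx₀ : e.symm x ∈ e₀.source) :
    HasFDerivAt (fun x => e₀ (e.symm x)) (fderiv ℝ (fun x => e₀ (e.symm x)) x) x :=
  (((contDiffOn_transition he he₀).contDiffAt
    ((isOpen_transition e e₀).mem_nhds ⟨hx, hx₀⟩)).differentiableAt (by simp)).hasFDerivAt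

theorem fderiv_transition_comp {e e₀ e₁ : OpenPartialHomeomorph M (Eu n)} (he : IsSmoothChart e)
    (he₀ : IsSmoothChart e₀) (he₁ : IsSmoothChart e₁) {x : Eu n} (hx : x ∈ e.target)
    (hx₀ : e.symm x ∈ e₀.source) (hx₁ : e.symm x ∈ e₁.source) :
    (fderiv ℝ (fun y => e₁ (e.symm y)) x).det =
      (fderiv ℝ (fun y => e₁ (e₀.symm y)) (e₀ (e.symm x))).det *
        (fderiv ℝ (fun y => e₀ (e.symm y)) x).det := by
  have h1 := hasFDerivAt_transition he he₀ hx hx₀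
  have h2 := hasFDerivAt_transition he₀ he₁ (x := e₀ (e.symm x)) (e₀.map_source hx₀)
    (by rwa [e₀.left_inv hx₀])
  have h3 := h2.comp x h1
  have h4 : (fun y => e₁ (e.symm y)) =ᶠ[𝓝 x]
      ((fun y => e₁ (e₀.symm y)) ∘ fun y => e₀ (e.symm y)) := by
    filter_upwards [(isOpen_transition e e₀).mem_nhds ⟨hx, hx₀⟩] with y hy
    simp only [Function.comp_apply]
    rw [e₀.left_inv hy.2]
  rw [h4.fderiv_eq, h3.fderiv]
  exact LinearMap.det_comp _ _

theorem det_transition_ne_zero {e e₀ : OpenPartialHomeomorph M (Eu n)} (he : IsSmoothChart e)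
    (he₀ : IsSmoothChart e₀) {x : Eu n} (hx : x ∈ e.target) (hx₀ : e.symm x ∈ e₀.source) :
    (fderiv ℝ (fun y => e₀ (e.symm y)) x).det ≠ 0 := by
  have h1 := fderiv_transition_comp he he₀ he hx hx₀ (e.map_target hx)
  have h2 : (fun y => e (e.symm y)) =ᶠ[𝓝 x] id := by
    filter_upwards [e.open_target.mem_nhds hx] with y hy using e.right_inv hy
  rw [h2.fderiv_eq, fderiv_id] at h1
  intro h
  rw [h, mul_zero] at h1
  have h3 : (ContinuousLinearMap.id ℝ (Eu n)).det = 1 := LinearMap.det_id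
  rw [h3] at h1
  exact one_ne_zero h1

theorem contDiff_det : ContDiff ℝ ∞ (fun A : Eu n →L[ℝ] Eu n => A.det) := by
  have h : (fun A : Eu n →L[ℝ] Eu n => A.det) = fun A => Matrix.det (Matrix.of
      fun i j => A (stdVec j) i) := by
    funext A
    change LinearMap.det (A : Eu n →ₗ[ℝ] Eu n) = _
    rw [← LinearMap.det_toMatrix (EuclideanSpace.basisFun (Fin n) ℝ).toBasis]
    congr 1
  rw [h]
  simp only [Matrix.det_apply]
  refine ContDiff.sum fun τ _ => ContDiff.const_smul _ (contDiff_prod fun i _ => ?_)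
  exact (EuclideanSpace.proj (𝕜 := ℝ) (τ i)).contDiff.comp
    (contDiff_id.clm_apply contDiff_const)

/-- The absolute value of the Jacobian determinant of a change of coordinates. -/
def jac (e e₀ : OpenPartialHomeomorph M (Eu n)) (x : Eu n) : ℂ :=
  ((|(fderiv ℝ (fun y => e₀ (e.symm y)) x).det| : ℝ) : ℂ)

theorem contDiffOn_jac {e e₀ : OpenPartialHomeomorph M (Eu n)} (he : IsSmoothChart e)
    (he₀ : IsSmoothChart e₀) : ContDiffOn ℝ ∞ (jac e e₀) (e.target ∩ e.symm ⁻¹' e₀.source) := by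
  intro x hx
  have h1 : ContDiffAt ℝ ∞ (fun x => (fderiv ℝ (fun y => e₀ (e.symm y)) x).det) x :=
    contDiff_det.contDiffAt.comp x (((contDiffOn_transition he he₀).fderiv_of_isOpen
      (isOpen_transition e e₀) (m := ∞) (by simp)).contDiffAt
        ((isOpen_transition e e₀).mem_nhds hx))
  exact (Complex.ofRealCLM.contDiff.contDiffAt.comp x
    (h1.abs (det_transition_ne_zero he he₀ hx.1 hx.2))).contDiffWithinAt

/-- Both sides refer to the preferred chart at the same point of `M`, so the chain rule for Jacobian
determinants gives the factor. -/
theorem densityCoord_eq [IsManifold 𝓘(ℝ, Eu n) ∞ M] {e e₀ : OpenPartialHomeomorph M (Eu n)}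
    (he : IsSmoothChart e) (he₀ : IsSmoothChart e₀) (ρ : M → ℂ) {x : Eu n} (hx : x ∈ e.target)
    (hx₀ : e.symm x ∈ e₀.source) :
    densityCoord e ρ x = jac e e₀ x * densityCoord e₀ ρ (e₀ (e.symm x)) := by
  have hc : IsSmoothChart (chartAt (Eu n) (e.symm x)) := IsManifold.chart_mem_maximalAtlas _
  have h1 := fderiv_transition_comp he he₀ hc hx hx₀ (mem_chart_source _ _)
  simp only [densityCoord, jac]
  rw [e₀.left_inv hx₀, h1, abs_mul]
  push_cast
  ring

theorem densityCoord_eventuallyEq_zero [T2Space M] {e : OpenPartialHomeomorph M (Eu n)}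
    {ρ : M → ℂ} {Z : Set M} (hZ : IsCompact Z) (hρ : ∀ p, ρ p ≠ 0 → p ∈ Z) {x : Eu n}
    (hx : x ∈ e.target) (hxZ : e.symm x ∉ Z) : densityCoord e ρ =ᶠ[𝓝 x] fun _ => 0 := by
  have ho := e.isOpen_inter_preimage_symm hZ.isClosed.isOpen_compl
  filter_upwards [ho.mem_nhds ⟨hx, hxZ⟩] with y hy
  have : ρ (e.symm y) = 0 := by
    by_contra h
    exact hy.2 (hρ _ h)
  simp [densityCoord, this]

/-- Continuity is tested in an arbitrary chart, while the estimates live in the chart of the local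
representation. Seminorms are compared by bounding the derivatives of a composition with the
transition map and of the product with its Jacobian. -/
theorem exists_norm_densityCoord_le [T2Space M] [IsManifold 𝓘(ℝ, Eu n) ∞ M]
    {e e₀ : OpenPartialHomeomorph M (Eu n)}
    (he : IsSmoothChart e) (he₀ : IsSmoothChart e₀) {K K₀ : Set (Eu n)} (hK : IsCompact K)
    (hKe : K ⊆ e.target) (hK₀ : IsCompact K₀) (hK₀e : K₀ ⊆ e₀.target) (N : ℕ) :
    ∃ C : ℝ, 0 ≤ C ∧ ∀ ρ ∈ smoothMeasure (n := n) (⊤ : Opens M),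
      (∀ p, ρ p ≠ 0 → p ∈ e₀.source ∧ e₀ p ∈ K₀) → ∀ B : ℝ, 0 ≤ B →
      (∀ m ≤ N, ∀ x ∈ K₀, ‖iteratedFDeriv ℝ m (densityCoord e₀ ρ) x‖ ≤ B) →
        ∀ m ≤ N, ∀ x ∈ K, ‖iteratedFDeriv ℝ m (densityCoord e ρ) x‖ ≤ C * B := by
  set Z : Set M := e₀.symm '' K₀ with hZ
  have hZc : IsCompact Z := hK₀.image_of_continuousOn (e₀.continuousOn_symm.mono hK₀e)
  set K₁ : Set (Eu n) := K ∩ e.symm ⁻¹' Z with hK₁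
  have hK₁c : IsCompact K₁ := hK.of_isClosed_subset
    ((e.continuousOn_symm.mono hKe).preimage_isClosed_of_isClosed hK.isClosed hZc.isClosed)
    inter_subset_left
  set O := e.target ∩ e.symm ⁻¹' e₀.source with hO
  have hOo : IsOpen O := isOpen_transition e e₀
  have hK₁O : K₁ ⊆ O := by
    rintro x ⟨hx, y, hy, hxy⟩
    refine ⟨hKe hx, ?_⟩
    rw [mem_preimage, ← hxy]
    exact e₀.map_target (hK₀e hy)
  set T : Eu n → Eu n := fun x => e₀ (e.symm x) with hT
  have hTs : ContDiffOn ℝ ∞ T O := contDiffOn_transition he he₀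
  have hTK : ∀ x ∈ K₁, T x ∈ K₀ := by
    rintro x ⟨hx, y, hy, hxy⟩
    rw [hT]
    simp only
    rw [← hxy, e₀.right_inv (hK₀e hy)]
    exact hy
  have hbd : ∀ i : ℕ, ∃ A : ℝ, ∀ x ∈ K₁, ‖iteratedFDerivWithin ℝ i T O x‖ ≤ A := fun i =>
    hK₁c.exists_bound_of_continuousOn
      ((hTs.continuousOn_iteratedFDerivWithin (m := i) (by exact_mod_cast le_top)
        hOo.uniqueDiffOn).mono hK₁O)
  choose A hA using hbd
  -- The bound for composed derivatives asks that the `i`-th derivative be at most `D^i`; `D ≥ 1`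
  -- ensures `D ≤ D^i` for `i ≥ 1`.
  set D : ℝ := 1 + ∑ i ∈ Finset.range (N + 1), |A i| with hD
  have hD1 : 1 ≤ D := le_add_of_nonneg_right (Finset.sum_nonneg fun i _ => abs_nonneg _)
  have hAD : ∀ i ≤ N, A i ≤ D := fun i hi => by
    have := Finset.single_le_sum (f := fun i => |A i|) (fun i _ => abs_nonneg _)
      (Finset.mem_range.2 (Nat.lt_succ_of_le hi))
    have h2 := le_abs_self (A i)
    rw [hD]; linarith
  obtain ⟨C, hC0, hC⟩ := exists_norm_iteratedFDeriv_mul_le hOo hK₁c hK₁O (contDiffOn_jac he he₀) N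
  refine ⟨C * (N.factorial * D ^ N), by positivity, fun ρ hρ hsupp B hB hb m hm x hx => ?_⟩
  by_cases hxZ : e.symm x ∈ Z
  · have hx₁ : x ∈ K₁ := ⟨hx, hxZ⟩
    have hφ : ContDiffOn ℝ ∞ (densityCoord e₀ ρ) e₀.target := hρ.2.2 e₀ he₀
    have hmaps : MapsTo T O e₀.target := fun y hy => e₀.map_source hy.2
    have hcomp : ∀ m ≤ N, ‖iteratedFDeriv ℝ m (densityCoord e₀ ρ ∘ T) x‖ ≤
        N.factorial * D ^ N * B := by
      intro m hm
      rw [← iteratedFDerivWithin_of_isOpen m hOo (hK₁O hx₁)]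
      have h1 := norm_iteratedFDerivWithin_comp_le hφ hTs (n := m) (by exact_mod_cast le_top)
        e₀.open_target.uniqueDiffOn hOo.uniqueDiffOn hmaps (hK₁O hx₁) (C := B) (D := D)
        (fun i hi => by
          rw [iteratedFDerivWithin_of_isOpen i e₀.open_target (hmaps (hK₁O hx₁))]
          exact hb i (hi.trans hm) _ (hTK x hx₁))
        (fun i hi1 hi => ((hA i x hx₁).trans (hAD i (hi.trans hm))).trans
          (le_self_pow₀ hD1 (by omega)))
      refine h1.trans ?_
      have h2 : (m.factorial : ℝ) ≤ N.factorial := by exact_mod_cast Nat.factorial_le hm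
      have h3 : D ^ m ≤ D ^ N := pow_le_pow_right₀ hD1 hm
      calc (m.factorial : ℝ) * B * D ^ m ≤ N.factorial * B * D ^ N := by gcongr
        _ = N.factorial * D ^ N * B := by ring
    have h4 := hC (densityCoord e₀ ρ ∘ T) (hφ.comp hTs hmaps) x hx₁ _ (by positivity) hcomp m hm
    have h5 : densityCoord e ρ =ᶠ[𝓝 x] fun y => jac e e₀ y * (densityCoord e₀ ρ ∘ T) y := by
      filter_upwards [hOo.mem_nhds (hK₁O hx₁)] with y hy
      exact densityCoord_eq he he₀ ρ hy.1 hy.2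
    rw [(h5.iteratedFDeriv ℝ m).self_of_nhds]
    refine h4.trans (le_of_eq ?_)
    ring
  -- Off the compact, hence closed, set `Z` the density vanishes in a neighbourhood, and so do all
  -- its derivatives.
  · have h1 : densityCoord e ρ =ᶠ[𝓝 x] fun _ => 0 :=
      densityCoord_eventuallyEq_zero hZc (fun p hp =>
        ⟨e₀ p, (hsupp p hp).2, e₀.left_inv (hsupp p hp).1⟩) (hKe hx) hxZ
    rw [(h1.iteratedFDeriv ℝ m).self_of_nhds]
    have h2 : iteratedFDeriv ℝ m (fun _ : Eu n => (0 : ℂ)) x = 0 := by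
      simp
    rw [h2, norm_zero]
    positivity

/-! ### Partitions of unity -/

section Partition

variable [T2Space M] [SecondCountableTopology M] [IsManifold 𝓘(ℝ, Eu n) ∞ M]

theorem exists_finite_partition {s : Set M} (hs : IsCompact s) {U : M → Set M}
    (hU : ∀ q ∈ s, IsOpen (U q) ∧ q ∈ U q) :
    ∃ (t : Finset s) (χ : s → M → ℂ), (∀ q, ContMDiff 𝓘(ℝ, Eu n) 𝓘(ℝ, ℂ) ∞ (χ q)) ∧
      (∀ q, tsupport (χ q) ⊆ U q) ∧ ∀ p ∈ s, ∑ q ∈ t, χ q p = 1 := by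
  have hlc : LocallyCompactSpace M := ChartedSpace.locallyCompactSpace (Eu n) M
  obtain ⟨ρ, hρ⟩ := SmoothPartitionOfUnity.exists_isSubordinate 𝓘(ℝ, Eu n) hs.isClosed
    (fun q : s => U q) (fun q => (hU q q.2).1) (fun q hq => mem_iUnion.2 ⟨⟨q, hq⟩, (hU q hq).2⟩)
  have hfin := ρ.locallyFinite.finite_nonempty_inter_compact hs
  refine ⟨hfin.toFinset, fun q p => ((ρ q p : ℝ) : ℂ), fun q => ?_, fun q => ?_, fun p hp => ?_⟩
  · exact Complex.ofRealCLM.contDiff.contMDiff.comp (ρ q).contMDiff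
  · refine (closure_mono fun p hp => ?_).trans (hρ q)
    rw [Function.mem_support] at hp ⊢
    exact fun h => hp (by change ((ρ q p : ℝ) : ℂ) = 0; rw [h, Complex.ofReal_zero])
  · have h1 := ρ.sum_eq_one hp
    rw [finsum_eq_sum_of_support_subset (s := hfin.toFinset)] at h1
    · rw [← Complex.ofReal_sum, h1, Complex.ofReal_one]
    · intro q hq
      rw [Set.Finite.coe_toFinset]
      exact ⟨p, hq, hp⟩

/-- A partition of unity writes `μ` as a finite sum of measures with support in the given
neighbourhoods. -/
theorem smoothMeasure_induction {U : Opens M} {P : smoothMeasure (n := n) U → Prop} (h0 : P 0)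
    (hadd : ∀ μ μ', P μ → P μ' → P (μ + μ'))
    (hloc : ∀ q ∈ U, ∃ O : Set M, IsOpen O ∧ q ∈ O ∧
      ∀ μ : smoothMeasure (n := n) U, tsupport (μ : M → ℂ) ⊆ O → P μ) : ∀ μ, P μ := by
  intro μ
  choose! O hOo hqO hO using hloc
  obtain ⟨t, χ, hχ, hχO, hsum⟩ := exists_finite_partition (n := n) (s := tsupport (μ : M → ℂ))
    μ.2.1 (U := O) fun q hq => ⟨hOo q (μ.2.2.1 hq), hqO q (μ.2.2.1 hq)⟩
  have h1 : μ = ∑ q ∈ t, mulMeasure (χ q) (hχ q).contMDiffOn μ := by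
    ext p
    have h2 : ((∑ q ∈ t, mulMeasure (χ q) (hχ q).contMDiffOn μ : smoothMeasure (n := n) U) :
        M → ℂ) p = ∑ q ∈ t, χ q p * (μ : M → ℂ) p := by
      rw [AddSubmonoidClass.coe_finsetSum, Finset.sum_apply]
      rfl
    rw [h2, ← Finset.sum_mul]
    by_cases hp : p ∈ tsupport (μ : M → ℂ)
    · rw [hsum p hp, one_mul]
    · rw [image_eq_zero_of_notMem_tsupport hp, mul_zero]
  have h3 : ∀ t' : Finset (tsupport (μ : M → ℂ)),
      P (∑ q ∈ t', mulMeasure (χ q) (hχ q).contMDiffOn μ) := by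
    classical
    intro t'
    induction t' using Finset.induction_on with
    | empty => simpa using h0
    | insert q t' hq ih =>
      rw [Finset.sum_insert hq]
      refine hadd _ _ (hO q (μ.2.2.1 q.2) _ ?_) ih
      exact tsupport_mul_subset_left.trans (hχO q)
  rw [h1]
  exact h3 t

theorem isContinuousFunctional_of_local {T : smoothMeasure (n := n) (⊤ : Opens M) →ₗ[ℂ] ℂ}
    (h : ∀ q : M, ∃ O : Set M, IsOpen O ∧ q ∈ O ∧ ∀ (χ : M → ℂ)
      (hχ : ContMDiffOn 𝓘(ℝ, Eu n) 𝓘(ℝ, ℂ) ∞ χ (⊤ : Opens M)), tsupport χ ⊆ O →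
        IsContinuousFunctional ⊤ (T ∘ₗ mulMeasure χ hχ)) :
    IsContinuousFunctional ⊤ T := by
  choose O hOo hqO hO using h
  intro e he K hK hKe hKU
  have hsc : IsCompact (e.symm '' K) := hK.image_of_continuousOn (e.continuousOn_symm.mono hKe)
  obtain ⟨t, χ, hχ, hχO, hsum⟩ := exists_finite_partition (n := n) hsc (U := O)
    fun q _ => ⟨hOo q, hqO q⟩
  choose C N hC using fun q => hO q.1 (χ q) (hχ q).contMDiffOn (hχO q) e he K hK hKe hKU
  refine ⟨∑ q ∈ t, |C q|, t.sup N, fun μ hμ B hB hb => ?_⟩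
  have h1 : μ = ∑ q ∈ t, mulMeasure (χ q) (hχ q).contMDiffOn μ := by
    ext p
    have h2 : ((∑ q ∈ t, mulMeasure (χ q) (hχ q).contMDiffOn μ :
        smoothMeasure (n := n) (⊤ : Opens M)) : M → ℂ) p = ∑ q ∈ t, χ q p * (μ : M → ℂ) p := by
      rw [AddSubmonoidClass.coe_finsetSum, Finset.sum_apply]
      rfl
    rw [h2, ← Finset.sum_mul]
    by_cases hp : (μ : M → ℂ) p = 0
    · rw [hp, mul_zero]
    · rw [hsum p ⟨e p, (hμ p hp).2, e.left_inv (hμ p hp).1⟩, one_mul]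
  have h4 : T μ = ∑ q ∈ t, T (mulMeasure (χ q) (hχ q).contMDiffOn μ) := by
    conv_lhs => rw [h1]
    rw [map_sum]
  rw [h4, Finset.sum_mul]
  refine (norm_sum_le _ _).trans (Finset.sum_le_sum fun q hq => ?_)
  exact (hC q μ hμ B hB fun m hm => hb m (hm.trans (Finset.le_sup (f := N) hq))).trans
    (mul_le_mul_of_nonneg_right (le_abs_self _) hB)

end Partition

end

/-! ### Holomorphy off the zero set, and smoothness of the weights. -/

section

variable {n : ℕ} {M : Type*} [TopologicalSpace M] [ChartedSpace (Eu n) M]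

/-! ### Evaluation of distributions on densities -/

open Classical in
/-- The value of a distribution on the smooth measure with density `ρ`, and zero if `ρ` is not the
density of a compactly supported smooth measure. -/
def Distr.ev (σ : Distr n (⊤ : Opens M)) (ρ : M → ℂ) : ℂ :=
  if h : ρ ∈ smoothMeasure (n := n) (⊤ : Opens M) then σ ⟨ρ, h⟩ else 0

theorem Distr.ev_of_mem (σ : Distr n (⊤ : Opens M)) {ρ : M → ℂ}
    (h : ρ ∈ smoothMeasure (n := n) (⊤ : Opens M)) : σ.ev ρ = σ ⟨ρ, h⟩ := dif_pos h

theorem mem_smoothMeasure_top {U : Opens M} {ρ : M → ℂ} (h : ρ ∈ smoothMeasure (n := n) U) :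
    ρ ∈ smoothMeasure (n := n) (⊤ : Opens M) := smoothMeasure_mono le_top h

theorem Distr.ev_add (σ : Distr n (⊤ : Opens M)) {ρ ρ' : M → ℂ}
    (h : ρ ∈ smoothMeasure (n := n) (⊤ : Opens M))
    (h' : ρ' ∈ smoothMeasure (n := n) (⊤ : Opens M)) : σ.ev (ρ + ρ') = σ.ev ρ + σ.ev ρ' := by
  rw [σ.ev_of_mem h, σ.ev_of_mem h', σ.ev_of_mem (Submodule.add_mem _ h h')]
  exact σ.toLinearMap.map_add ⟨ρ, h⟩ ⟨ρ', h'⟩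

theorem Distr.ev_smul (σ : Distr n (⊤ : Opens M)) (c : ℂ) {ρ : M → ℂ}
    (h : ρ ∈ smoothMeasure (n := n) (⊤ : Opens M)) : σ.ev (c • ρ) = c * σ.ev ρ := by
  rw [σ.ev_of_mem h, σ.ev_of_mem (Submodule.smul_mem _ c h)]
  exact σ.toLinearMap.map_smul c ⟨ρ, h⟩

theorem Distr.ev_zero (σ : Distr n (⊤ : Opens M)) : σ.ev 0 = 0 := by
  rw [σ.ev_of_mem (Submodule.zero_mem _)]
  exact σ.toLinearMap.map_zero

/-! ### Holomorphic dependence of exponential multipliers -/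

/-- The remainder of the exponential series, divided by the square of the argument. -/
theorem exists_exp_eq : ∃ q : ℂ → ℂ, ContDiff ℝ ∞ q ∧ ∀ w, Complex.exp w = 1 + w + w ^ 2 * q w := by
  have h1 : Differentiable ℂ (dslope Complex.exp 0) := differentiableOn_univ.1
    ((Complex.differentiableOn_dslope Filter.univ_mem).2 Complex.differentiable_exp.differentiableOn)
  have h2 : Differentiable ℂ (dslope (dslope Complex.exp 0) 0) := differentiableOn_univ.1
    ((Complex.differentiableOn_dslope Filter.univ_mem).2 h1.differentiableOn)
  refine ⟨_, (h2.contDiff (n := ∞)).restrict_scalars ℝ, fun w => ?_⟩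
  have h3 := sub_smul_dslope Complex.exp 0 w
  have h4 := sub_smul_dslope (dslope Complex.exp 0) 0 w
  rw [dslope_same, Complex.deriv_exp, Complex.exp_zero] at h4
  rw [Complex.exp_zero] at h3
  simp only [sub_zero, smul_eq_mul] at h3 h4
  linear_combination (-1 : ℂ) * h3 - w * h4

theorem exists_norm_iteratedFDeriv_comp_le {O K : Set (Eu n)} (hO : IsOpen O) (hK : IsCompact K)
    (hKO : K ⊆ O) {A B : Eu n → ℂ} (hA : ContDiffOn ℝ ∞ A O) (hB : ContDiffOn ℝ ∞ B O) {q : ℂ → ℂ}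
    (hq : ContDiff ℝ ∞ q) (N : ℕ) :
    ∃ C : ℝ, 0 ≤ C ∧ ∀ h : ℂ × ℂ, ‖h‖ ≤ 1 → ∀ m ≤ N, ∀ x ∈ K,
      ‖iteratedFDeriv ℝ m (fun y => q (h.1 * A y + h.2 * B y)) x‖ ≤ C := by
  set AB : Eu n → ℂ × ℂ := fun y => (A y, B y) with hAB
  have hABs : ContDiffOn ℝ ∞ AB O := hA.prodMk hB
  have hbd : ∀ i : ℕ, ∃ P : ℝ, ∀ x ∈ K, ‖iteratedFDerivWithin ℝ i AB O x‖ ≤ P := fun i =>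
    hK.exists_bound_of_continuousOn
      ((hABs.continuousOn_iteratedFDerivWithin (m := i) (by exact_mod_cast le_top)
        hO.uniqueDiffOn).mono hKO)
  choose P hP using hbd
  set L : ℂ × ℂ → ℂ × ℂ →L[ℝ] ℂ := fun h =>
    (h.1 • ContinuousLinearMap.fst ℝ ℂ ℂ + h.2 • ContinuousLinearMap.snd ℝ ℂ ℂ) with hL
  have hLn : ∀ h : ℂ × ℂ, ‖h‖ ≤ 1 → ‖L h‖ ≤ 2 := by
    intro h hh
    refine (norm_add_le _ _).trans ?_
    rw [norm_smul, norm_smul]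
    have h1 := (norm_fst_le h).trans hh
    have h2 := (norm_snd_le h).trans hh
    have h3 := ContinuousLinearMap.norm_fst_le ℝ ℂ ℂ
    have h4 := ContinuousLinearMap.norm_snd_le ℝ ℂ ℂ
    have h5 := mul_le_one₀ h1 (norm_nonneg _) h3
    have h6 := mul_le_one₀ h2 (norm_nonneg _) h4
    linarith
  set R : ℝ := 2 * P 0 with hR
  have hbq : ∀ i : ℕ, ∃ Q : ℝ, ∀ w ∈ Metric.closedBall (0 : ℂ) R, ‖iteratedFDeriv ℝ i q w‖ ≤ Q :=
    fun i => (isCompact_closedBall _ _).exists_bound_of_continuousOn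
      (hq.continuous_iteratedFDeriv (m := i) (by exact_mod_cast le_top)).continuousOn
  choose Q hQ using hbq
  set D : ℝ := 1 + ∑ i ∈ Finset.range (N + 1), 2 * |P i| with hD
  have hD1 : 1 ≤ D := le_add_of_nonneg_right (Finset.sum_nonneg fun i _ => by positivity)
  have hPD : ∀ i ≤ N, 2 * |P i| ≤ D := fun i hi => by
    have := Finset.single_le_sum (f := fun i => 2 * |P i|) (fun i _ => by positivity)
      (Finset.mem_range.2 (Nat.lt_succ_of_le hi))
    rw [hD]; linarith
  set E : ℝ := ∑ i ∈ Finset.range (N + 1), |Q i| with hE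
  have hE0 : 0 ≤ E := Finset.sum_nonneg fun i _ => abs_nonneg _
  have hQE : ∀ i ≤ N, Q i ≤ E := fun i hi => (le_abs_self _).trans
    (Finset.single_le_sum (f := fun i => |Q i|) (fun i _ => abs_nonneg _)
      (Finset.mem_range.2 (Nat.lt_succ_of_le hi)))
  refine ⟨N.factorial * E * D ^ N, by positivity, fun h hh m hm x hx => ?_⟩
  have hfun : (fun y => q (h.1 * A y + h.2 * B y)) = q ∘ (L h ∘ AB) := by
    funext y; simp [hL, hAB]
  have hw : ∀ i, ‖iteratedFDerivWithin ℝ i (L h ∘ AB) O x‖ ≤ 2 * P i := fun i =>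
    ((L h).norm_iteratedFDerivWithin_comp_left (hABs x (hKO hx)) hO.uniqueDiffOn (hKO hx)
      (by exact_mod_cast le_top)).trans
      (mul_le_mul (hLn h hh) (hP i x hx) (norm_nonneg _) zero_le_two)
  have hwR : (L h ∘ AB) x ∈ Metric.closedBall (0 : ℂ) R := by
    rw [mem_closedBall_zero_iff]
    have := hw 0
    rwa [norm_iteratedFDerivWithin_zero] at this
  rw [← iteratedFDerivWithin_of_isOpen m hO (hKO hx), hfun]
  refine (norm_iteratedFDerivWithin_comp_le (t := univ) (hq.contDiffOn)
    ((L h).contDiff.comp_contDiffOn hABs) (n := m) (by exact_mod_cast le_top)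
    uniqueDiffOn_univ hO.uniqueDiffOn (mapsTo_univ _ _) (hKO hx) (C := E) (D := D)
    (fun i hi => ?_) (fun i hi1 hi => ?_)).trans ?_
  · rw [iteratedFDerivWithin_univ]
    exact (hQ i _ hwR).trans (hQE i (hi.trans hm))
  · exact (((hw i).trans (mul_le_mul_of_nonneg_left (le_abs_self _) zero_le_two)).trans
      (hPD i (hi.trans hm))).trans (le_self_pow₀ hD1 (by omega))
  · have h2 : (m.factorial : ℝ) ≤ N.factorial := by exact_mod_cast Nat.factorial_le hm
    have h3 : D ^ m ≤ D ^ N := pow_le_pow_right₀ hD1 hm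
    gcongr

theorem contMDiffOn_comp_two {U : Opens M} {a b : M → ℂ}
    (ha : ContMDiffOn 𝓘(ℝ, Eu n) 𝓘(ℝ, ℂ) ∞ a U) (hb : ContMDiffOn 𝓘(ℝ, Eu n) 𝓘(ℝ, ℂ) ∞ b U)
    {q : ℂ → ℂ} (hq : ContDiff ℝ ∞ q) (h : ℂ × ℂ) :
    ContMDiffOn 𝓘(ℝ, Eu n) 𝓘(ℝ, ℂ) ∞ (fun p => q (h.1 * a p + h.2 * b p)) U := by
  have h1 : ContDiff ℝ ∞ (fun w : ℂ × ℂ => q (h.1 * w.1 + h.2 * w.2)) :=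
    hq.comp ((contDiff_const.mul contDiff_fst).add (contDiff_const.mul contDiff_snd))
  exact h1.contMDiff.comp_contMDiffOn (ha.prodMk_space hb)

/-- Bounds the coefficients of the quadratic remainder uniformly for `‖h‖ ≤ 1`: the test densities
range over a bounded set, supported in one fixed compact set. -/
theorem exists_norm_ev_comp_le [T2Space M] (σ : Distr n (⊤ : Opens M)) {U : Opens M} {a b : M → ℂ}
    (ha : ContMDiffOn 𝓘(ℝ, Eu n) 𝓘(ℝ, ℂ) ∞ a U) (hb : ContMDiffOn 𝓘(ℝ, Eu n) 𝓘(ℝ, ℂ) ∞ b U)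
    {q : ℂ → ℂ} (hq : ContDiff ℝ ∞ q) {e : OpenPartialHomeomorph M (Eu n)} (he : IsSmoothChart e)
    {ρ : M → ℂ} (hρ : ρ ∈ smoothMeasure (n := n) U) (hs : tsupport ρ ⊆ e.source) :
    ∃ C : ℝ, ∀ h : ℂ × ℂ, ‖h‖ ≤ 1 →
      ‖σ.ev ((fun p => q (h.1 * a p + h.2 * b p)) * ρ)‖ ≤ C := by
  set K : Set (Eu n) := e '' tsupport ρ with hKdef
  have hK : IsCompact K := hρ.1.image_of_continuousOn (e.continuousOn.mono hs)
  have hKe : K ⊆ e.target := by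
    rintro _ ⟨p, hp, rfl⟩
    exact e.map_source (hs hp)
  set O : Set (Eu n) := e.target ∩ e.symm ⁻¹' (U : Set M) with hO
  have hOo : IsOpen O := e.isOpen_inter_preimage_symm U.isOpen
  have hKO : K ⊆ O := by
    rintro _ ⟨p, hp, rfl⟩
    refine ⟨e.map_source (hs hp), ?_⟩
    rw [mem_preimage, e.left_inv (hs hp)]
    exact hρ.2.1 hp
  obtain ⟨C, N, hC⟩ := σ.continuous' e he K hK hKe fun _ _ => trivial
  obtain ⟨C₁, hC₁0, hC₁⟩ := exists_norm_iteratedFDeriv_comp_le hOo hK hKO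
    (contDiffOn_comp_symm ha he) (contDiffOn_comp_symm hb he) hq N
  obtain ⟨C₂, hC₂0, hC₂⟩ := exists_norm_iteratedFDeriv_mul_le hOo hK hKO
    ((hρ.2.2 e he).mono inter_subset_left) N
  refine ⟨C * (C₂ * C₁), fun h hh => ?_⟩
  have hg := contMDiffOn_comp_two ha hb hq h
  have hmem := mem_smoothMeasure_top (mul_mem_smoothMeasure hg hρ)
  rw [σ.ev_of_mem hmem]
  refine hC ⟨_, hmem⟩ (fun p hp => ?_) _ (mul_nonneg hC₂0 hC₁0) fun m hm x hx => ?_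
  · have hp' : p ∈ tsupport ρ := subset_tsupport _ fun h0 => hp (by simp [h0])
    exact ⟨hs hp', p, hp', rfl⟩
  · simp only [densityCoord_mul]
    have h3 := hC₂ (fun x => q (h.1 * a (e.symm x) + h.2 * b (e.symm x)))
      (contDiffOn_comp_symm hg he) x hx C₁ hC₁0 (fun m hm => hC₁ h hh m hm x hx) m hm
    simp only [mul_comm (densityCoord e ρ _)] at h3
    exact h3

/-- With `w = h₁ a + h₂ b`, the factor `e^w = 1 + w + w² q(w)` expands the value at `z₀ + h` into a
constant, a linear part, and a remainder `O(‖h‖²)`. The Fréchet derivative in both variables is thus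
read off directly. -/
theorem differentiableAt_ev_exp [T2Space M] (σ : Distr n (⊤ : Opens M)) {U : Opens M} {a b : M → ℂ}
    (ha : ContMDiffOn 𝓘(ℝ, Eu n) 𝓘(ℝ, ℂ) ∞ a U) (hb : ContMDiffOn 𝓘(ℝ, Eu n) 𝓘(ℝ, ℂ) ∞ b U)
    {e : OpenPartialHomeomorph M (Eu n)} (he : IsSmoothChart e)
    {ρ : M → ℂ} (hρ : ρ ∈ smoothMeasure (n := n) U) (hs : tsupport ρ ⊆ e.source) (z₀ : ℂ × ℂ) :
    DifferentiableAt ℂ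
      (fun z : ℂ × ℂ => σ.ev ((fun p => Complex.exp (z.1 * a p + z.2 * b p)) * ρ)) z₀ := by
  obtain ⟨q, hq, hexp⟩ := exists_exp_eq
  have hexps : ContDiff ℝ ∞ Complex.exp := Complex.contDiff_exp
  set ρ₀ : M → ℂ := (fun p => Complex.exp (z₀.1 * a p + z₀.2 * b p)) * ρ with hρ₀def
  have hρ₀ : ρ₀ ∈ smoothMeasure (n := n) U :=
    mul_mem_smoothMeasure (contMDiffOn_comp_two ha hb hexps z₀) hρ
  have hs₀ : tsupport ρ₀ ⊆ e.source := tsupport_mul_subset_right.trans hs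
  have hmul : ∀ {g ρ' : M → ℂ}, ContMDiffOn 𝓘(ℝ, Eu n) 𝓘(ℝ, ℂ) ∞ g U →
      ρ' ∈ smoothMeasure (n := n) U ∧ tsupport ρ' ⊆ e.source →
      g * ρ' ∈ smoothMeasure (n := n) U ∧ tsupport (g * ρ') ⊆ e.source := fun hg h =>
    ⟨mul_mem_smoothMeasure hg h.1, tsupport_mul_subset_right.trans h.2⟩
  have ha₀ := hmul ha ⟨hρ₀, hs₀⟩
  have hb₀ := hmul hb ⟨hρ₀, hs₀⟩
  have haa := hmul ha ha₀
  have hab := hmul ha hb₀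
  have hbb := hmul hb hb₀
  obtain ⟨C₁, hC₁⟩ := exists_norm_ev_comp_le σ ha hb hq he haa.1 haa.2
  obtain ⟨C₂, hC₂⟩ := exists_norm_ev_comp_le σ ha hb hq he hab.1 hab.2
  obtain ⟨C₃, hC₃⟩ := exists_norm_ev_comp_le σ ha hb hq he hbb.1 hbb.2
  set F : ℂ × ℂ → ℂ := fun z => σ.ev ((fun p => Complex.exp (z.1 * a p + z.2 * b p)) * ρ) with hF
  set G : ℂ × ℂ → (M → ℂ) → M → ℂ := fun h ρ' => (fun p => q (h.1 * a p + h.2 * b p)) * ρ' with hG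
  have hGm : ∀ h {ρ' : M → ℂ}, ρ' ∈ smoothMeasure (n := n) U →
      G h ρ' ∈ smoothMeasure (n := n) (⊤ : Opens M) := fun h ρ' h' =>
    mem_smoothMeasure_top (mul_mem_smoothMeasure (contMDiffOn_comp_two ha hb hq h) h')
  have hexpand : ∀ h : ℂ × ℂ, F (z₀ + h) = F z₀ + (h.1 * σ.ev (a * ρ₀) + h.2 * σ.ev (b * ρ₀)) +
      (h.1 ^ 2 * σ.ev (G h (a * (a * ρ₀))) + 2 * h.1 * h.2 * σ.ev (G h (a * (b * ρ₀))) +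
        h.2 ^ 2 * σ.ev (G h (b * (b * ρ₀)))) := by
    intro h
    have h1 : (fun p => Complex.exp ((z₀ + h).1 * a p + (z₀ + h).2 * b p)) * ρ =
        ρ₀ + (h.1 • (a * ρ₀) + h.2 • (b * ρ₀)) + (h.1 ^ 2 • G h (a * (a * ρ₀)) +
          (2 * h.1 * h.2) • G h (a * (b * ρ₀)) + h.2 ^ 2 • G h (b * (b * ρ₀))) := by
      funext p
      have h2 : (z₀ + h).1 * a p + (z₀ + h).2 * b p =
          (z₀.1 * a p + z₀.2 * b p) + (h.1 * a p + h.2 * b p) := by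
        simp only [Prod.fst_add, Prod.snd_add]; ring
      simp only [Pi.mul_apply, Pi.add_apply, Pi.smul_apply, smul_eq_mul, hG, hρ₀def]
      rw [h2, Complex.exp_add, hexp (h.1 * a p + h.2 * b p)]
      ring
    have ta := mem_smoothMeasure_top ha₀.1
    have tb := mem_smoothMeasure_top hb₀.1
    have t0 := mem_smoothMeasure_top hρ₀
    have taa := hGm h haa.1
    have tab := hGm h hab.1
    have tbb := hGm h hbb.1
    have sm := fun (c : ℂ) {ρ' : M → ℂ} (h : ρ' ∈ smoothMeasure (n := n) (⊤ : Opens M)) =>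
      Submodule.smul_mem _ c h
    have e1 : F (z₀ + h) = σ.ev _ := congrArg σ.ev h1
    rw [e1, σ.ev_add (Submodule.add_mem _ t0 (Submodule.add_mem _ (sm _ ta) (sm _ tb)))
      (Submodule.add_mem _ (Submodule.add_mem _ (sm _ taa) (sm _ tab)) (sm _ tbb)),
      σ.ev_add t0 (Submodule.add_mem _ (sm _ ta) (sm _ tb)), σ.ev_add (sm _ ta) (sm _ tb),
      σ.ev_add (Submodule.add_mem _ (sm _ taa) (sm _ tab)) (sm _ tbb),
      σ.ev_add (sm _ taa) (sm _ tab), σ.ev_smul _ ta, σ.ev_smul _ tb, σ.ev_smul _ taa,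
      σ.ev_smul _ tab, σ.ev_smul _ tbb]
  set L : ℂ × ℂ →L[ℂ] ℂ := σ.ev (a * ρ₀) • ContinuousLinearMap.fst ℂ ℂ ℂ +
    σ.ev (b * ρ₀) • ContinuousLinearMap.snd ℂ ℂ ℂ with hL
  have hder : HasFDerivAt F L z₀ := by
    rw [hasFDerivAt_iff_isLittleO_nhds_zero]
    refine Asymptotics.IsBigO.trans_isLittleO ?_
      (Asymptotics.isLittleO_norm_pow_id (E' := ℂ × ℂ) one_lt_two)
    refine Asymptotics.IsBigO.of_bound (|C₁| + 2 * |C₂| + |C₃|) ?_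
    filter_upwards [Metric.closedBall_mem_nhds (0 : ℂ × ℂ) one_pos] with h hh
    rw [mem_closedBall_zero_iff] at hh
    have h1 := norm_fst_le h
    have h2 := norm_snd_le h
    have e1 : F (z₀ + h) - F z₀ - L h = h.1 ^ 2 * σ.ev (G h (a * (a * ρ₀))) +
        2 * h.1 * h.2 * σ.ev (G h (a * (b * ρ₀))) + h.2 ^ 2 * σ.ev (G h (b * (b * ρ₀))) := by
      rw [hexpand]
      simp [hL]
      ring
    rw [e1, Real.norm_of_nonneg (by positivity)]
    have k1 : ‖h.1 ^ 2 * σ.ev (G h (a * (a * ρ₀)))‖ ≤ ‖h‖ ^ 2 * |C₁| := by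
      rw [norm_mul, norm_pow]
      have := (hC₁ h hh).trans (le_abs_self _)
      gcongr
    have k2 : ‖2 * h.1 * h.2 * σ.ev (G h (a * (b * ρ₀)))‖ ≤ 2 * ‖h‖ * ‖h‖ * |C₂| := by
      rw [norm_mul, norm_mul, norm_mul, Complex.norm_two]
      have := (hC₂ h hh).trans (le_abs_self _)
      gcongr
    have k3 : ‖h.2 ^ 2 * σ.ev (G h (b * (b * ρ₀)))‖ ≤ ‖h‖ ^ 2 * |C₃| := by
      rw [norm_mul, norm_pow]
      have := (hC₃ h hh).trans (le_abs_self _)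
      gcongr
    refine (norm_add₃_le).trans ?_
    nlinarith [k1, k2, k3]
  exact hder.differentiableAt

theorem differentiable_ev_exp [T2Space M] [SecondCountableTopology M] [IsManifold 𝓘(ℝ, Eu n) ∞ M]
    (σ : Distr n (⊤ : Opens M)) {U : Opens M} {a b : M → ℂ}
    (ha : ContMDiffOn 𝓘(ℝ, Eu n) 𝓘(ℝ, ℂ) ∞ a U) (hb : ContMDiffOn 𝓘(ℝ, Eu n) 𝓘(ℝ, ℂ) ∞ b U)
    {ρ : M → ℂ} (hρ : ρ ∈ smoothMeasure (n := n) U) :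
    Differentiable ℂ
      (fun z : ℂ × ℂ => σ.ev ((fun p => Complex.exp (z.1 * a p + z.2 * b p)) * ρ)) := by
  refine smoothMeasure_induction (U := U) (P := fun μ => Differentiable ℂ (fun z : ℂ × ℂ =>
    σ.ev ((fun p => Complex.exp (z.1 * a p + z.2 * b p)) * (μ : M → ℂ)))) ?_ ?_ ?_ ⟨ρ, hρ⟩
  · simp only [Submodule.coe_zero, mul_zero, σ.ev_zero]
    exact differentiable_const 0
  · intro μ μ' h h'
    have hm : ∀ (z : ℂ × ℂ) (μ : smoothMeasure (n := n) U),
        (fun p => Complex.exp (z.1 * a p + z.2 * b p)) * (μ : M → ℂ) ∈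
          smoothMeasure (n := n) (⊤ : Opens M) := fun z μ =>
      mem_smoothMeasure_top (mul_mem_smoothMeasure
        (contMDiffOn_comp_two ha hb Complex.contDiff_exp z) μ.2)
    simp only [Submodule.coe_add, mul_add, σ.ev_add (hm _ _) (hm _ _)]
    exact h.add h'
  · intro q hq
    refine ⟨(chartAt (Eu n) q).source, (chartAt (Eu n) q).open_source, mem_chart_source _ _,
      fun μ hμ z₀ => ?_⟩
    exact differentiableAt_ev_exp σ ha hb (IsManifold.chart_mem_maximalAtlas _) μ.2 hμ z₀

/-! ### Smoothness of the weights -/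

theorem contMDiffOn_comp_real {f : M → ℝ} (hf : ContMDiff 𝓘(ℝ, Eu n) 𝓘(ℝ, ℝ) ∞ f) {U : Set M}
    {g : ℝ → ℂ} (hg : ∀ p ∈ U, ContDiffAt ℝ ∞ g (f p)) :
    ContMDiffOn 𝓘(ℝ, Eu n) 𝓘(ℝ, ℂ) ∞ (fun p => g (f p)) U := fun p hp =>
  ((hg p hp).contMDiffAt.comp p (hf p)).contMDiffWithinAt

theorem contDiffAt_sgnPow (d : ℕ) {t : ℝ} (ht : t ≠ 0) : ContDiffAt ℝ ∞ (sgnPow d) t := by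
  refine (contDiffAt_const (c := sgnPow d t)).congr_of_eventuallyEq ?_
  rcases lt_or_gt_of_ne ht with h | h
  · filter_upwards [Iio_mem_nhds h] with s hs
    rw [sgnPow, sgnPow, sign_neg h, sign_neg hs]
  · filter_upwards [Ioi_mem_nhds h] with s hs
    rw [sgnPow, sgnPow, sign_pos h, sign_pos hs]

/-- The logarithm of the absolute value, as a complex number. -/
def logAbs (t : ℝ) : ℂ := ((Real.log |t| : ℝ) : ℂ)

theorem contDiffAt_logAbs {t : ℝ} (ht : t ≠ 0) : ContDiffAt ℝ ∞ logAbs t := by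
  have h : logAbs = fun t => ((Real.log t : ℝ) : ℂ) := by
    funext t; rw [logAbs, Real.log_abs]
  rw [h]
  exact Complex.ofRealCLM.contDiff.contDiffAt.comp t (Real.contDiffAt_log.2 ht)

/-- Along the negative real axis the principal logarithm is smooth, although it jumps across that
axis: the argument is constantly `π` there. -/
theorem contDiffAt_log_ofReal {y : ℝ} (hy : y ≠ 0) :
    ContDiffAt ℝ ∞ (fun y : ℝ => Complex.log (y : ℂ)) y := by
  have h1 : ContDiffAt ℝ ∞ (fun t : ℝ => ((Real.log t : ℝ) : ℂ)) y :=
    Complex.ofRealCLM.contDiff.contDiffAt.comp y (Real.contDiffAt_log.2 hy)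
  have h2 : (fun t : ℝ => Complex.log (t : ℂ)) =ᶠ[𝓝 y]
      fun t => ((Real.log t : ℝ) : ℂ) + Complex.arg (y : ℂ) * Complex.I := by
    rcases lt_or_gt_of_ne hy with h | h
    · filter_upwards [Iio_mem_nhds h] with s hs
      rw [Complex.log, Complex.norm_real, Real.norm_eq_abs, Real.log_abs,
        Complex.arg_ofReal_of_neg h, Complex.arg_ofReal_of_neg hs]
    · filter_upwards [Ioi_mem_nhds h] with s hs
      rw [Complex.log, Complex.norm_real, Real.norm_eq_abs, Real.log_abs,
        Complex.arg_ofReal_of_nonneg h.le, Complex.arg_ofReal_of_nonneg (le_of_lt hs)]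
  exact (h1.add contDiffAt_const).congr_of_eventuallyEq h2

theorem log_abs_ne_zero {t : ℝ} (ht : t ≠ 0) (ht1 : |t| ≠ 1) : Real.log |t| ≠ 0 := by
  have h := abs_pos.2 ht
  exact Real.log_ne_zero_of_pos_of_ne_one h ht1

theorem contDiffAt_log_logAbs {t : ℝ} (ht : t ≠ 0) (ht1 : |t| ≠ 1) :
    ContDiffAt ℝ ∞ (fun t => Complex.log (logAbs t)) t := by
  have h1 : ContDiffAt ℝ ∞ (fun t => Real.log |t|) t := by
    simp only [Real.log_abs]
    exact Real.contDiffAt_log.2 ht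
  exact (contDiffAt_log_ofReal (log_abs_ne_zero ht ht1)).comp t h1

theorem wt_eq_exp {t : ℝ} (ht : t ≠ 0) (ht1 : |t| ≠ 1) (δ : ZMod 2) (α β : ℂ) :
    wt δ α β t =
      Complex.exp (α * logAbs t + β * Complex.log (logAbs t)) * sgnPow δ.val t := by
  have h1 : ((|t| : ℝ) : ℂ) ≠ 0 := Complex.ofReal_ne_zero.2 (abs_pos.2 ht).ne'
  have h2 : ((Real.log |t| : ℝ) : ℂ) ≠ 0 := Complex.ofReal_ne_zero.2 (log_abs_ne_zero ht ht1)
  rw [wt, Complex.cpow_def_of_ne_zero h1, Complex.cpow_def_of_ne_zero h2, sgnPow,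
    ← Complex.ofReal_log (abs_nonneg t), Complex.exp_add, logAbs]
  ring_nf

theorem wt_natCast_eq_exp {t : ℝ} (ht : t ≠ 0) (δ : ZMod 2) (α : ℂ) (m : ℕ) :
    wt δ α m t = Complex.exp (α * logAbs t) * (sgnPow δ.val t * logAbs t ^ m) := by
  have h1 : ((|t| : ℝ) : ℂ) ≠ 0 := Complex.ofReal_ne_zero.2 (abs_pos.2 ht).ne'
  rw [wt, Complex.cpow_def_of_ne_zero h1, Complex.cpow_natCast, sgnPow,
    ← Complex.ofReal_log (abs_nonneg t), logAbs]
  ring_nf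

/-- The values of `β` for which the weight is smooth off the zero set of `f`. -/
def IsAdmissible {X : Type*} (f : X → ℝ) (β : ℂ) : Prop := (∀ p, |f p| ≠ 1) ∨ ∃ m : ℕ, β = m

theorem IsAdmissible.contDiffAt_wt {X : Type*} {f : X → ℝ} {β : ℂ} (h : IsAdmissible f β)
    (δ : ZMod 2) (α : ℂ) {p : X} (hp : f p ≠ 0) : ContDiffAt ℝ ∞ (wt δ α β) (f p) := by
  have h0 : ∀ᶠ t in 𝓝 (f p), t ≠ 0 := isOpen_ne.mem_nhds hp
  rcases h with h | ⟨m, rfl⟩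
  · have h1 : ∀ᶠ t in 𝓝 (f p), |t| ≠ 1 :=
      (continuous_abs.continuousAt (x := f p)).eventually_ne (h p)
    refine ((((contDiffAt_const.mul (contDiffAt_logAbs hp)).add (contDiffAt_const.mul
      (contDiffAt_log_logAbs hp (h p)))).cexp).mul
      (contDiffAt_sgnPow δ.val hp)).congr_of_eventuallyEq (f := fun t =>
      Complex.exp (α * logAbs t + β * Complex.log (logAbs t)) * sgnPow δ.val t) ?_
    filter_upwards [h0, h1] with t ht ht1 using wt_eq_exp ht ht1 δ α β
  · refine (((contDiffAt_const.mul (contDiffAt_logAbs hp)).cexp).mul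
      ((contDiffAt_sgnPow δ.val hp).mul ((contDiffAt_logAbs hp).pow m))).congr_of_eventuallyEq
      (f := fun t => Complex.exp (α * logAbs t) * (sgnPow δ.val t * logAbs t ^ m)) ?_
    filter_upwards [h0] with t ht using wt_natCast_eq_exp ht δ α m

theorem IsAdmissible.contMDiffOn_weight {f : M → ℝ} (hf : ContMDiff 𝓘(ℝ, Eu n) 𝓘(ℝ, ℝ) ∞ f) {β : ℂ}
    (h : IsAdmissible f β) (δ : ZMod 2) (α : ℂ) :
    ContMDiffOn 𝓘(ℝ, Eu n) 𝓘(ℝ, ℂ) ∞ (weight f δ α β) (nonzeroSet f hf.continuous) :=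
  contMDiffOn_comp_real hf fun _ hp => h.contDiffAt_wt δ α hp

/-- The weight, cut off near the zero set of `f`. -/
def cutWeight (f : M → ℝ) (δ : ZMod 2) (α β : ℂ) (ν : ℕ) (p : M) : ℂ :=
  (cutoff ν (f p) : ℂ) * wt δ α β (f p)

theorem cutoff_eventually_eq_zero (ν : ℕ) : ∀ᶠ t in 𝓝 (0 : ℝ), cutoff ν t = 0 := by
  have h1 : Filter.Tendsto (fun t : ℝ => (ν : ℝ) ^ 2 * t ^ 2 - 1) (𝓝 0) (𝓝 ((ν : ℝ) ^ 2 * 0 ^ 2 - 1)) :=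
    Continuous.tendsto (by fun_prop) 0
  filter_upwards [h1.eventually_lt_const (u := 0) (by norm_num)] with t ht
  exact Real.smoothTransition.zero_of_nonpos (le_of_lt ht)

theorem cutoff_eq_one {ν : ℕ} {c t : ℝ} (hν : 2 ≤ ν * c) (ht : c ≤ |t|) :
    cutoff ν t = 1 := by
  refine Real.smoothTransition.one_of_one_le ?_
  have h1 : 2 ≤ ν * |t| := hν.trans (by gcongr)
  have h2 : (ν : ℝ) ^ 2 * t ^ 2 = (ν * |t|) ^ 2 := by rw [mul_pow, sq_abs]
  rw [h2]
  nlinarith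

theorem IsAdmissible.contMDiff_cutWeight {f : M → ℝ} (hf : ContMDiff 𝓘(ℝ, Eu n) 𝓘(ℝ, ℝ) ∞ f) {β : ℂ}
    (h : IsAdmissible f β) (δ : ZMod 2) (α : ℂ) (ν : ℕ) :
    ContMDiff 𝓘(ℝ, Eu n) 𝓘(ℝ, ℂ) ∞ (cutWeight f δ α β ν) := by
  rw [← contMDiffOn_univ]
  refine contMDiffOn_comp_real (g := fun t => (cutoff ν t : ℂ) * wt δ α β t) hf fun p _ => ?_
  by_cases hp : f p = 0
  -- Near the zero set the cutoff is identically zero, so the singularity of the weight is not seen.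
  · refine (contDiffAt_const (c := (0 : ℂ))).congr_of_eventuallyEq ?_
    rw [hp]
    filter_upwards [cutoff_eventually_eq_zero ν] with t ht
    rw [ht, Complex.ofReal_zero, zero_mul]
  · exact (Complex.ofRealCLM.contDiff.contDiffAt.comp _ (contDiff_cutoff ν).contDiffAt).mul
      (h.contDiffAt_wt δ α hp)

end

/-! ### Local representations and construction of the extension. -/

section

variable {n : ℕ} {M : Type*} [TopologicalSpace M] [ChartedSpace (Eu n) M]

/-! ### Local representations -/

theorem RegularOn.of_chart [IsManifold 𝓘(ℝ, Eu n) ∞ M] {f : M → ℝ}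
    (hf : ContMDiff 𝓘(ℝ, Eu n) 𝓘(ℝ, ℝ) ∞ f)
    (hcrit : ∀ p : M, f p = 0 → mfderiv 𝓘(ℝ, Eu n) 𝓘(ℝ, ℝ) f p ≠ 0)
    {e : OpenPartialHomeomorph M (Eu n)} (he : IsSmoothChart e) {V : Opens (Eu n)}
    (hV : (V : Set (Eu n)) ⊆ e.target) : RegularOn (fun x => f (e.symm x)) V := by
  have hs : ContDiffOn ℝ ∞ (fun x => f (e.symm x)) V :=
    (hf.comp_contMDiffOn ((contMDiffOn_symm_of_mem_maximalAtlas (I := 𝓘(ℝ, Eu n)) he).mono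
      hV)).contDiffOn
  refine ⟨hs, fun x hx hx0 hd => hcrit (e.symm x) hx0 ?_⟩
  have hp : e.symm x ∈ e.source := e.map_target (hV hx)
  have h1 : f =ᶠ[𝓝 (e.symm x)] (fun x => f (e.symm x)) ∘ e := by
    filter_upwards [e.open_source.mem_nhds hp] with q hq
    rw [Function.comp_apply, e.left_inv hq]
  have h2 : MDifferentiableAt 𝓘(ℝ, Eu n) 𝓘(ℝ, Eu n) e (e.symm x) :=
    ((contMDiffOn_of_mem_maximalAtlas (I := 𝓘(ℝ, Eu n)) he).contMDiffAt
      (e.open_source.mem_nhds hp)).mdifferentiableAt (by simp)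
  have h3 : MDifferentiableAt 𝓘(ℝ, Eu n) 𝓘(ℝ, ℝ) (fun x => f (e.symm x)) (e (e.symm x)) := by
    rw [e.right_inv (hV hx)]
    exact ((hs.contDiffAt (V.isOpen.mem_nhds hx)).differentiableAt (by simp)).mdifferentiableAt
  rw [h1.mfderiv_eq, mfderiv_comp _ h3 h2, e.right_inv (hV hx), mfderiv_eq_fderiv, hd]
  exact ContinuousLinearMap.zero_comp _

/-- The restriction of a differential operator to a smaller open set. -/
def DiffOp.restrict {V W : Opens (Eu n)} (D : DiffOp V) (h : W ≤ V) : DiffOp W where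
  terms := D.terms
  coeff := D.coeff
  smooth w hw := (D.smooth w hw).mono h

/-- The density `ρ` has compact support in the coordinate neighbourhood `e⁻¹(V)`. -/
structure IsLocalDensity (e : OpenPartialHomeomorph M (Eu n)) (V : Opens (Eu n)) (ρ : M → ℂ) :
    Prop where
  mem : ρ ∈ smoothMeasure (n := n) (⊤ : Opens M)
  subset : tsupport ρ ⊆ e.source ∩ e ⁻¹' (V : Set (Eu n))

namespace IsLocalDensity

variable {e : OpenPartialHomeomorph M (Eu n)} {V : Opens (Eu n)} {ρ : M → ℂ}

theorem isCompact (h : IsLocalDensity e V ρ) : IsCompact (e '' tsupport ρ) :=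
  h.mem.1.image_of_continuousOn (e.continuousOn.mono fun _ hp => (h.subset hp).1)

theorem image_subset (h : IsLocalDensity e V ρ) : e '' tsupport ρ ⊆ V := by
  rintro _ ⟨p, hp, rfl⟩
  exact (h.subset hp).2

theorem contDiffOn (h : IsLocalDensity e V ρ) (he : IsSmoothChart e)
    (hVe : (V : Set (Eu n)) ⊆ e.target) : ContDiffOn ℝ ∞ (densityCoord e ρ) V :=
  (h.mem.2.2 e he).mono hVe

theorem eq_zero (hVe : (V : Set (Eu n)) ⊆ e.target) :
    ∀ y ∈ V, y ∉ e '' tsupport ρ → densityCoord e ρ y = 0 := by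
  intro y hy hyK
  have h1 : ρ (e.symm y) = 0 := by
    by_contra h0
    exact hyK ⟨e.symm y, subset_tsupport _ h0, e.right_inv (hVe hy)⟩
  simp [densityCoord, h1]

theorem mul (h : IsLocalDensity e V ρ) {g : M → ℂ} (hg : ContMDiff 𝓘(ℝ, Eu n) 𝓘(ℝ, ℂ) ∞ g) :
    IsLocalDensity e V (g * ρ) :=
  ⟨mul_mem_smoothMeasure hg.contMDiffOn h.mem, tsupport_mul_subset_right.trans h.subset⟩

end IsLocalDensity

/-- A representation of `σ` as a sum of terms `f^k c D h` on a small coordinate neighbourhood. -/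
structure IsLocalRep (f : M → ℝ) (k : ℕ) (σ : Distr n (⊤ : Opens M))
    (e : OpenPartialHomeomorph M (Eu n)) (V : Opens (Eu n)) {N : ℕ}
    (T : Fin N → LocalTerm (fun x => f (e.symm x)) V) : Prop where
  chart : IsSmoothChart e
  subset : (V : Set (Eu n)) ⊆ e.target
  good : IsGoodDomain (fun x => f (e.symm x)) V
  tangential : ∀ j b, ((T j).F b).IsTangential (e.symm ⁻¹' {p | f p = 0})
  eq : ∀ ρ, IsLocalDensity e V ρ → σ.ev ρ = ∑ j, ∫ x in (V : Set (Eu n)), (T j).h x *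
    (T j).D.transpose (fun y => (f (e.symm y) : ℂ) ^ k * (T j).c y * densityCoord e ρ y) x

/-- The definition is brought to normal form on a smaller neighbourhood, where `f^k` divides each
coefficient and the tangential operators have their conjugates by powers of `f`. -/
theorem VanishesToOrder.exists_isLocalRep [IsManifold 𝓘(ℝ, Eu n) ∞ M] {f : M → ℝ}
    (hf : ContMDiff 𝓘(ℝ, Eu n) 𝓘(ℝ, ℝ) ∞ f)
    (hcrit : ∀ p : M, f p = 0 → mfderiv 𝓘(ℝ, Eu n) 𝓘(ℝ, ℝ) f p ≠ 0) {k : ℕ}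
    {σ : Distr n (⊤ : Opens M)} (hσ : VanishesToOrder {p | f p = 0} k σ) {p : M} (hp : f p = 0) :
    ∃ (e : OpenPartialHomeomorph M (Eu n)) (V : Opens (Eu n)) (N : ℕ)
      (T : Fin N → LocalTerm (fun x => f (e.symm x)) V), p ∈ e.source ∧ e p ∈ V ∧
        IsLocalRep f k σ e V T := by
  obtain ⟨e, V₀, he, hpe, hpV₀, hV₀e, N, g, D, h, hg, hD, hh, hrep⟩ := hσ p hp
  obtain ⟨V, hpV, hVV₀, hV⟩ := (RegularOn.of_chart hf hcrit he hV₀e).exists_isGoodDomain hpV₀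
    (by rw [e.left_inv hpe, hp])
  have hVe : (V : Set (Eu n)) ⊆ e.target := fun x hx => hV₀e (hVV₀ hx)
  have hS : ∀ x ∈ V, x ∈ e.symm ⁻¹' {p | f p = 0} ↔ f (e.symm x) = 0 := fun x _ => Iff.rfl
  have hgV : ∀ j, ∃ c : Eu n → ℂ, ContDiffOn ℝ ∞ c V ∧
      ∀ x ∈ V, g j x = (f (e.symm x) : ℂ) ^ k * c x := fun j =>
    (hV.toRegularOn.inIdealPow_iff hS le_rfl).1 fun q hq => by
      obtain ⟨W, hqW, hWV, m, c, u, hc, hu, hu0, heq⟩ := hg j q (hVV₀ hq)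
      exact ⟨W ⊓ V, ⟨hqW, hq⟩, inf_le_right, m, c, u, fun i => (hc i).mono inf_le_left,
        fun i l => (hu i l).mono inf_le_left, fun i l x hx => hu0 i l x hx.1,
        fun x hx => heq x hx.1⟩
  choose c hc hgc using hgV
  have hDV : ∀ j, ((D j).restrict hVV₀).IsTangential (e.symm ⁻¹' {p | f p = 0}) :=
    fun j m W hW u hu => hD j m W (hW.trans hVV₀) u hu
  choose F hFt hF using fun j => hV.toRegularOn.exists_conj hS (hDV j)
  refine ⟨e, V, N, fun j =>
    { D := (D j).restrict hVV₀
      F := F j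
      order := (D j).terms.sup List.length
      c := c j
      h := h j
      conj := hF j
      order_le := fun w hw => Finset.le_sup (f := List.length) hw
      smooth := hc j
      bounded := fun K hK hKV => hh j K hK (hKV.trans hVV₀) }, hpe, hpV,
    { chart := he
      subset := hVe
      good := hV
      tangential := fun j b => hFt j b
      eq := fun ρ hρ => ?_ }⟩
  rw [σ.ev_of_mem hρ.mem, hrep ⟨ρ, hρ.mem⟩ fun q hq => ⟨(hρ.subset hq).1, hVV₀ (hρ.subset hq).2⟩]
  refine Finset.sum_congr rfl fun j _ => ?_
  -- The domain of integration may shrink from `V₀` to `V`, since the test density is supported in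
  -- `V`.
  rw [setIntegral_eq_of_subset_of_forall_sdiff_eq_zero V₀.isOpen.measurableSet (s := V) hVV₀
    fun x hx => ?_]
  · refine setIntegral_congr_fun V.isOpen.measurableSet fun x hx => ?_
    have h1 : (fun y => g j y * densityCoord e ρ y) =ᶠ[𝓝 x] fun y =>
        (f (e.symm y) : ℂ) ^ k * c j y * densityCoord e ρ y := by
      filter_upwards [V.isOpen.mem_nhds hx] with y hy
      rw [hgc j y hy]
    exact congrArg (h j x * ·) ((D j).transpose_congr h1)
  · rw [(D j).transpose_eq_zero hρ.isCompact (fun y hy hyK => ?_) hx.1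
      fun hxK => hx.2 (hρ.image_subset hxK), mul_zero]
    rw [IsLocalDensity.eq_zero (V := V₀) hV₀e y hy hyK, mul_zero]

namespace IsLocalRep

variable {f : M → ℝ} {k : ℕ} {σ : Distr n (⊤ : Opens M)} {e : OpenPartialHomeomorph M (Eu n)}
  {V : Opens (Eu n)} {N : ℕ} {T : Fin N → LocalTerm (fun x => f (e.symm x)) V}

/-- The sequence does not involve `ℓ`: one limit has an expression for each `ℓ` with `Re (α + k - ℓ)
> -1`. The choice `ℓ = 0` gives existence; larger `ℓ` reveal the order of vanishing. -/
theorem tendsto (hT : IsLocalRep f k σ e V T) (hf : ContMDiff 𝓘(ℝ, Eu n) 𝓘(ℝ, ℝ) ∞ f) {β : ℂ}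
    (hβ : IsAdmissible f β) (δ : ZMod 2) (α : ℂ) (ℓ : ℕ) (hα : -1 < (α + k - ℓ).re) {ρ : M → ℂ}
    (hρ : IsLocalDensity e V ρ) :
    Filter.Tendsto (fun ν => σ.ev (cutWeight f δ α β ν * ρ)) Filter.atTop
      (𝓝 (∑ j, (T j).integral (δ.val + k + ℓ) (α + k - ℓ) β
        (fun y => (f (e.symm y) : ℂ) ^ ℓ * densityCoord e ρ y))) := by
  have h1 : ∀ ν, σ.ev (cutWeight f δ α β ν * ρ) = ∑ j, ∫ x in (V : Set (Eu n)), (T j).h x *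
      (T j).D.transpose (fun y => (f (e.symm y) : ℂ) ^ k * (T j).c y *
        ((cutoff ν (f (e.symm y)) : ℂ) * wt δ α β (f (e.symm y)) * densityCoord e ρ y)) x := by
    intro ν
    rw [hT.eq _ (hρ.mul (hβ.contMDiff_cutWeight hf δ α ν)), densityCoord_mul]
    rfl
  simp only [h1]
  refine tendsto_finsetSum _ fun j _ => ?_
  refine (T j).tendsto_integral_cut hT.good hρ.isCompact hρ.image_subset
    (hρ.contDiffOn hT.chart hT.subset) (IsLocalDensity.eq_zero hT.subset) δ α β k ℓ hα fun ν => ?_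
  exact (contDiffOn_comp_symm (U := ⊤) (hβ.contMDiff_cutWeight hf δ α ν).contMDiffOn
    hT.chart).mono fun x hx => ⟨hT.subset hx, trivial⟩

end IsLocalRep

/-! ### Existence of the extension -/

section Limits

variable {f : M → ℝ} {σ : Distr n (⊤ : Opens M)}

theorem cutWeight_mul_eventually_eq (hf : Continuous f) (δ : ZMod 2) (α β : ℂ) {ρ : M → ℂ}
    (hρ : ρ ∈ smoothMeasure (n := n) (nonzeroSet f hf)) :
    ∀ᶠ ν in Filter.atTop, cutWeight f δ α β ν * ρ = weight f δ α β * ρ := by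
  -- By compactness `|f|` is bounded below on the support of `ρ`, and the cutoff equals `1` there
  -- once `ν ≥ 2/c`.
  obtain ⟨c, hc, hcρ⟩ : ∃ c : ℝ, 0 < c ∧ ∀ p ∈ tsupport ρ, c ≤ |f p| := by
    rcases (tsupport ρ).eq_empty_or_nonempty with h0 | h0
    · exact ⟨1, one_pos, fun p hp => by simp [h0] at hp⟩
    · obtain ⟨q, hq, hmin⟩ := IsCompact.exists_isMinOn hρ.1 h0 (hf.abs.continuousOn)
      exact ⟨|f q|, abs_pos.2 (hρ.2.1 hq), fun p hp => hmin hp⟩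
  obtain ⟨ν₀, hν₀⟩ := exists_nat_ge (2 / c)
  filter_upwards [Filter.eventually_ge_atTop ν₀] with ν hν
  funext p
  by_cases hp : p ∈ tsupport ρ
  · have h2 : 2 ≤ (ν : ℝ) * c := by
      have : (ν₀ : ℝ) ≤ ν := by exact_mod_cast hν
      exact (div_le_iff₀ hc).1 (hν₀.trans this)
    simp only [Pi.mul_apply, cutWeight, cutoff_eq_one h2 (hcρ p hp), Complex.ofReal_one, one_mul]
    rfl
  · simp [image_eq_zero_of_notMem_tsupport hp]

theorem tendsto_of_nonzero (hf : Continuous f) (δ : ZMod 2) (α β : ℂ) {ρ : M → ℂ}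
    (hρ : ρ ∈ smoothMeasure (n := n) (nonzeroSet f hf)) :
    Filter.Tendsto (fun ν => σ.ev (cutWeight f δ α β ν * ρ)) Filter.atTop
      (𝓝 (σ.ev (weight f δ α β * ρ))) := by
  refine tendsto_const_nhds.congr' ?_
  filter_upwards [cutWeight_mul_eventually_eq hf δ α β hρ] with ν hν
  rw [hν]

/-- The distribution `τ` is the limit of the products of `σ` with the cut off weights. -/
def IsWeightedLimit (f : M → ℝ) (δ : ZMod 2) (α β : ℂ) (σ τ : Distr n (⊤ : Opens M)) : Prop :=
  ∀ ρ ∈ smoothMeasure (n := n) (⊤ : Opens M),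
    Filter.Tendsto (fun ν => σ.ev (cutWeight f δ α β ν * ρ)) Filter.atTop (𝓝 (τ.ev ρ))

variable [T2Space M] [SecondCountableTopology M] [IsManifold 𝓘(ℝ, Eu n) ∞ M]

/-- To prove a property of all smooth measures, one may treat separately the measures supported
off the zero set of `f`, and those supported in small neighbourhoods of its points. -/
theorem smoothMeasure_induction_zeroSet (hf : ContMDiff 𝓘(ℝ, Eu n) 𝓘(ℝ, ℝ) ∞ f)
    (hcrit : ∀ p : M, f p = 0 → mfderiv 𝓘(ℝ, Eu n) 𝓘(ℝ, ℝ) f p ≠ 0) {k : ℕ}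
    (hσ : VanishesToOrder {p | f p = 0} k σ) {P : (M → ℂ) → Prop} (h0 : P 0)
    (hadd : ∀ ρ ∈ smoothMeasure (n := n) (⊤ : Opens M),
      ∀ ρ' ∈ smoothMeasure (n := n) (⊤ : Opens M), P ρ → P ρ' → P (ρ + ρ'))
    (hoff : ∀ ρ ∈ smoothMeasure (n := n) (nonzeroSet f hf.continuous), P ρ)
    (hnear : ∀ (e : OpenPartialHomeomorph M (Eu n)) (V : Opens (Eu n)) (N : ℕ)
      (T : Fin N → LocalTerm (fun x => f (e.symm x)) V), IsLocalRep f k σ e V T →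
        ∀ ρ, IsLocalDensity e V ρ → P ρ) :
    ∀ ρ ∈ smoothMeasure (n := n) (⊤ : Opens M), P ρ := by
  intro ρ hρ
  refine smoothMeasure_induction (U := ⊤) (P := fun μ => P (μ : M → ℂ)) h0
    (fun μ μ' => hadd _ μ.2 _ μ'.2) (fun q _ => ?_) ⟨ρ, hρ⟩
  by_cases hq : f q = 0
  · obtain ⟨e, V, N, T, hqe, hqV, hT⟩ := hσ.exists_isLocalRep hf hcrit hq
    exact ⟨_, e.isOpen_inter_preimage V.isOpen, ⟨hqe, hqV⟩, fun μ hμ =>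
      hnear e V N T hT _ ⟨μ.2, hμ⟩⟩
  · exact ⟨nonzeroSet f hf.continuous, (nonzeroSet f hf.continuous).isOpen, hq, fun μ hμ =>
      hoff _ ⟨μ.2.1, hμ, μ.2.2.2⟩⟩

theorem exists_tendsto (hf : ContMDiff 𝓘(ℝ, Eu n) 𝓘(ℝ, ℝ) ∞ f)
    (hcrit : ∀ p : M, f p = 0 → mfderiv 𝓘(ℝ, Eu n) 𝓘(ℝ, ℝ) f p ≠ 0) {k : ℕ}
    (hσ : VanishesToOrder {p | f p = 0} k σ) {β : ℂ} (hβ : IsAdmissible f β) (δ : ZMod 2) {α : ℂ}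
    (hα : -(k : ℝ) - 1 < α.re) : ∀ ρ ∈ smoothMeasure (n := n) (⊤ : Opens M),
      ∃ z, Filter.Tendsto (fun ν => σ.ev (cutWeight f δ α β ν * ρ)) Filter.atTop (𝓝 z) := by
  have hm : ∀ ν {ρ : M → ℂ}, ρ ∈ smoothMeasure (n := n) (⊤ : Opens M) →
      cutWeight f δ α β ν * ρ ∈ smoothMeasure (n := n) (⊤ : Opens M) := fun ν ρ h =>
    mul_mem_smoothMeasure (hβ.contMDiff_cutWeight hf δ α ν).contMDiffOn h
  refine smoothMeasure_induction_zeroSet hf hcrit hσ ?_ ?_ ?_ ?_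
  · refine ⟨0, ?_⟩
    simp only [mul_zero, σ.ev_zero]
    exact tendsto_const_nhds
  · rintro ρ hρ ρ' hρ' ⟨z, hz⟩ ⟨z', hz'⟩
    refine ⟨z + z', ?_⟩
    simp only [mul_add, σ.ev_add (hm _ hρ) (hm _ hρ')]
    exact hz.add hz'
  · exact fun ρ hρ => ⟨_, tendsto_of_nonzero hf.continuous δ α β hρ⟩
  · exact fun e V N T hT ρ hρ => ⟨_, hT.tendsto hf hβ δ α 0 (by simp; linarith) hρ⟩

/-- Linearity passes to the limit. Continuity is local: near the zero set it follows from the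
estimate of the local integrals, and elsewhere the limit is `σ` times a smooth function. -/
theorem exists_isWeightedLimit (hf : ContMDiff 𝓘(ℝ, Eu n) 𝓘(ℝ, ℝ) ∞ f)
    (hcrit : ∀ p : M, f p = 0 → mfderiv 𝓘(ℝ, Eu n) 𝓘(ℝ, ℝ) f p ≠ 0) {k : ℕ}
    (hσ : VanishesToOrder {p | f p = 0} k σ) {β : ℂ} (hβ : IsAdmissible f β) (δ : ZMod 2) {α : ℂ}
    (hα : -(k : ℝ) - 1 < α.re) : ∃ τ, IsWeightedLimit f δ α β σ τ := by
  have hm : ∀ ν {ρ : M → ℂ}, ρ ∈ smoothMeasure (n := n) (⊤ : Opens M) →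
      cutWeight f δ α β ν * ρ ∈ smoothMeasure (n := n) (⊤ : Opens M) := fun ν ρ h =>
    mul_mem_smoothMeasure (hβ.contMDiff_cutWeight hf δ α ν).contMDiffOn h
  choose! L hL using exists_tendsto hf hcrit hσ hβ δ hα
  let Λ : smoothMeasure (n := n) (⊤ : Opens M) →ₗ[ℂ] ℂ :=
    { toFun := fun μ => L μ
      map_add' := fun μ μ' => by
        refine tendsto_nhds_unique (hL _ (μ + μ').2) ?_
        simp only [Submodule.coe_add, mul_add, σ.ev_add (hm _ μ.2) (hm _ μ'.2)]
        exact (hL _ μ.2).add (hL _ μ'.2)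
      map_smul' := fun c μ => by
        refine tendsto_nhds_unique (hL _ (c • μ).2) ?_
        simp only [Submodule.coe_smul, mul_smul_comm, σ.ev_smul c (hm _ μ.2)]
        exact (hL _ μ.2).const_mul c }
  suffices hΛ : IsContinuousFunctional ⊤ Λ by
    refine ⟨⟨Λ, hΛ⟩, fun ρ hρ => ?_⟩
    rw [Distr.ev_of_mem _ hρ]
    exact hL ρ hρ
  refine isContinuousFunctional_of_local fun q => ?_
  by_cases hq : f q = 0
  · obtain ⟨e, V, N, T, hqe, hqV, hT⟩ := hσ.exists_isLocalRep hf hcrit hq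
    refine ⟨_, e.isOpen_inter_preimage V.isOpen, ⟨hqe, hqV⟩, fun χ hχ hχs e' he' K' hK' hKe' _ => ?_⟩
    -- Measures supported in the test compact set of the chart `e'`, once multiplied by `χ`, vanish
    -- outside this fixed compact set, which lies in the domain of the local representation.
    set Z : Set M := tsupport χ ∩ e'.symm '' K' with hZ
    have hZc : IsCompact Z := (hK'.image_of_continuousOn
      (e'.continuousOn_symm.mono hKe')).inter_left (isClosed_tsupport χ)
    set K : Set (Eu n) := e '' Z with hK
    have hKc : IsCompact K :=
      hZc.image_of_continuousOn (e.continuousOn.mono fun p hp => (hχs hp.1).1)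
    have hKV : K ⊆ V := by
      rintro _ ⟨p, hp, rfl⟩
      exact (hχs hp.1).2
    have hKe : K ⊆ e.target := hKV.trans hT.subset
    choose C N' hC0 hC using fun j => (T j).exists_norm_integral_le hT.good hKc hKV
      (δ.val + k) (γ := α + k) (by simp; linarith) β
    set N₀ := Finset.univ.sup N' with hN₀
    obtain ⟨C₁, hC₁0, hC₁⟩ := exists_norm_densityCoord_le hT.chart he' hKc hKe hK' hKe' N₀
    obtain ⟨C₂, hC₂0, hC₂⟩ := exists_norm_iteratedFDeriv_mul_le V.isOpen hKc hKV
      ((contDiffOn_comp_symm hχ hT.chart).mono fun x hx => ⟨hT.subset hx, trivial⟩) N₀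
    refine ⟨∑ j, C j * (C₂ * C₁), N₀, fun μ hμ B hB hb => ?_⟩
    have hloc : IsLocalDensity e V (χ * (μ : M → ℂ)) :=
      ⟨mul_mem_smoothMeasure hχ μ.2, tsupport_mul_subset_left.trans hχs⟩
    have h1 := tendsto_nhds_unique (hL _ hloc.mem)
      (hT.tendsto hf hβ δ α 0 (by simp; linarith) hloc)
    have h2 : (Λ ∘ₗ mulMeasure χ hχ) μ = L (χ * (μ : M → ℂ)) := rfl
    rw [h2, h1, Finset.sum_mul]
    refine (norm_sum_le _ _).trans (Finset.sum_le_sum fun j _ => ?_)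
    simp only [pow_zero, one_mul, Nat.cast_zero, sub_zero, add_zero]
    rw [mul_assoc]
    refine hC j _ (hloc.contDiffOn hT.chart hT.subset) (fun y hy hyK => ?_) _ (by positivity)
      fun m hm' x hx => ?_
    · have h3 : (χ * (μ : M → ℂ)) (e.symm y) = 0 := by
        by_contra h0
        refine hyK ⟨e.symm y, ⟨subset_tsupport _ (left_ne_zero_of_mul h0), ?_⟩,
          e.right_inv (hT.subset hy)⟩
        obtain ⟨hs, hK''⟩ := hμ _ (right_ne_zero_of_mul h0)
        exact ⟨_, hK'', e'.left_inv hs⟩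
      simp only [densityCoord, h3, zero_mul]
    · rw [densityCoord_mul, mul_assoc]
      have hmN : m ≤ N₀ := hm'.trans (Finset.le_sup (f := N') (Finset.mem_univ j))
      exact hC₂ _ ((μ.2.2.2 e hT.chart).mono hT.subset) x hx _ (by positivity)
        (fun m' hm'' => hC₁ _ μ.2 hμ B hB hb m' hm'' x hx) m hmN
  · refine ⟨nonzeroSet f hf.continuous, (nonzeroSet f hf.continuous).isOpen, hq,
      fun χ hχ hχs => ?_⟩
    -- Because `χ` is supported off the zero set, its product with the weight is smooth on all of
    -- `M`.
    have hg : ContMDiffOn 𝓘(ℝ, Eu n) 𝓘(ℝ, ℂ) ∞ (weight f δ α β * χ) (⊤ : Opens M) := by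
      intro p _
      by_cases hp : p ∈ tsupport χ
      · have h1 := (hβ.contMDiffOn_weight hf δ α).contMDiffAt
          ((nonzeroSet f hf.continuous).isOpen.mem_nhds (hχs hp))
        have h2 := hχ.contMDiffAt (Filter.univ_mem : (univ : Set M) ∈ 𝓝 p)
        have h3 : ContDiff ℝ ∞ (fun w : ℂ × ℂ => w.1 * w.2) := contDiff_fst.mul contDiff_snd
        exact (h3.contMDiff.contMDiffAt.comp p (h1.prodMk_space h2)).contMDiffWithinAt
      · have h1 : weight f δ α β * χ =ᶠ[𝓝 p] fun _ => 0 := by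
          filter_upwards [(isClosed_tsupport χ).isOpen_compl.mem_nhds hp] with y hy
          rw [Pi.mul_apply, image_eq_zero_of_notMem_tsupport hy, mul_zero]
        exact (contMDiffAt_const.congr_of_eventuallyEq h1).contMDiffWithinAt
    have h1 : Λ ∘ₗ mulMeasure χ hχ = σ.toLinearMap ∘ₗ mulMeasure _ hg := by
      ext μ
      have hmem : χ * (μ : M → ℂ) ∈ smoothMeasure (n := n) (nonzeroSet f hf.continuous) :=
        ⟨(mul_mem_smoothMeasure hχ μ.2).1, tsupport_mul_subset_left.trans hχs,
          (mul_mem_smoothMeasure hχ μ.2).2.2⟩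
      have h2 := tendsto_nhds_unique (hL _ (mem_smoothMeasure_top hmem))
        (tendsto_of_nonzero hf.continuous δ α β hmem)
      have h3 := mul_mem_smoothMeasure hg μ.2
      rw [← mul_assoc, σ.ev_of_mem h3] at h2
      exact h2
    rw [h1]
    exact isContinuousFunctional_mul hg σ

end Limits

end

/-! ### Order of vanishing, uniqueness and holomorphy of the extension. -/

section

variable {n : ℕ} {M : Type*} [TopologicalSpace M] [ChartedSpace (Eu n) M]

/-! ### Properties of the extension -/

theorem Distr.ext_ev {σ τ : Distr n (⊤ : Opens M)}
    (h : ∀ ρ ∈ smoothMeasure (n := n) (⊤ : Opens M), σ.ev ρ = τ.ev ρ) : σ = τ := by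
  have h1 : σ.toLinearMap = τ.toLinearMap := by
    ext μ
    have h2 := h μ μ.2
    rwa [σ.ev_of_mem μ.2, τ.ev_of_mem μ.2] at h2
  cases σ
  cases τ
  simpa using h1

theorem extendsWeighted_iff {f : M → ℝ} (hf : ContMDiff 𝓘(ℝ, Eu n) 𝓘(ℝ, ℝ) ∞ f) {β : ℂ}
    (hβ : IsAdmissible f β) (δ : ZMod 2) (α : ℂ) (σ τ : Distr n (⊤ : Opens M)) :
    ExtendsWeighted f hf.continuous δ α β σ τ ↔
      ∀ ρ ∈ smoothMeasure (n := n) (nonzeroSet f hf.continuous),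
        τ.ev ρ = σ.ev (weight f δ α β * ρ) := by
  have hw := hβ.contMDiffOn_weight hf δ α
  have hev : ∀ μ : smoothMeasure (n := n) (nonzeroSet f hf.continuous),
      (τ.restrict le_top).toLinearMap μ = τ.ev μ ∧
      ((σ.restrict (le_top : nonzeroSet f hf.continuous ≤ ⊤)).mul (weight f δ α β) hw).toLinearMap μ
        = σ.ev (weight f δ α β * (μ : M → ℂ)) := fun μ =>
    ⟨(τ.ev_of_mem (mem_smoothMeasure_top μ.2)).symm,
      (σ.ev_of_mem (mem_smoothMeasure_top (mul_mem_smoothMeasure hw μ.2))).symm⟩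
  constructor
  · rintro ⟨hg, h⟩ ρ hρ
    have h1 := congrArg (fun η => η.toLinearMap ⟨ρ, hρ⟩) h
    exact ((hev ⟨ρ, hρ⟩).1.symm.trans h1).trans (hev ⟨ρ, hρ⟩).2
  · intro h
    refine ⟨hw, ?_⟩
    have h1 : (τ.restrict (le_top : nonzeroSet f hf.continuous ≤ ⊤)).toLinearMap =
        ((σ.restrict (le_top : nonzeroSet f hf.continuous ≤ ⊤)).mul
          (weight f δ α β) hw).toLinearMap := by
      ext μ
      rw [(hev μ).1, (hev μ).2, h μ μ.2]
    unfold IsExtension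
    generalize τ.restrict (le_top : nonzeroSet f hf.continuous ≤ ⊤) = τ₁ at h1 ⊢
    generalize (σ.restrict (le_top : nonzeroSet f hf.continuous ≤ ⊤)).mul
          (weight f δ α β) hw = σ₁ at h1 ⊢
    cases σ₁
    cases τ₁
    simpa using h1

theorem IsWeightedLimit.extendsWeighted {f : M → ℝ} (hf : ContMDiff 𝓘(ℝ, Eu n) 𝓘(ℝ, ℝ) ∞ f) {β : ℂ}
    (hβ : IsAdmissible f β) {δ : ZMod 2} {α : ℂ} {σ τ : Distr n (⊤ : Opens M)}
    (h : IsWeightedLimit f δ α β σ τ) : ExtendsWeighted f hf.continuous δ α β σ τ :=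
  (extendsWeighted_iff hf hβ δ α σ τ).2 fun ρ hρ =>
    tendsto_nhds_unique (h ρ (mem_smoothMeasure_top hρ)) (tendsto_of_nonzero hf.continuous δ α β hρ)

namespace LocalTerm

variable {f : Eu n → ℝ} {V : Opens (Eu n)} (T : LocalTerm f V)

theorem isLocBounded_kernel (hV : IsGoodDomain f V) (d b : ℕ) {γ β : ℂ}
    (h : 0 < γ.re ∨ (β = 0 ∧ 0 ≤ γ.re)) : IsLocBounded V (T.kernel d b γ β) := by
  intro K hK hKV
  obtain ⟨C, hC⟩ : ∃ C : ℝ, ∀ s : ℝ, s ≤ -1 →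
      ‖jetCoeff T.order b (fun j => powJet j γ β) s‖ ≤ C := by
    rcases h with h | ⟨rfl, h⟩
    -- The loss is taken to be `η = Re γ`, which leaves the exponent `0`.
    · obtain ⟨C, hC0, hC⟩ := exists_norm_jetCoeff_le T.order b (max ‖γ‖ ‖β‖) h
      refine ⟨C, fun s hs => ((hC γ β s (le_max_left _ _) (le_max_right _ _) hs).1).trans ?_⟩
      simp
    · obtain ⟨C, hC0, hC⟩ := exists_norm_jetCoeff_zero_right_le T.order b γ
      refine ⟨C, fun s hs => (hC s).trans (mul_le_of_le_one_right hC0 ?_)⟩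
      exact Real.exp_le_one_iff.2 (mul_nonpos_of_nonneg_of_nonpos h (by linarith))
  obtain ⟨H, hH0, hH⟩ := T.exists_ae_bound hK hKV
  refine memLp_top_of_bound (T.aestronglyMeasurable_kernel hV.smooth.continuousOn hK hKV d b γ β)
    (H * (1 * C)) ?_
  filter_upwards [hH, hV.ae_mem_ne_zero hK hKV] with x hx hxK
  rw [kernel, norm_mul, norm_mul]
  have h1 := hC _ (hV.log_le (hKV hxK.1) hxK.2)
  exact mul_le_mul hx (mul_le_mul (norm_sgnPow_le _ _) h1 (norm_nonneg _) zero_le_one)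
    (by positivity) hH0

theorem integral_eq_sum (hV : IsGoodDomain f V) {K : Set (Eu n)} (hK : IsCompact K) (hKV : K ⊆ V)
    {u : Eu n → ℂ} (hu : ContDiffOn ℝ ∞ u V) (hu0 : ∀ y ∈ V, y ∉ K → u y = 0) (d : ℕ) {γ β : ℂ}
    (h : 0 < γ.re ∨ (β = 0 ∧ 0 ≤ γ.re)) :
    T.integral d γ β u = ∑ b ∈ Finset.range (T.order + 1), ∫ x in (V : Set (Eu n)),
      T.kernel d b γ β x * (T.F b).transpose (fun y => T.c y * u y) x := by
  rw [T.integral_eq hK hKV hu0, integral_finsetSum]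
  · refine Finset.sum_congr rfl fun b _ => (setIntegral_eq_of_support hKV fun x hx hxK => ?_).symm
    rw [(T.F b).transpose_eq_zero hK (fun y hy hyK => by rw [hu0 y hy hyK, mul_zero]) hx hxK,
      mul_zero]
  · intro b _
    have h1 : ContinuousOn ((T.F b).transpose fun y => T.c y * u y) K :=
      (contDiffOn_transpose (T.F b) le_rfl (T.smooth.mul hu)).continuousOn.mono hKV
    have h2 : MemLp ((T.F b).transpose fun y => T.c y * u y) 1 (volume.restrict K) :=
      memLp_one_iff_integrable.2 (h1.integrableOn_compact hK)
    exact memLp_one_iff_integrable.1 (h2.mul (T.isLocBounded_kernel hV d b h K hK hKV))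

end LocalTerm

section Order

variable {f : M → ℝ} {σ τ : Distr n (⊤ : Opens M)}

variable [IsManifold 𝓘(ℝ, Eu n) ∞ M]

/-- The limit formula for this `ℓ` has the required shape: coefficients `f^ℓ c`, tangential
operators `F_b`, and kernels that are locally bounded because `Re γ > 0`, or `β = 0` and `Re γ ≥ 0`.
-/
theorem IsWeightedLimit.vanishesToOrder (hf : ContMDiff 𝓘(ℝ, Eu n) 𝓘(ℝ, ℝ) ∞ f)
    (hcrit : ∀ p : M, f p = 0 → mfderiv 𝓘(ℝ, Eu n) 𝓘(ℝ, ℝ) f p ≠ 0) {k : ℕ}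
    (hσ : VanishesToOrder {p | f p = 0} k σ) {β : ℂ} (hβ : IsAdmissible f β) {δ : ZMod 2} {α : ℂ}
    (h : IsWeightedLimit f δ α β σ τ) {ℓ : ℕ}
    (hℓ : (ℓ : ℝ) < α.re + k ∨ (β = 0 ∧ (ℓ : ℝ) ≤ α.re + k)) :
    VanishesToOrder {p | f p = 0} ℓ τ := by
  intro p hp
  obtain ⟨e, V, N, T, hpe, hpV, hT⟩ := hσ.exists_isLocalRep hf hcrit hp
  have hγ : 0 < (α + k - ℓ).re ∨ (β = 0 ∧ 0 ≤ (α + k - ℓ).re) := by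
    simp only [Complex.sub_re, Complex.add_re, Complex.natCast_re]
    rcases hℓ with h | ⟨h, h'⟩
    · exact Or.inl (by linarith)
    · exact Or.inr ⟨h, by linarith⟩
  have hγ' : -1 < (α + k - ℓ).re := by
    rcases hγ with h | ⟨-, h⟩ <;> linarith
  set d := δ.val + k + ℓ with hd
  -- The terms are indexed by pairs of a term and a conjugate `b`, renumbered to match the
  -- definition.
  let I := Σ j : Fin N, Fin ((T j).order + 1)
  let ε : Fin (Fintype.card I) ≃ I := (Fintype.equivFin I).symm
  refine ⟨e, V, hT.chart, hpe, hpV, hT.subset, Fintype.card I,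
    fun i x => (f (e.symm x) : ℂ) ^ ℓ * (T (ε i).1).c x, fun i => (T (ε i).1).F (ε i).2,
    fun i => (T (ε i).1).kernel d (ε i).2 (α + k - ℓ) β, fun i => ?_, fun i => hT.tangential _ _,
    fun i => (T (ε i).1).isLocBounded_kernel hT.good _ _ hγ, fun μ hμ => ?_⟩
  · exact (hT.good.toRegularOn.inIdealPow_iff (fun x _ => Iff.rfl) le_rfl).2
      ⟨_, (T (ε i).1).smooth, fun x _ => rfl⟩
  · have hloc : IsLocalDensity e V (μ : M → ℂ) := ⟨μ.2, hμ⟩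
    have h1 := tendsto_nhds_unique (h _ μ.2) (hT.tendsto hf hβ δ α ℓ hγ' hloc)
    have hu := hloc.contDiffOn hT.chart hT.subset
    rw [τ.ev_of_mem μ.2] at h1
    refine h1.trans ?_
    rw [ε.sum_comp (fun i : I => ∫ x in (V : Set (Eu n)), (T i.1).kernel d i.2 (α + k - ℓ) β x *
      ((T i.1).F i.2).transpose
        (fun y => (f (e.symm y) : ℂ) ^ ℓ * (T i.1).c y * densityCoord e μ y) x),
      Fintype.sum_sigma]
    refine Finset.sum_congr rfl fun j _ => ?_
    rw [(T j).integral_eq_sum hT.good hloc.isCompact hloc.image_subset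
      ((hT.good.smooth_ofReal.pow ℓ).mul hu) (fun y hy hyK => by
        rw [IsLocalDensity.eq_zero hT.subset y hy hyK, mul_zero]) d hγ, Finset.sum_range]
    refine Finset.sum_congr rfl fun b _ => ?_
    have h2 : (fun y => (T j).c y * ((f (e.symm y) : ℂ) ^ ℓ * densityCoord e μ y)) =
        fun y => (f (e.symm y) : ℂ) ^ ℓ * (T j).c y * densityCoord e μ y := by
      funext y; ring
    rw [h2]

variable [T2Space M] [SecondCountableTopology M]

/-- Nothing is concentrated on the zero set: with trivial weight the local integrals return `σ`
itself. -/
theorem VanishesToOrder.isWeightedLimit_self (hf : ContMDiff 𝓘(ℝ, Eu n) 𝓘(ℝ, ℝ) ∞ f)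
    (hcrit : ∀ p : M, f p = 0 → mfderiv 𝓘(ℝ, Eu n) 𝓘(ℝ, ℝ) f p ≠ 0)
    (hσ : VanishesToOrder {p | f p = 0} 0 σ) : IsWeightedLimit f 0 0 0 σ σ := by
  have hβ : IsAdmissible f 0 := Or.inr ⟨0, by simp⟩
  have hm : ∀ ν {ρ : M → ℂ}, ρ ∈ smoothMeasure (n := n) (⊤ : Opens M) →
      cutWeight f 0 0 0 ν * ρ ∈ smoothMeasure (n := n) (⊤ : Opens M) := fun ν ρ h =>
    mul_mem_smoothMeasure (hβ.contMDiff_cutWeight hf 0 0 ν).contMDiffOn h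
  refine smoothMeasure_induction_zeroSet hf hcrit hσ ?_ ?_ ?_ ?_
  · simp only [mul_zero, σ.ev_zero]
    exact tendsto_const_nhds
  · intro ρ hρ ρ' hρ' h h'
    simp only [mul_add, σ.ev_add (hm _ hρ) (hm _ hρ'), σ.ev_add hρ hρ']
    exact h.add h'
  · intro ρ hρ
    have h1 : weight f 0 0 0 * ρ = ρ := by
      funext p
      simp [weight]
    have h2 := tendsto_of_nonzero (σ := σ) hf.continuous 0 0 0 hρ
    rwa [h1] at h2
  · intro e V N T hT ρ hρ
    have h1 := hT.tendsto hf hβ 0 0 0 (by simp) hρ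
    rw [hT.eq ρ hρ]
    convert h1 using 2
    refine Finset.sum_congr rfl fun j _ => ?_
    have h2 := (T j).integral_zero hT.good hρ.isCompact hρ.image_subset
      (hρ.contDiffOn hT.chart hT.subset) (IsLocalDensity.eq_zero hT.subset)
    simpa using h2.symm

/-- Each distribution is the limit of its products with cutoffs, and a cut off test measure is
supported off the zero set. -/
theorem eq_of_eq_on_nonzeroSet (hf : ContMDiff 𝓘(ℝ, Eu n) 𝓘(ℝ, ℝ) ∞ f)
    (hcrit : ∀ p : M, f p = 0 → mfderiv 𝓘(ℝ, Eu n) 𝓘(ℝ, ℝ) f p ≠ 0)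
    (hσ : VanishesToOrder {p | f p = 0} 0 σ) (hτ : VanishesToOrder {p | f p = 0} 0 τ)
    (h : ∀ ρ ∈ smoothMeasure (n := n) (nonzeroSet f hf.continuous), σ.ev ρ = τ.ev ρ) : σ = τ := by
  refine Distr.ext_ev fun ρ hρ => ?_
  refine tendsto_nhds_unique (hσ.isWeightedLimit_self hf hcrit ρ hρ) ?_
  refine (hτ.isWeightedLimit_self hf hcrit ρ hρ).congr fun ν => (h _ ?_).symm
  have hβ : IsAdmissible f 0 := Or.inr ⟨0, by simp⟩
  have h1 := mul_mem_smoothMeasure (hβ.contMDiff_cutWeight hf 0 0 ν).contMDiffOn hρ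
  refine ⟨h1.1, fun p hp => ?_, h1.2.2⟩
  intro hp0
  have h2 : ∀ᶠ q in 𝓝 p, cutoff ν (f q) = 0 := by
    have h3 := hf.continuous.tendsto p
    rw [show f p = 0 from hp0] at h3
    exact h3.eventually (cutoff_eventually_eq_zero ν)
  refine notMem_tsupport_iff_eventuallyEq.2 ?_ hp
  filter_upwards [h2] with q hq
  simp [cutWeight, hq]

/-- The map `g` allows one proof for both cases: the identity of `ℂ × ℂ`, and `α ↦ (α, m)`. -/
theorem IsWeightedLimit.differentiableAt (hf : ContMDiff 𝓘(ℝ, Eu n) 𝓘(ℝ, ℝ) ∞ f)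
    (hcrit : ∀ p : M, f p = 0 → mfderiv 𝓘(ℝ, Eu n) 𝓘(ℝ, ℝ) f p ≠ 0) {k : ℕ}
    (hσ : VanishesToOrder {p | f p = 0} k σ) {δ : ZMod 2} {E : Type*} [NormedAddCommGroup E]
    [NormedSpace ℂ E] {g : E → ℂ × ℂ} {w₀ : E} (hg : DifferentiableAt ℂ g w₀)
    (hg₀ : -(k : ℝ) - 1 < (g w₀).1.re) (hβ : ∀ w, IsAdmissible f (g w).2)
    {τ : E → Distr n (⊤ : Opens M)}
    (hτ : ∀ w, -(k : ℝ) - 1 < (g w).1.re → IsWeightedLimit f δ (g w).1 (g w).2 σ (τ w))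
    (hoff : ∀ ρ ∈ smoothMeasure (n := n) (nonzeroSet f hf.continuous), DifferentiableAt ℂ
      (fun w => σ.ev (weight f δ (g w).1 (g w).2 * ρ)) w₀) :
    ∀ ρ ∈ smoothMeasure (n := n) (⊤ : Opens M), DifferentiableAt ℂ (fun w => (τ w).ev ρ) w₀ := by
  have hopen : ∀ᶠ w in 𝓝 w₀, -(k : ℝ) - 1 < (g w).1.re :=
    (Complex.continuous_re.continuousAt.comp (continuousAt_fst.comp hg.continuousAt)
      ).eventually_const_lt hg₀
  refine smoothMeasure_induction_zeroSet hf hcrit hσ ?_ ?_ ?_ ?_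
  · simp only [Distr.ev_zero]
    exact differentiableAt_const 0
  · intro ρ hρ ρ' hρ' h h'
    simp only [Distr.ev_add _ hρ hρ']
    exact h.add h'
  · intro ρ hρ
    refine (hoff ρ hρ).congr_of_eventuallyEq ?_
    filter_upwards [hopen] with w hw
    exact tendsto_nhds_unique (hτ w hw ρ (mem_smoothMeasure_top hρ))
      (tendsto_of_nonzero hf.continuous δ _ _ hρ)
  · intro e V N T hT ρ hρ
    have h1 : ∀ j, DifferentiableAt ℂ (fun w => (T j).integral (δ.val + k) ((g w).1 + k) (g w).2
        (densityCoord e ρ)) w₀ := fun j =>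
      ((T j).differentiableAt_integral hT.good hρ.isCompact hρ.image_subset
        (hρ.contDiffOn hT.chart hT.subset) (IsLocalDensity.eq_zero hT.subset) (δ.val + k) k
        (z₀ := g w₀) (by simp; linarith)).comp w₀ hg
    refine (DifferentiableAt.fun_sum (u := Finset.univ) fun j _ => h1 j).congr_of_eventuallyEq ?_
    filter_upwards [hopen] with w hw
    have h2 := tendsto_nhds_unique (hτ w hw ρ hρ.mem)
      (hT.tendsto hf (hβ w) δ _ 0 (by simp; linarith) hρ)
    simpa using h2

/-- Holomorphic dependence of the weights on the exponents, off the zero set. -/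
theorem differentiable_ev_weight (hf : ContMDiff 𝓘(ℝ, Eu n) 𝓘(ℝ, ℝ) ∞ f) (h1 : ∀ p, |f p| ≠ 1)
    (δ : ZMod 2) (σ : Distr n (⊤ : Opens M)) {ρ : M → ℂ}
    (hρ : ρ ∈ smoothMeasure (n := n) (nonzeroSet f hf.continuous)) :
    Differentiable ℂ (fun z : ℂ × ℂ => σ.ev (weight f δ z.1 z.2 * ρ)) := by
  have hs := mul_mem_smoothMeasure (contMDiffOn_comp_real hf
    (U := nonzeroSet f hf.continuous) fun p hp => contDiffAt_sgnPow δ.val hp) hρ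
  have h2 := differentiable_ev_exp σ
    (contMDiffOn_comp_real hf (U := nonzeroSet f hf.continuous) fun p hp => contDiffAt_logAbs hp)
    (contMDiffOn_comp_real hf (U := nonzeroSet f hf.continuous) fun p hp =>
      contDiffAt_log_logAbs hp (h1 p)) hs
  convert h2 using 3 with z
  funext p
  by_cases hp : f p = 0
  · have h0 : ρ p = 0 := by
      by_contra h
      exact hρ.2.1 (subset_tsupport _ h) hp
    simp [h0]
  · have h3 : weight f δ z.1 z.2 p = _ := wt_eq_exp hp (h1 p) δ z.1 z.2
    simp only [Pi.mul_apply, h3, mul_assoc]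

theorem differentiable_ev_weight_natCast (hf : ContMDiff 𝓘(ℝ, Eu n) 𝓘(ℝ, ℝ) ∞ f)
    (δ : ZMod 2) (m : ℕ) (σ : Distr n (⊤ : Opens M)) {ρ : M → ℂ}
    (hρ : ρ ∈ smoothMeasure (n := n) (nonzeroSet f hf.continuous)) :
    Differentiable ℂ (fun α : ℂ => σ.ev (weight f δ α m * ρ)) := by
  have hs := mul_mem_smoothMeasure (contMDiffOn_comp_real hf
    (U := nonzeroSet f hf.continuous) fun p hp =>
      (contDiffAt_sgnPow δ.val hp).mul ((contDiffAt_logAbs hp).pow m)) hρ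
  have ha := contMDiffOn_comp_real hf (U := nonzeroSet f hf.continuous) fun p hp =>
    contDiffAt_logAbs hp
  -- Only one exponent varies, so the second parameter is set to `0` and its function is immaterial;
  -- the power `(log |f|)^m` has been moved into the density.
  have h2 := (differentiable_ev_exp σ ha ha hs).comp
    (differentiable_id.prodMk (differentiable_const (0 : ℂ)))
  refine Eq.mp (congrArg (Differentiable ℂ) (funext fun α => ?_)) h2
  refine congrArg σ.ev ?_
  funext p
  by_cases hp : f p = 0
  · have h0 : ρ p = 0 := by
      by_contra h
      exact hρ.2.1 (subset_tsupport _ h) hp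
    simp [h0]
  · have h3 : weight f δ α m p = _ := wt_natCast_eq_exp hp δ α m
    simp [h3, mul_assoc]

end Order

end

/-! ### Families of extensions: existence and uniqueness. -/

section

variable {n : ℕ} {M : Type*} [TopologicalSpace M] [ChartedSpace (Eu n) M]

/-! ### Families of extensions -/

/-- Identity theorem. For `c = -k - 1`, the smaller half-plane `Re α > -k` is where vanishing to
order `0` is guaranteed. -/
theorem eq_of_eq_on_half_plane {c : ℝ} {g g' : ℂ → ℂ} (hg : DifferentiableOn ℂ g {α | c < α.re})
    (hg' : DifferentiableOn ℂ g' {α | c < α.re}) (h : ∀ α : ℂ, c + 1 < α.re → g α = g' α) :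
    ∀ α : ℂ, c < α.re → g α = g' α := by
  have ho : IsOpen {α : ℂ | c < α.re} := isOpen_lt continuous_const Complex.continuous_re
  have hc : IsPreconnected {α : ℂ | c < α.re} := (convex_halfSpace_re_gt c).isPreconnected
  intro α hα
  refine (hg.analyticOnNhd ho).eqOn_of_preconnected_of_eventuallyEq (hg'.analyticOnNhd ho) hc
    (z₀ := ((c + 2 : ℝ) : ℂ)) ?_ ?_ hα
  · change c < ((c + 2 : ℝ) : ℂ).re
    rw [Complex.ofReal_re]; linarith
  · have ho' : IsOpen {α : ℂ | c + 1 < α.re} := isOpen_lt continuous_const Complex.continuous_re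
    filter_upwards [ho'.mem_nhds (x := ((c + 2 : ℝ) : ℂ)) (by
      change c + 1 < ((c + 2 : ℝ) : ℂ).re
      rw [Complex.ofReal_re]; linarith)] with z hz using h z hz

theorem IsExtensionFamily.at {f : M → ℝ} {hf : Continuous f} {σ : Distr n (⊤ : Opens M)} {δ : ZMod 2} {k : ℕ}
    {τ : ℂ → ℂ → Distr n (⊤ : Opens M)} (h : IsExtensionFamily f hf δ k σ τ) (β : ℂ) :
    IsExtensionFamilyAt f hf δ k β σ fun α => τ α β where
  extends_weighted α := h.extends_weighted α β
  order α := h.order α β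
  holomorphic μ := (h.holomorphic μ).comp
    (differentiable_id.prodMk (differentiable_const β)).differentiableOn fun _ hα => hα

open Classical in
/-- The limit of the products of `σ` with the cut off weights, if it exists. -/
def weightedLimit (f : M → ℝ) (δ : ZMod 2) (α β : ℂ) (σ : Distr n (⊤ : Opens M)) :
    Distr n (⊤ : Opens M) :=
  if h : ∃ τ, IsWeightedLimit f δ α β σ τ then h.choose else σ

variable [T2Space M] [SecondCountableTopology M] [IsManifold 𝓘(ℝ, Eu n) ∞ M]

variable {f : M → ℝ} {σ : Distr n (⊤ : Opens M)}

theorem isWeightedLimit_weightedLimit (hf : ContMDiff 𝓘(ℝ, Eu n) 𝓘(ℝ, ℝ) ∞ f)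
    (hcrit : ∀ p : M, f p = 0 → mfderiv 𝓘(ℝ, Eu n) 𝓘(ℝ, ℝ) f p ≠ 0) {k : ℕ}
    (hσ : VanishesToOrder {p | f p = 0} k σ) {β : ℂ} (hβ : IsAdmissible f β) (δ : ZMod 2) {α : ℂ}
    (hα : -(k : ℝ) - 1 < α.re) : IsWeightedLimit f δ α β σ (weightedLimit f δ α β σ) := by
  have h := exists_isWeightedLimit hf hcrit hσ hβ δ hα
  rw [weightedLimit, dif_pos h]
  exact h.choose_spec

theorem eq_of_extendsWeighted (hf : ContMDiff 𝓘(ℝ, Eu n) 𝓘(ℝ, ℝ) ∞ f)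
    (hcrit : ∀ p : M, f p = 0 → mfderiv 𝓘(ℝ, Eu n) 𝓘(ℝ, ℝ) f p ≠ 0) {β : ℂ}
    (hβ : IsAdmissible f β) {δ : ZMod 2} {α : ℂ} {τ τ' : Distr n (⊤ : Opens M)}
    (h : ExtendsWeighted f hf.continuous δ α β σ τ)
    (h' : ExtendsWeighted f hf.continuous δ α β σ τ')
    (hτ : VanishesToOrder {p | f p = 0} 0 τ) (hτ' : VanishesToOrder {p | f p = 0} 0 τ') :
    τ' = τ :=
  eq_of_eq_on_nonzeroSet hf hcrit hτ' hτ fun ρ hρ =>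
    ((extendsWeighted_iff hf hβ δ α σ τ').1 h' ρ hρ).trans
      ((extendsWeighted_iff hf hβ δ α σ τ).1 h ρ hρ).symm

/-- For `Re α > -k` the order condition with `ℓ = 0` already determines the extension; in the
remaining strip only holomorphy does. -/
theorem IsExtensionFamilyAt.eq (hf : ContMDiff 𝓘(ℝ, Eu n) 𝓘(ℝ, ℝ) ∞ f)
    (hcrit : ∀ p : M, f p = 0 → mfderiv 𝓘(ℝ, Eu n) 𝓘(ℝ, ℝ) f p ≠ 0) {β : ℂ}
    (hβ : IsAdmissible f β) {δ : ZMod 2} {k : ℕ} {τ τ' : ℂ → Distr n (⊤ : Opens M)}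
    (h : IsExtensionFamilyAt f hf.continuous δ k β σ τ)
    (h' : IsExtensionFamilyAt f hf.continuous δ k β σ τ') :
    ∀ α : ℂ, -(k : ℝ) - 1 < α.re → τ' α = τ α := by
  intro α hα
  refine Distr.ext_ev fun ρ hρ => ?_
  rw [Distr.ev_of_mem _ hρ, Distr.ev_of_mem _ hρ]
  refine eq_of_eq_on_half_plane (h'.holomorphic ⟨ρ, hρ⟩) (h.holomorphic ⟨ρ, hρ⟩)
    (fun z hz => ?_) α hα
  have hz' : -(k : ℝ) - 1 < z.re := by linarith
  have h0 : ((0 : ℕ) : ℝ) < z.re + k := by push_cast; linarith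
  rw [eq_of_extendsWeighted hf hcrit hβ (h.extends_weighted z hz') (h'.extends_weighted z hz')
    (h.order z hz' 0 (Or.inl h0)) (h'.order z hz' 0 (Or.inl h0))]

theorem isExtensionFamily_weightedLimit (hf : ContMDiff 𝓘(ℝ, Eu n) 𝓘(ℝ, ℝ) ∞ f)
    (hcrit : ∀ p : M, f p = 0 → mfderiv 𝓘(ℝ, Eu n) 𝓘(ℝ, ℝ) f p ≠ 0) {k : ℕ}
    (hσ : VanishesToOrder {p | f p = 0} k σ) (h1 : ∀ p, |f p| ≠ 1) (δ : ZMod 2) :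
    IsExtensionFamily f hf.continuous δ k σ fun α β => weightedLimit f δ α β σ where
  extends_weighted α β hα :=
    (isWeightedLimit_weightedLimit hf hcrit hσ (Or.inl h1) δ hα).extendsWeighted hf (Or.inl h1)
  order α β hα ℓ hℓ := (isWeightedLimit_weightedLimit hf hcrit hσ (Or.inl h1) δ hα).vanishesToOrder
    hf hcrit hσ (Or.inl h1) hℓ
  holomorphic μ := fun z hz => by
    have h2 := IsWeightedLimit.differentiableAt hf hcrit hσ (δ := δ) (g := id) (w₀ := z)
      (τ := fun z => weightedLimit f δ z.1 z.2 σ) differentiableAt_id hz (fun w => Or.inl h1)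
      (fun w hw => isWeightedLimit_weightedLimit hf hcrit hσ (Or.inl h1) δ hw)
      (fun ρ hρ => differentiable_ev_weight hf h1 δ σ hρ z) μ μ.2
    simp only [Distr.ev_of_mem _ μ.2] at h2
    exact h2.differentiableWithinAt

theorem isExtensionFamilyAt_weightedLimit (hf : ContMDiff 𝓘(ℝ, Eu n) 𝓘(ℝ, ℝ) ∞ f)
    (hcrit : ∀ p : M, f p = 0 → mfderiv 𝓘(ℝ, Eu n) 𝓘(ℝ, ℝ) f p ≠ 0) {k : ℕ}
    (hσ : VanishesToOrder {p | f p = 0} k σ) (δ : ZMod 2) (m : ℕ) :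
    IsExtensionFamilyAt f hf.continuous δ k m σ fun α => weightedLimit f δ α m σ where
  extends_weighted α hα :=
    (isWeightedLimit_weightedLimit hf hcrit hσ (Or.inr ⟨m, rfl⟩) δ hα).extendsWeighted hf
      (Or.inr ⟨m, rfl⟩)
  order α hα ℓ hℓ := (isWeightedLimit_weightedLimit hf hcrit hσ (Or.inr ⟨m, rfl⟩) δ
    hα).vanishesToOrder hf hcrit hσ (Or.inr ⟨m, rfl⟩) hℓ
  holomorphic μ := fun z hz => by
    have h2 := IsWeightedLimit.differentiableAt hf hcrit hσ (δ := δ) (g := fun α => (α, (m : ℂ)))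
      (w₀ := z) (τ := fun α => weightedLimit f δ α m σ)
      (differentiableAt_id.prodMk (differentiableAt_const _)) hz (fun w => Or.inr ⟨m, rfl⟩)
      (fun w hw => isWeightedLimit_weightedLimit hf hcrit hσ (Or.inr ⟨m, rfl⟩) δ hw)
      (fun ρ hρ => differentiable_ev_weight_natCast hf δ m σ hρ z) μ μ.2
    simp only [Distr.ev_of_mem _ μ.2] at h2
    exact h2.differentiableWithinAt

theorem exists_natCast_lt (x : ℝ) : ∃ k : ℕ, -(k : ℝ) - 1 < x := by
  obtain ⟨k, hk⟩ := exists_nat_gt (-x)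
  exact ⟨k, by linarith⟩

theorem canonicallyExtendsWeighted_weightedLimit (hf : ContMDiff 𝓘(ℝ, Eu n) 𝓘(ℝ, ℝ) ∞ f)
    (hcrit : ∀ p : M, f p = 0 → mfderiv 𝓘(ℝ, Eu n) 𝓘(ℝ, ℝ) f p ≠ 0)
    (hσ : VanishesToInfiniteOrder {p | f p = 0} σ) {β : ℂ} (hβ : IsAdmissible f β) (δ : ZMod 2)
    (α : ℂ) :
    CanonicallyExtendsWeighted f hf.continuous δ α β σ (weightedLimit f δ α β σ) ∧
      ∀ τ', CanonicallyExtendsWeighted f hf.continuous δ α β σ τ' →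
        τ' = weightedLimit f δ α β σ := by
  have hS : ((nonzeroSet f hf.continuous : Set M))ᶜ = {p | f p = 0} := by
    ext p; simp [nonzeroSet]
  obtain ⟨k, hk⟩ := exists_natCast_lt α.re
  have hlim := isWeightedLimit_weightedLimit hf hcrit (hσ k) hβ δ hk
  obtain ⟨hg, hext⟩ := hlim.extendsWeighted hf hβ
  -- The limit is the same for every `k`, so for each order `ℓ` it may be analysed with a `k` large
  -- enough for that `ℓ`.
  have hord : VanishesToInfiniteOrder {p | f p = 0} (weightedLimit f δ α β σ) := fun ℓ => by
    obtain ⟨k', hk'⟩ := exists_natCast_lt (α.re - ℓ - 1)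
    exact hlim.vanishesToOrder hf hcrit (hσ k') hβ (Or.inl (by linarith))
  refine ⟨⟨hg, hext, by rwa [hS]⟩, ?_⟩
  rintro τ' ⟨hg', hext', hord'⟩
  rw [hS] at hord'
  exact eq_of_extendsWeighted hf hcrit hβ ⟨hg, hext⟩ ⟨hg', hext'⟩ (hord 0) (hord' 0)

end

end DistributionVanishing

end

theorem mainTheorem4 {n : ℕ} {M : Type*} [TopologicalSpace M] [T2Space M]
    [SecondCountableTopology M] [ChartedSpace (Eu n) M] [IsManifold 𝓘(ℝ, Eu n) ∞ M]
    (f : M → ℝ) (hf : ContMDiff 𝓘(ℝ, Eu n) 𝓘(ℝ, ℝ) ∞ f)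
    (hcrit : ∀ p : M, f p = 0 → mfderiv 𝓘(ℝ, Eu n) 𝓘(ℝ, ℝ) f p ≠ 0)
    (δ : ZMod 2) (σ : Distr n (⊤ : Opens M)) :
    -- the case of a distribution vanishing to finite order `k`
    (∀ k : ℕ, VanishesToOrder {p | f p = 0} k σ →
      -- arbitrary complex powers of the logarithm, if `log |f|` has no zeros on `M - S`
      ((∀ p : M, |f p| ≠ 1) →
        ∃ τ : ℂ → ℂ → Distr n (⊤ : Opens M),
          IsExtensionFamily f hf.continuous δ k σ τ ∧
          ∀ τ' : ℂ → ℂ → Distr n (⊤ : Opens M), IsExtensionFamily f hf.continuous δ k σ τ' →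
            ∀ α β : ℂ, -(k : ℝ) - 1 < α.re → τ' α β = τ α β) ∧
      -- powers of the logarithm with exponent a natural number, without restriction on `f`
      (∀ m : ℕ,
        ∃ τ : ℂ → Distr n (⊤ : Opens M),
          IsExtensionFamilyAt f hf.continuous δ k m σ τ ∧
          ∀ τ' : ℂ → Distr n (⊤ : Opens M), IsExtensionFamilyAt f hf.continuous δ k m σ τ' →
            ∀ α : ℂ, -(k : ℝ) - 1 < α.re → τ' α = τ α)) ∧
    -- the case of a distribution vanishing to infinite order
    (VanishesToInfiniteOrder {p | f p = 0} σ →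
      ((∀ p : M, |f p| ≠ 1) →
        ∃ τ : ℂ → ℂ → Distr n (⊤ : Opens M),
          (∀ α β : ℂ, CanonicallyExtendsWeighted f hf.continuous δ α β σ (τ α β) ∧
            ∀ τ' : Distr n (⊤ : Opens M),
              CanonicallyExtendsWeighted f hf.continuous δ α β σ τ' → τ' = τ α β) ∧
          ∀ μ : smoothMeasure (n := n) (⊤ : Opens M),
            Differentiable ℂ (fun z : ℂ × ℂ => τ z.1 z.2 μ)) ∧
      (∀ m : ℕ,
        ∃ τ : ℂ → Distr n (⊤ : Opens M),
          (∀ α : ℂ, CanonicallyExtendsWeighted f hf.continuous δ α m σ (τ α) ∧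
            ∀ τ' : Distr n (⊤ : Opens M),
              CanonicallyExtendsWeighted f hf.continuous δ α m σ τ' → τ' = τ α) ∧
          ∀ μ : smoothMeasure (n := n) (⊤ : Opens M),
            Differentiable ℂ (fun α : ℂ => τ α μ))) := by
  refine ⟨fun k hσ => ⟨fun h1 => ⟨_, isExtensionFamily_weightedLimit hf hcrit hσ h1 δ,
      -- Uniqueness in two variables needs only the identity theorem in `α`, for each fixed `β`.
      fun τ' h' α β hα => IsExtensionFamilyAt.eq hf hcrit (Or.inl h1)
        ((isExtensionFamily_weightedLimit hf hcrit hσ h1 δ).at β) (h'.at β) α hα⟩,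
    fun m => ⟨_, isExtensionFamilyAt_weightedLimit hf hcrit hσ δ m,
      fun τ' h' => IsExtensionFamilyAt.eq hf hcrit (Or.inr ⟨m, rfl⟩)
        (isExtensionFamilyAt_weightedLimit hf hcrit hσ δ m) h'⟩⟩,
    fun hσ => ⟨fun h1 => ⟨fun α β => weightedLimit f δ α β σ, fun α β =>
      canonicallyExtendsWeighted_weightedLimit hf hcrit hσ (Or.inl h1) δ α, fun μ z => ?_⟩,
    fun m => ⟨fun α => weightedLimit f δ α m σ, fun α =>
      canonicallyExtendsWeighted_weightedLimit hf hcrit hσ (Or.inr ⟨m, rfl⟩) δ α, fun μ z => ?_⟩⟩⟩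
  -- Differentiability at `z` follows from the finite order case on a half-space containing `z`.
  · obtain ⟨k, hk⟩ := exists_natCast_lt z.1.re
    refine ((isExtensionFamily_weightedLimit hf hcrit (hσ k) h1 δ).holomorphic μ).differentiableAt
      (IsOpen.mem_nhds ?_ hk)
    exact isOpen_lt continuous_const (Complex.continuous_re.comp continuous_fst)
  · obtain ⟨k, hk⟩ := exists_natCast_lt z.re
    refine ((isExtensionFamilyAt_weightedLimit hf hcrit (hσ k) δ m).holomorphic
      μ).differentiableAt (IsOpen.mem_nhds ?_ hk)
    exact isOpen_lt continuous_const Complex.continuous_re
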